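/- Let $F$ be a totally real number field with set of real embeddings $\mathbf a$, and let $B$ be a totally definite quaternion algebra over $F$. Let $R\subseteq B$ be an $\mathcal O_F$-order of reduced discriminant $\mathfrak N$ such that for every prime $\mathfrak p\mid\mathfrak N$ the Eichler invariant $e(R_{\mathfrak p})$ is nonzero, where $e(R_{\mathfrak p})=1,-1,0$ according as the quotient of $R_{\mathfrak p}$ by its Jacobson radical is $\kappa\times\kappa$, a quadratic field extension of $\kappa$, or $\kappa$, with $\kappa=\mathcal O_F/\mathfrak p$. Let $D\in F$ be totally positive, $K=F(\sqrt{-D})$, and fix an embedding of $F$-algebras $K\hookrightarrow B$ with $\mathcal O_K\subseteq R$. Let $\mathfrak D_K$ be the relative discriminant of $K/F$, put $t_K=[\mathcal O_K^\times:\mathcal O_F^\times]$, and let $\omega(\mathfrak N)$ be the number of primes dividing $\mathfrak N$. Write $\widehat B=\prod'_{\mathfrak p}B_{\mathfrak p}$, $\widehat R=\prod_{\mathfrak p}R_{\mathfrak p}$, and similarly $\widehat F,\widehat K,\widehat{\mathcal O}_K$. For $x\in\widehat B^\times$ let $R_x=B\cap x^{-1}\widehat R x$. Let $N(\widehat R)=\{z\in\widehat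 B^\times: z^{-1}\widehat Rz=\widehat R\}$, $\mathrm{Bil}(R)=\widehat R^\times\backslash N(\widehat R)/\widehat F^\times$ and $\mathrm{cl}(K)=\widehat{\mathcal O}_K^\times\backslash\widehat K^\times/K^\times$. Let $$\widetilde X_D=\{x\in\widehat B^\times:\mathcal O_K\subseteq R_x\},\qquad X_D=\widehat R^\times\backslash\widetilde X_D/K^\times .$$ Right multiplication by $\widehat K^\times$ induces an action of $\mathrm{cl}(K)$ on $X_D$, and left multiplication by $N(\widehat R)$ induces an action of $\mathrm{Bil}(R)$ on $X_D/\mathrm{cl}(K)$. For $\mathbf k=(k_\tau)\in\mathbb Z_{\ge0}^{\mathbf a}$ let $V_{\mathbf k}=\bigotimes_{\tau\in\mathbf a}V_{k_\tau}$, where $V_{k_\tau}$ is the space of complex homogeneous polynomials of degree $k_\tau$ on $W_\tau=B_\tau/F_\tau$ that are harmonic for the positive definite quadratic form $-\mathrm{disc}(y)=4\,\mathrm{nrd}(y)-\mathrm{trd}(y)^2$. Its elements are viewed as polynomials on $\prod_\tau W_\tau$, with right action $(P\cdot\gamma)(y)=P(\gamma y\gamma^{-1})$ of $B^\times$ and the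 invariant Hermitian inner product $\langle\,,\rangle$ (linear in the first variable) for which the monomials $X^m$ in orthonormal coordinates of the $W_\tau$ are orthogonal of square norm $\prod_i m_i!$. Let $\mathcal M_{\mathbf k}(R)$ be the space of functions $\varphi:\widehat B^\times\to V_{\mathbf k}$ with $\varphi(ux\gamma)=\varphi(x)\cdot\gamma$ for $u\in\widehat R^\times$, $\gamma\in B^\times$, and let $\mathcal M_{\mathbf k}(R,\mathbb 1)$ be the subspace of those fixed by $\widehat F^\times$, on which $\mathrm{Bil}(R)$ acts by $(\varphi\cdot z)(x)=\varphi(zx)$. Put $$\langle\varphi,\psi\rangle=\sum_{x\in\widehat R^\times\backslash\widehat B^\times/B^\times}\frac{1}{|R_x^\times/\mathcal O_F^\times|}\langle\varphi(x),\psi(x)\rangle ,\qquad \varphi_{x,v}(y)=\sum_{\gamma\in(B^\times\cap x^{-1}\widehat R^\times y)/\mathcal O_F^\times}v\cdot\gamma .$$ Fix $\omega\in K$ with $\mathrm{disc}(\omega)=\mathrm{Tr}_{K/F}(\omega)^2-4\,\mathrm N_{K/F}(\omega)=-D$. Then: 1. $\mathrm{Bil}(R)\cong(\mathbb Z/2\mathbb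 Z)^{\omega(\mathfrak N)}$. 2. $\mathrm{cl}(K)$ acts freely on $X_D$. 3. $\mathrm{Bil}(R)$ acts transitively on the nonempty set $X_D/\mathrm{cl}(K)$, and this action is free if $\mathfrak D_K$ is coprime to $\mathfrak N$. 4. There is a unique $P_D\in V_{\mathbf k}$ with $P(\omega)=\langle P,P_D\rangle$ for all $P\in V_{\mathbf k}$. Put $$\eta_D=\frac1{t_K}\sum_{x\in X_D}\varphi_{x,P_D},\qquad \psi_{P_D}=\frac1{t_K}\sum_{a\in\mathrm{cl}(K)}\varphi_{a,P_D}.$$ If $\mathfrak D_K$ is coprime to $\mathfrak N$, then $\psi_{P_D}\in\mathcal M_{\mathbf k}(R,\mathbb 1)$, $\eta_D\in\mathcal M_{\mathbf k}(R,\mathbb 1)^{\mathrm{Bil}(R)}$, $$\eta_D=\sum_{z\in\mathrm{Bil}(R)}\psi_{P_D}\cdot z ,$$ and for every $\varphi\in\mathcal M_{\mathbf k}(R,\mathbb 1)^{\mathrm{Bil}(R)}$ $$\langle\varphi,\eta_D\rangle=2^{\omega(\mathfrak N)}\langle\varphi,\psi_{P_D}\rangle .$$ -/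

import Mathlib

open NumberField IsDedekindDomain
open scoped TensorProduct RestrictedProduct Quaternion

noncomputable section

namespace QuatForms

/-! ## Orders, their completions, and adelic points -/

section Adelic

variable {F : Type*} [Field F] [NumberField F] {A : Type*} [Ring A] [Algebra F A]

/-- `R` is an `𝓞 F`-order in the `F`-algebra `A`: a subring that is a full lattice. -/
class IsOrder (R : Subalgebra (𝓞 F) A) : Prop where
  finite : Module.Finite (𝓞 F) R
  span_eq_top : Submodule.span F (R : Set A) = ⊤

variable (F A) in
/-- The completion `A_𝔭 = F_𝔭 ⊗ A`. -/
abbrev LocalAlg (v : HeightOneSpectrum (𝓞 F)) : Type _ := v.adicCompletion F ⊗[F] A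

/-- The completion `R_𝔭 ⊆ A_𝔭`: the `𝓞_𝔭`-algebra generated by (equivalently, since `R` is a
ring, the `𝓞_𝔭`-span of) the image of `R`. -/
def localOrder (R : Subalgebra (𝓞 F) A) (v : HeightOneSpectrum (𝓞 F)) :
    Subalgebra (v.adicCompletionIntegers F) (LocalAlg F A v) :=
  Algebra.adjoin (v.adicCompletionIntegers F)
    ((fun a : A => (1 : v.adicCompletion F) ⊗ₜ[F] a) '' (R : Set A))

/-- The ring `Â = ∏' A_𝔭`, the restricted product being taken with respect to the `R_𝔭`
(the restricted product is the same for all orders `R` of `A`). -/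
abbrev Hat (R : Subalgebra (𝓞 F) A) : Type _ :=
  Πʳ v : HeightOneSpectrum (𝓞 F), [LocalAlg F A v, localOrder R v]

/-- The subring `R̂ = ∏ R_𝔭` of `Â`. -/
def hatOrder (R : Subalgebra (𝓞 F) A) : Subring (Hat R) where
  carrier := {x | ∀ v, x v ∈ localOrder R v}
  mul_mem' := fun ha hb v => mul_mem (ha v) (hb v)
  one_mem' := fun v => one_mem (localOrder R v)
  add_mem' := fun ha hb v => add_mem (ha v) (hb v)
  zero_mem' := fun v => zero_mem (localOrder R v)
  neg_mem' := fun ha v => neg_mem (ha v)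

/-- The group `R̂ˣ`, as a subgroup of `Âˣ`. -/
def hatUnits (R : Subalgebra (𝓞 F) A) : Subgroup (Hat R)ˣ := (hatOrder R).toSubmonoid.units

theorem mem_hatUnits {R : Subalgebra (𝓞 F) A} {u : (Hat R)ˣ} :
    u ∈ hatUnits R ↔ (u : Hat R) ∈ hatOrder R ∧ ((u⁻¹ : (Hat R)ˣ) : Hat R) ∈ hatOrder R :=
  Submonoid.mem_units_iff _ _

theorem one_tmul_mem_localOrder {R : Subalgebra (𝓞 F) A} {a : A} (ha : a ∈ R)
    (v : HeightOneSpectrum (𝓞 F)) :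
    (1 : v.adicCompletion F) ⊗ₜ[F] a ∈ localOrder R v :=
  Algebra.subset_adjoin ⟨a, ha, rfl⟩

theorem eventually_mem_localOrder (R : Subalgebra (𝓞 F) A) [IsOrder R] (a : A) :
    ∀ᶠ v in Filter.cofinite, (1 : HeightOneSpectrum.adicCompletion F v) ⊗ₜ[F] a ∈
      localOrder R v := by
  have ha : a ∈ Submodule.span F (R : Set A) := by
    rw [IsOrder.span_eq_top]; trivial
  induction ha using Submodule.span_induction with
  | mem x hx => exact Filter.Eventually.of_forall fun v => one_tmul_mem_localOrder hx v
  | zero => simp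
  | add x y _ _ hx hy =>
    filter_upwards [hx, hy] with v h1 h2
    rw [TensorProduct.tmul_add]
    exact add_mem h1 h2
  | smul c x _ hx =>
    have hc : ∀ᶠ v : HeightOneSpectrum (𝓞 F) in Filter.cofinite,
        v.valuation F c ≤ 1 := by
      have h := HeightOneSpectrum.Support.finite (𝓞 F) c
      rw [Filter.eventually_cofinite]
      simpa [HeightOneSpectrum.Support] using h
    filter_upwards [hx, hc] with v h1 h2
    have hcv : (algebraMap F (v.adicCompletion F) c) ∈ v.adicCompletionIntegers F := by
      rw [HeightOneSpectrum.mem_adicCompletionIntegers]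
      change Valued.v ((c : F) : v.adicCompletion F) ≤ 1
      rwa [HeightOneSpectrum.valuedAdicCompletion_eq_valuation']
    have key : (1 : v.adicCompletion F) ⊗ₜ[F] (c • x) =
        (⟨_, hcv⟩ : v.adicCompletionIntegers F) • ((1 : v.adicCompletion F) ⊗ₜ[F] x) := by
      rw [← TensorProduct.smul_tmul, TensorProduct.smul_tmul', Algebra.smul_def]
      rfl
    rw [key]
    exact Subalgebra.smul_mem _ h1 _

/-- The diagonal embedding `A → Â`. -/
def diag (R : Subalgebra (𝓞 F) A) [IsOrder R] : A →+* Hat R where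
  toFun a := ⟨fun v => (1 : v.adicCompletion F) ⊗ₜ[F] a, eventually_mem_localOrder R a⟩
  map_one' := rfl
  map_mul' a b := by
    ext v
    change (1 : v.adicCompletion F) ⊗ₜ[F] (a * b) = (1 ⊗ₜ[F] a) * (1 ⊗ₜ[F] b)
    simp
  map_zero' := by
    ext v
    exact TensorProduct.tmul_zero _ _
  map_add' a b := by
    ext v
    exact TensorProduct.tmul_add _ _ _

/-- The diagonal embedding `Aˣ → Âˣ`. -/
abbrev diagUnits (R : Subalgebra (𝓞 F) A) [IsOrder R] : Aˣ →* (Hat R)ˣ :=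
  Units.map (diag R : A →* Hat R)

/-- The embedding `F̂ → Â` of the finite adeles of `F` as scalars. -/
def scalar (R : Subalgebra (𝓞 F) A) : FiniteAdeleRing (𝓞 F) F →+* Hat R where
  toFun c := ⟨fun v => algebraMap (v.adicCompletion F) (LocalAlg F A v) (c v), by
    filter_upwards [c.2] with v hv
    exact (localOrder R v).algebraMap_mem ⟨_, hv⟩⟩
  map_one' := by ext v; exact map_one (algebraMap (v.adicCompletion F) (LocalAlg F A v))
  map_mul' a b := by
    ext v; exact map_mul (algebraMap (v.adicCompletion F) (LocalAlg F A v)) _ _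
  map_zero' := by ext v; exact map_zero (algebraMap (v.adicCompletion F) (LocalAlg F A v))
  map_add' a b := by
    ext v; exact map_add (algebraMap (v.adicCompletion F) (LocalAlg F A v)) _ _

/-- The embedding `F̂ˣ → Âˣ`. -/
abbrev scalarUnits (R : Subalgebra (𝓞 F) A) : (FiniteAdeleRing (𝓞 F) F)ˣ →* (Hat R)ˣ :=
  Units.map (scalar R : FiniteAdeleRing (𝓞 F) F →* Hat R)

theorem scalar_comm (R : Subalgebra (𝓞 F) A) (c : FiniteAdeleRing (𝓞 F) F) (x : Hat R) :
    scalar R c * x = x * scalar R c := by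
  ext v; exact Algebra.commutes (R := v.adicCompletion F) (A := LocalAlg F A v) (c v) (x v)

theorem scalarUnits_comm (R : Subalgebra (𝓞 F) A) (c : (FiniteAdeleRing (𝓞 F) F)ˣ)
    (x : (Hat R)ˣ) : scalarUnits R c * x = x * scalarUnits R c :=
  Units.ext (scalar_comm R c x)

/-! ### The normalizer and the group `Bil(R)` -/

/-- The normalizer `N(R̂) = {z ∈ Âˣ : z⁻¹ R̂ z = R̂}`. -/
def hatNormalizer (R : Subalgebra (𝓞 F) A) : Subgroup (Hat R)ˣ where
  carrier := {z | ∀ y : Hat R, (z : Hat R) * y * ((z⁻¹ : (Hat R)ˣ) : Hat R) ∈ hatOrder R ↔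
    y ∈ hatOrder R}
  one_mem' := by simp
  mul_mem' := by
    intro a b ha hb y
    rw [← hb y, ← ha ((b : Hat R) * y * ((b⁻¹ : (Hat R)ˣ) : Hat R))]
    simp [mul_assoc]
  inv_mem' := by
    intro a ha y
    rw [← ha]
    simp [mul_assoc]

instance hatUnits_normal (R : Subalgebra (𝓞 F) A) :
    ((hatUnits R).subgroupOf (hatNormalizer R)).Normal where
  conj_mem n hn g := by
    rw [Subgroup.mem_subgroupOf, mem_hatUnits] at hn ⊢
    refine ⟨?_, ?_⟩
    · simpa using (g.2 _).2 hn.1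
    · simpa [mul_assoc] using (g.2 _).2 hn.2

instance scalarUnits_normal (R : Subalgebra (𝓞 F) A) :
    ((scalarUnits R).range.subgroupOf (hatNormalizer R)).Normal where
  conj_mem n hn g := by
    rw [Subgroup.mem_subgroupOf] at hn ⊢
    obtain ⟨c, hc⟩ := hn
    refine ⟨c, ?_⟩
    simp only [Subgroup.coe_mul, Subgroup.coe_inv, ← hc]
    rw [← scalarUnits_comm, mul_inv_cancel_right]

/-- The group `Bil(R) = R̂ˣ \ N(R̂) / F̂ˣ`. -/
abbrev Bil (R : Subalgebra (𝓞 F) A) : Type _ :=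
  hatNormalizer R ⧸ ((hatUnits R).subgroupOf (hatNormalizer R) ⊔
    (scalarUnits R).range.subgroupOf (hatNormalizer R))

/-! ### Discriminants and Eichler invariants -/

/-- The reduced trace of a quaternion algebra: half the trace of the regular representation. -/
def reducedTrace (b : A) : F := LinearMap.trace F A (LinearMap.mulLeft F b) / 2

/-- `N` is the reduced discriminant of the order `R` of a quaternion algebra: its square is the
ideal generated by the determinants `det (trd (x_i x_j))` with `x_1, …, x_4 ∈ R`. -/
def IsReducedDiscriminant (R : Subalgebra (𝓞 F) A) (N : Ideal (𝓞 F)) : Prop :=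
  N ^ 2 = Ideal.span {d : 𝓞 F | ∃ x : Fin 4 → A, (∀ i, x i ∈ R) ∧
    (d : F) = Matrix.det (Matrix.of fun i j => (reducedTrace (x i * x j) : F))}

open Classical in
/-- The Eichler invariant of `R_𝔭`, for `𝔭` dividing the reduced discriminant: with `J` the
Jacobson radical of `R_𝔭` and `κ` the residue field, it is `1`, `-1` or `0` according as
`R_𝔭 / J` is `κ × κ`, a quadratic field extension of `κ`, or `κ`. -/
def eichlerInvariant (R : Subalgebra (𝓞 F) A) (v : HeightOneSpectrum (𝓞 F)) : ℤ :=
  if Nonempty ((localOrder R v ⧸ Ring.jacobson (localOrder R v)) ≃ₐ[v.adicCompletionIntegers F]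
      (IsLocalRing.ResidueField (v.adicCompletionIntegers F) ×
        IsLocalRing.ResidueField (v.adicCompletionIntegers F))) then 1
  else if IsField (localOrder R v ⧸ Ring.jacobson (localOrder R v)) ∧
      Nat.card (localOrder R v ⧸ Ring.jacobson (localOrder R v)) =
        Nat.card (IsLocalRing.ResidueField (v.adicCompletionIntegers F)) ^ 2 then -1
  else 0

end Adelic

/-! ## The field `K`, special points -/

section Field

variable (F : Type*) [Field F] [NumberField F] (K : Type*) [Field K] [Algebra F K]

/-- The maximal order `𝓞_K`, as an `𝓞 F`-algebra. -/
abbrev maxOrder : Subalgebra (𝓞 F) K := integralClosure (𝓞 F) K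

instance isOrder_maxOrder [FiniteDimensional F K] : IsOrder (maxOrder F K) where
  finite := IsIntegralClosure.finite (𝓞 F) F K (maxOrder F K)
  span_eq_top := by
    rw [eq_top_iff]
    rintro x -
    have hx : IsAlgebraic (𝓞 F) x :=
      (IsFractionRing.isAlgebraic_iff (𝓞 F) F K).2 (Algebra.IsAlgebraic.isAlgebraic x)
    obtain ⟨y, hy, h⟩ := hx.exists_integral_multiple
    have hy' : algebraMap (𝓞 F) F y ≠ 0 := by simpa using hy
    have : x = (algebraMap (𝓞 F) F y)⁻¹ • (y • x) := by
      rw [← algebraMap_smul F y x, smul_smul, inv_mul_cancel₀ hy', one_smul]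
    rw [this]
    exact Submodule.smul_mem _ _ (Submodule.subset_span h)

instance : CommRing (Hat (maxOrder F K)) where
  mul_comm a b := by
    ext v; exact mul_comm (G := LocalAlg F K v) (a v) (b v)

/-- The relative discriminant ideal `𝔇_K` of a quadratic extension `K/F`. -/
def relDiscriminant : Ideal (𝓞 F) :=
  Ideal.span {d : 𝓞 F | ∃ x : Fin 2 → K, (∀ i, x i ∈ maxOrder F K) ∧
    (d : F) = Algebra.discr F x}

/-- `t_K = [𝓞_Kˣ : 𝓞_Fˣ]`. -/
def unitIndex : ℕ :=
  (Units.map (algebraMap (𝓞 F) (maxOrder F K) : 𝓞 F →* maxOrder F K)).range.index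

/-- `cl(K) = 𝓞̂_Kˣ \ K̂ˣ / Kˣ`. -/
abbrev ClassGp [FiniteDimensional F K] : Type _ :=
  (Hat (maxOrder F K))ˣ ⧸ (hatUnits (maxOrder F K) ⊔ (diagUnits (maxOrder F K)).range)

end Field

section Special

variable {F : Type*} [Field F] [NumberField F] {B : Type*} [Ring B] [Algebra F B]

/-- An embedding `K → B` of `F`-algebras with `𝓞_K ⊆ R`. -/
structure IntegralEmbedding (K : Type*) [Field K] [Algebra F K] (R : Subalgebra (𝓞 F) B) where
  toAlgHom : K →ₐ[F] B
  map_mem : ∀ a ∈ maxOrder F K, toAlgHom a ∈ R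

variable {K : Type*} [Field K] [Algebra F K] {R : Subalgebra (𝓞 F) B}

namespace IntegralEmbedding

/-- The induced map `K_𝔭 → B_𝔭`. -/
def localMap (ι : IntegralEmbedding K R) (v : HeightOneSpectrum (𝓞 F)) :
    LocalAlg F K v →ₐ[v.adicCompletion F] LocalAlg F B v :=
  Algebra.TensorProduct.map (AlgHom.id (v.adicCompletion F) (v.adicCompletion F)) ι.toAlgHom

theorem localMap_mem (ι : IntegralEmbedding K R) (v : HeightOneSpectrum (𝓞 F))
    {x : LocalAlg F K v} (hx : x ∈ localOrder (maxOrder F K) v) :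
    ι.localMap v x ∈ localOrder R v := by
  induction hx using Algebra.adjoin_induction with
  | mem y hy =>
    obtain ⟨a, ha, rfl⟩ := hy
    simpa [localMap] using one_tmul_mem_localOrder (ι.map_mem a ha) v
  | algebraMap r =>
    have : ι.localMap v (algebraMap (v.adicCompletionIntegers F) _ r) =
        algebraMap (v.adicCompletionIntegers F) _ r :=
      (ι.localMap v).commutes (r : v.adicCompletion F)
    rw [this]
    exact (localOrder R v).algebraMap_mem r
  | add y z _ _ hy hz => rw [map_add]; exact add_mem hy hz
  | mul y z _ _ hy hz => rw [map_mul]; exact mul_mem hy hz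

/-- The induced map `K̂ → B̂`. -/
def hatMap (ι : IntegralEmbedding K R) : Hat (maxOrder F K) →+* Hat R where
  toFun x := ⟨fun v => ι.localMap v (x v), by
    filter_upwards [x.2] with v hv using ι.localMap_mem v hv⟩
  map_one' := by ext v; exact map_one (ι.localMap v)
  map_mul' a b := by ext v; exact map_mul (ι.localMap v) _ _
  map_zero' := by ext v; exact map_zero (ι.localMap v)
  map_add' a b := by ext v; exact map_add (ι.localMap v) _ _

/-- The induced map `K̂ˣ → B̂ˣ`. -/
abbrev hatUnitsMap (ι : IntegralEmbedding K R) : (Hat (maxOrder F K))ˣ →* (Hat R)ˣ :=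
  Units.map (ι.hatMap : Hat (maxOrder F K) →* Hat R)

theorem hatMap_diag [FiniteDimensional F K] [IsOrder R] (ι : IntegralEmbedding K R) (a : K) :
    ι.hatMap (diag (maxOrder F K) a) = diag R (ι.toAlgHom a) := by
  ext v
  change ι.localMap v (1 ⊗ₜ[F] a) = 1 ⊗ₜ[F] ι.toAlgHom a
  simp [localMap]

theorem hatMap_scalar (ι : IntegralEmbedding K R) (c : FiniteAdeleRing (𝓞 F) F) :
    ι.hatMap (scalar (maxOrder F K) c) = scalar R c := by
  ext v
  exact (ι.localMap v).commutes (c v)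

end IntegralEmbedding

/-- `R_x = B ∩ x⁻¹ R̂ x`. -/
def orderAt (R : Subalgebra (𝓞 F) B) [IsOrder R] (x : (Hat R)ˣ) : Set B :=
  {b | (x : Hat R) * diag R b * ((x⁻¹ : (Hat R)ˣ) : Hat R) ∈ hatOrder R}

variable [FiniteDimensional F K] [IsOrder R]

/-- `X̃_D = {x ∈ B̂ˣ : 𝓞_K ⊆ R_x}`. -/
def specialSet (ι : IntegralEmbedding K R) : Set (Hat R)ˣ :=
  {x | ∀ a ∈ maxOrder F K, ι.toAlgHom a ∈ orderAt R x}

/-- For `x ∈ X̃_D` one has `x 𝓞̂_K x⁻¹ ⊆ R̂`. -/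
theorem conj_hatOrder_mem (ι : IntegralEmbedding K R) {x : (Hat R)ˣ} (hx : x ∈ specialSet ι)
    {y : Hat (maxOrder F K)} (hy : y ∈ hatOrder (maxOrder F K)) :
    (x : Hat R) * ι.hatMap y * ((x⁻¹ : (Hat R)ˣ) : Hat R) ∈ hatOrder R := by
  intro v
  have hxv : (x : Hat R) v * ((x⁻¹ : (Hat R)ˣ) : Hat R) v = 1 := by
    rw [← RestrictedProduct.mul_apply, Units.mul_inv]; rfl
  have hxv' : ((x⁻¹ : (Hat R)ˣ) : Hat R) v * (x : Hat R) v = 1 := by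
    rw [← RestrictedProduct.mul_apply, Units.inv_mul]; rfl
  change (x : Hat R) v * ι.localMap v (y v) * ((x⁻¹ : (Hat R)ˣ) : Hat R) v ∈ localOrder R v
  have hyv : y v ∈ localOrder (maxOrder F K) v := hy v
  generalize y v = w at hyv
  induction hyv using Algebra.adjoin_induction with
  | mem z hz =>
    obtain ⟨a, ha, rfl⟩ := hz
    have h := hx a ha v
    have e : ι.localMap v ((1 : v.adicCompletion F) ⊗ₜ[F] a) = diag R (ι.toAlgHom a) v := by
      simp only [IntegralEmbedding.localMap, Algebra.TensorProduct.map_tmul, map_one]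
      rfl
    rw [e]
    exact h
  | algebraMap r =>
    have h1 : ι.localMap v (algebraMap (v.adicCompletionIntegers F) _ r) =
        algebraMap (v.adicCompletionIntegers F) _ r :=
      (ι.localMap v).commutes (r : v.adicCompletion F)
    rw [h1, ← Algebra.commutes, mul_assoc, hxv, mul_one]
    exact (localOrder R v).algebraMap_mem r
  | add z w _ _ hz hw =>
    rw [map_add, mul_add, add_mul]; exact add_mem hz hw
  | mul z w _ _ hz hw =>
    have h2 := mul_mem hz hw
    rw [map_mul]
    convert h2 using 1
    simp only [mul_assoc]
    rw [← mul_assoc (((x⁻¹ : (Hat R)ˣ) : Hat R) v) ((x : Hat R) v), hxv', one_mul]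

/-- The equivalence relation defining `X_D = R̂ˣ \ X̃_D / Kˣ`. -/
def specialSetoid (ι : IntegralEmbedding K R) : Setoid (specialSet ι) where
  r x y := ∃ u ∈ hatUnits R, ∃ c : Kˣ,
    (y : (Hat R)ˣ) = u * x * ι.hatUnitsMap (diagUnits (maxOrder F K) c)
  iseqv :=
    { refl := fun x => ⟨1, one_mem _, 1, by simp⟩
      symm := by
        rintro x y ⟨u, hu, c, h⟩
        refine ⟨u⁻¹, inv_mem hu, c⁻¹, ?_⟩
        rw [h, map_inv, map_inv]
        group
      trans := by
        rintro x y z ⟨u, hu, c, h⟩ ⟨u', hu', c', h'⟩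
        refine ⟨u' * u, mul_mem hu' hu, c * c', ?_⟩
        rw [h', h, map_mul, map_mul]
        group }

/-- The set of special points `X_D = R̂ˣ \ X̃_D / Kˣ`. -/
def SpecialPoints (ι : IntegralEmbedding K R) : Type _ := Quotient (specialSetoid ι)

theorem mul_hatUnitsMap_mem (ι : IntegralEmbedding K R) {x : (Hat R)ˣ} (hx : x ∈ specialSet ι)
    (a : (Hat (maxOrder F K))ˣ) : x * ι.hatUnitsMap a ∈ specialSet ι := by
  intro b hb
  have h := hx b hb
  change ((x * ι.hatUnitsMap a : (Hat R)ˣ) : Hat R) * _ *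
    (((x * ι.hatUnitsMap a)⁻¹ : (Hat R)ˣ) : Hat R) ∈ hatOrder R
  have e : ((ι.hatUnitsMap a : (Hat R)ˣ) : Hat R) * diag R (ι.toAlgHom b) *
      (((ι.hatUnitsMap a)⁻¹ : (Hat R)ˣ) : Hat R) = diag R (ι.toAlgHom b) := by
    rw [← ι.hatMap_diag]
    have : ((ι.hatUnitsMap a : (Hat R)ˣ) : Hat R) * ι.hatMap (diag (maxOrder F K) b) =
        ι.hatMap (diag (maxOrder F K) b) * ((ι.hatUnitsMap a : (Hat R)ˣ) : Hat R) := by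
      change ι.hatMap a * ι.hatMap _ = ι.hatMap _ * ι.hatMap a
      rw [← map_mul, mul_comm, map_mul]
    rw [this, Units.mul_inv_cancel_right]
  have e2 : ((x * ι.hatUnitsMap a : (Hat R)ˣ) : Hat R) * diag R (ι.toAlgHom b) *
      (((x * ι.hatUnitsMap a)⁻¹ : (Hat R)ˣ) : Hat R) =
      (x : Hat R) * diag R (ι.toAlgHom b) * ((x⁻¹ : (Hat R)ˣ) : Hat R) := by
    conv_rhs => rw [← e]
    rw [mul_inv_rev, Units.val_mul, Units.val_mul]
    simp only [mul_assoc]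
  rw [e2]
  exact h

theorem normalizer_mul_mem (ι : IntegralEmbedding K R) {x : (Hat R)ˣ} (hx : x ∈ specialSet ι)
    (z : hatNormalizer R) : (z : (Hat R)ˣ) * x ∈ specialSet ι := by
  intro b hb
  have h := (z.2 _).2 (hx b hb)
  change (((z : (Hat R)ˣ) * x : (Hat R)ˣ) : Hat R) * _ *
    ((((z : (Hat R)ˣ) * x)⁻¹ : (Hat R)ˣ) : Hat R) ∈ hatOrder R
  rw [mul_inv_rev, Units.val_mul, Units.val_mul]
  simpa only [mul_assoc] using h

/-- The action of `K̂ˣ` on `X_D` by right multiplication. -/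
instance (ι : IntegralEmbedding K R) : MulAction (Hat (maxOrder F K))ˣ (SpecialPoints ι) where
  smul a := Quotient.map' (s₁ := specialSetoid ι) (s₂ := specialSetoid ι)
    (fun x => ⟨x * ι.hatUnitsMap a, mul_hatUnitsMap_mem ι x.2 a⟩) (by
      rintro x y ⟨u, hu, c, h⟩
      refine ⟨u, hu, c, ?_⟩
      change (y : (Hat R)ˣ) * _ = u * (x * _) * _
      rw [h, mul_assoc (u * x : (Hat R)ˣ), ← map_mul, mul_comm _ a, map_mul]
      simp only [mul_assoc])
  one_smul p := by
    induction p using Quotient.inductionOn' with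
    | h x => exact congrArg (Quotient.mk'' (s₁ := specialSetoid ι)) (Subtype.ext (by simp))
  mul_smul a b p := by
    induction p using Quotient.inductionOn' with
    | h x =>
      refine congrArg (Quotient.mk'' (s₁ := specialSetoid ι)) (Subtype.ext ?_)
      change (x : (Hat R)ˣ) * ι.hatUnitsMap (a * b) = x * ι.hatUnitsMap b * ι.hatUnitsMap a
      rw [mul_comm a b, map_mul, mul_assoc]

/-- The action of `K̂ˣ` on `X_D` descends to `cl(K)`. -/
def classPerm (ι : IntegralEmbedding K R) : ClassGp F K →* Equiv.Perm (SpecialPoints ι) :=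
  QuotientGroup.lift _ (MulAction.toPermHom (Hat (maxOrder F K))ˣ (SpecialPoints ι)) (by
    rw [sup_le_iff]
    refine ⟨fun a ha => ?_, ?_⟩
    · ext p
      induction p using Quotient.inductionOn' with
      | h x =>
        refine Quotient.sound' (s₁ := specialSetoid ι) ?_
        refine (specialSetoid ι).symm ⟨x * ι.hatUnitsMap a * (x : (Hat R)ˣ)⁻¹, ?_, 1, ?_⟩
        · rw [mem_hatUnits] at ha ⊢
          refine ⟨conj_hatOrder_mem ι x.2 ha.1, ?_⟩
          have h := conj_hatOrder_mem ι x.2 ha.2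
          have e : (((x : (Hat R)ˣ) * ι.hatUnitsMap a * (x : (Hat R)ˣ)⁻¹)⁻¹ : (Hat R)ˣ) =
              x * ι.hatUnitsMap a⁻¹ * (x : (Hat R)ˣ)⁻¹ := by
            rw [map_inv]; group
          rw [e]
          exact h
        · change (x : (Hat R)ˣ) * ι.hatUnitsMap a = _
          simp
    · rintro _ ⟨c, rfl⟩
      ext p
      induction p using Quotient.inductionOn' with
      | h x =>
        refine Quotient.sound' (s₁ := specialSetoid ι) ?_
        refine (specialSetoid ι).symm ⟨1, one_mem _, c, ?_⟩
        rw [one_mul])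

/-- The action of `cl(K)` on `X_D` induced by right multiplication. -/
instance classAction (ι : IntegralEmbedding K R) : MulAction (ClassGp F K) (SpecialPoints ι) :=
  MulAction.compHom _ (classPerm ι)

/-- The action of `N(R̂)` on `X_D` by left multiplication. -/
instance normalizerAction (ι : IntegralEmbedding K R) :
    MulAction (hatNormalizer R) (SpecialPoints ι) where
  smul z := Quotient.map' (s₁ := specialSetoid ι) (s₂ := specialSetoid ι)
    (fun x => ⟨z * x, normalizer_mul_mem ι x.2 z⟩) (by
      rintro x y ⟨u, hu, c, h⟩
      have hn := (hatUnits_normal R).conj_mem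
        (⟨u, fun w => ?_⟩ : hatNormalizer R) (by rwa [Subgroup.mem_subgroupOf]) z
      · refine ⟨_, hn, c, ?_⟩
        change (z : (Hat R)ˣ) * y = (z * u * (z : (Hat R)ˣ)⁻¹) * (z * x) * _
        rw [h]
        group
      · rw [mem_hatUnits] at hu
        constructor
        · intro hw
          have := mul_mem (mul_mem hu.2 hw) hu.1
          simpa [mul_assoc] using this
        · intro hw
          exact mul_mem (mul_mem hu.1 hw) hu.2)
  one_smul p := by
    induction p using Quotient.inductionOn' with
    | h x => exact congrArg (Quotient.mk'' (s₁ := specialSetoid ι)) (Subtype.ext (by simp))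
  mul_smul a b p := by
    induction p using Quotient.inductionOn' with
    | h x =>
      refine congrArg (Quotient.mk'' (s₁ := specialSetoid ι)) (Subtype.ext ?_)
      change ((a * b : hatNormalizer R) : (Hat R)ˣ) * x = a * (b * x)
      rw [Subgroup.coe_mul, mul_assoc]

theorem normalizer_smul_comm (ι : IntegralEmbedding K R) (z : hatNormalizer R)
    (a : ClassGp F K) (p : SpecialPoints ι) : z • a • p = a • z • p := by
  induction a using QuotientGroup.induction_on with
  | H a =>
    induction p using Quotient.inductionOn' with
    | h x =>
      refine congrArg (Quotient.mk'' (s₁ := specialSetoid ι)) (Subtype.ext ?_)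
      change (z : (Hat R)ˣ) * (x * ι.hatUnitsMap a) = z * x * ι.hatUnitsMap a
      rw [mul_assoc]

/-- The quotient `X_D / cl(K)`. -/
abbrev SpecialClasses (ι : IntegralEmbedding K R) : Type _ :=
  MulAction.orbitRel.Quotient (ClassGp F K) (SpecialPoints ι)

/-- The action of `N(R̂)` on `X_D / cl(K)`. -/
instance normalizerClassAction (ι : IntegralEmbedding K R) :
    MulAction (hatNormalizer R) (SpecialClasses ι) where
  smul z := Quotient.map' (fun p => z • p) (by
    rintro p q ⟨a, rfl⟩
    exact ⟨a, (normalizer_smul_comm ι z a q).symm⟩)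
  one_smul p := by
    induction p using Quotient.inductionOn' with
    | h x => exact congrArg Quotient.mk'' (one_smul _ x)
  mul_smul a b p := by
    induction p using Quotient.inductionOn' with
    | h x => exact congrArg Quotient.mk'' (mul_smul a b x)

/-- The action of `N(R̂)` on `X_D / cl(K)` descends to `Bil(R)`. -/
def bilPerm (ι : IntegralEmbedding K R) : Bil R →* Equiv.Perm (SpecialClasses ι) :=
  QuotientGroup.lift _ (MulAction.toPermHom (hatNormalizer R) (SpecialClasses ι)) (by
    rw [sup_le_iff]
    refine ⟨fun z hz => ?_, fun z hz => ?_⟩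
    · ext p
      induction p using Quotient.inductionOn' with
      | h p =>
        refine congrArg Quotient.mk'' ?_
        induction p using Quotient.inductionOn' with
        | h x =>
          exact Quotient.sound' (s₁ := specialSetoid ι)
            ((specialSetoid ι).symm ⟨z, hz, 1, by simp⟩)
    · rw [Subgroup.mem_subgroupOf] at hz
      obtain ⟨c, hc⟩ := hz
      ext p
      induction p using Quotient.inductionOn' with
      | h p =>
        refine Quotient.sound' ⟨QuotientGroup.mk (scalarUnits (maxOrder F K) c), ?_⟩
        induction p using Quotient.inductionOn' with
        | h x =>
          refine congrArg (Quotient.mk'' (s₁ := specialSetoid ι)) (Subtype.ext ?_)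
          change (x : (Hat R)ˣ) * ι.hatUnitsMap (scalarUnits (maxOrder F K) c) = z * x
          rw [← hc, scalarUnits_comm]
          congr 1
          exact Units.ext (ι.hatMap_scalar c))

/-- The action of `Bil(R)` on `X_D / cl(K)` induced by left multiplication. -/
instance bilAction (ι : IntegralEmbedding K R) : MulAction (Bil R) (SpecialClasses ι) :=
  MulAction.compHom _ (bilPerm ι)

end Special

/-! ## The representation `V_𝐤` -/

section Weight

variable {F : Type*} [Field F] [NumberField F] {B : Type*} [Ring B] [Algebra F B]

variable (F B) in
/-- A choice of isomorphisms `B_τ = ℝ ⊗_{F,τ} B ≃ ℍ` for all `τ : F → ℝ`; such a choice exists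
if and only if the quaternion algebra `B` is totally definite. -/
def HamiltonIdent : Type _ :=
  ∀ τ : F →+* ℝ, letI : Algebra F ℝ := τ.toAlgebra; (ℝ ⊗[F] B) ≃ₐ[ℝ] ℍ[ℝ]

/-- The embedding `B → B_τ ≃ ℍ`. -/
def HamiltonIdent.emb (θ : HamiltonIdent F B) (τ : F →+* ℝ) : B →+* ℍ[ℝ] :=
  letI : Algebra F ℝ := τ.toAlgebra
  ((θ τ : (ℝ ⊗[F] B) →+* ℍ[ℝ])).comp
    (Algebra.TensorProduct.includeRight : B →ₐ[F] ℝ ⊗[F] B).toRingHom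

theorem HamiltonIdent.emb_algebraMap (θ : HamiltonIdent F B) (τ : F →+* ℝ) (a : F) :
    θ.emb τ (algebraMap F B a) = algebraMap ℝ ℍ[ℝ] (τ a) := by
  letI : Algebra F ℝ := τ.toAlgebra
  have h : (1 : ℝ) ⊗ₜ[F] (algebraMap F B a) = algebraMap ℝ (ℝ ⊗[F] B) (τ a) := by
    rw [Algebra.algebraMap_eq_smul_one, TensorProduct.tmul_smul, TensorProduct.smul_tmul',
      Algebra.TensorProduct.algebraMap_apply, Algebra.smul_def, mul_one]
    rfl
  change θ τ ((1 : ℝ) ⊗ₜ[F] (algebraMap F B a)) = _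
  rw [h]
  exact (θ τ).commutes (τ a)

/-- Coordinates on `W = ℍ / ℝ` with respect to the basis `i/2, j/2, ij/2`, which is orthonormal
for the quadratic form `-disc = 4 nrd - trd²`. -/
def coord (q : ℍ[ℝ]) : Fin 3 → ℝ := ![2 * q.imI, 2 * q.imJ, 2 * q.imK]

/-- The basis `i/2, j/2, ij/2` of `W = ℍ / ℝ`. -/
def halfBasis : Fin 3 → ℍ[ℝ] := ![⟨0, 1 / 2, 0, 0⟩, ⟨0, 0, 1 / 2, 0⟩, ⟨0, 0, 0, 1 / 2⟩]

variable (F) in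
/-- Complex polynomial functions on `∏_τ W_τ`, in the above coordinates. -/
abbrev WPoly : Type _ := MvPolynomial ((F →+* ℝ) × Fin 3) ℂ

/-- The value of a polynomial at the image in `∏_τ W_τ` of an element of `B`. -/
def evalAt (θ : HamiltonIdent F B) (b : B) (P : WPoly F) : ℂ :=
  MvPolynomial.eval (fun p => ((coord (θ.emb p.1 b) p.2 : ℝ) : ℂ)) P

/-- The matrix of `y ↦ γ y γ⁻¹` on `W_τ`. -/
def conjMatrix (θ : HamiltonIdent F B) (γ : Bˣ) (τ : F →+* ℝ) : Matrix (Fin 3) (Fin 3) ℝ :=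
  Matrix.of fun i j => coord (θ.emb τ γ * halfBasis j * θ.emb τ ((γ⁻¹ : Bˣ) : B)) i

/-- The right action of `Bˣ` on polynomials, `(P · γ)(y) = P(γ y γ⁻¹)`. -/
def act (θ : HamiltonIdent F B) (γ : Bˣ) : WPoly F →ₐ[ℂ] WPoly F :=
  MvPolynomial.aeval fun p =>
    ∑ j, MvPolynomial.C ((conjMatrix θ γ p.1 p.2 j : ℝ) : ℂ) * MvPolynomial.X (p.1, j)

/-- The representation `V_𝐤 = ⊗_τ V_{k_τ}`, realised on polynomials on `∏_τ W_τ` which are, in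
the `τ`-variable, homogeneous of degree `k_τ` and harmonic, for every `τ`. -/
def V (k : (F →+* ℝ) → ℕ) : Submodule ℂ (WPoly F) where
  carrier := {P | ∀ τ, (∀ m ∈ P.support, ∑ i, m (τ, i) = k τ) ∧
    ∑ i, MvPolynomial.pderiv (τ, i) (MvPolynomial.pderiv (τ, i) P) = 0}
  zero_mem' := by simp
  add_mem' := by
    classical
    intro P Q hP hQ τ
    refine ⟨fun m hm => ?_, ?_⟩
    · rcases Finset.mem_union.1 (MvPolynomial.support_add hm) with h | h
      · exact (hP τ).1 m h
      · exact (hQ τ).1 m h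
    · simp only [map_add, Finset.sum_add_distrib, (hP τ).2, (hQ τ).2, add_zero]
  smul_mem' := by
    intro c P hP τ
    refine ⟨fun m hm => (hP τ).1 m (MvPolynomial.support_smul hm), ?_⟩
    simp only [Derivation.map_smul, ← Finset.smul_sum, (hP τ).2, smul_zero]

/-- The invariant inner product (linear in the first variable) on polynomials for which the
monomials `X^m` are orthogonal of square norm `∏ m_p !`. -/
def fischer (P Q : WPoly F) : ℂ :=
  ∑ m ∈ P.support, P.coeff m * (starRingEnd ℂ) (Q.coeff m) * ∏ p, ((m p).factorial : ℂ)

/-- `P_D ∈ V_𝐤` is characterised by `P(ω) = ⟨P, P_D⟩` for every `P ∈ V_𝐤`. -/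
def IsGegenbauer (θ : HamiltonIdent F B) (k : (F →+* ℝ) → ℕ) (ω : B) (PD : WPoly F) : Prop :=
  PD ∈ V k ∧ ∀ P ∈ V k, evalAt θ ω P = fischer P PD

end Weight

/-! ## Quaternionic modular forms -/

section Forms

variable {F : Type*} [Field F] [NumberField F] {B : Type*} [Ring B] [Algebra F B]
variable (R : Subalgebra (𝓞 F) B) [IsOrder R] (θ : HamiltonIdent F B) (k : (F →+* ℝ) → ℕ)

/-- The space `M_𝐤(R)`: functions `φ : B̂ˣ → V_𝐤` with `φ(u x γ) = φ(x) · γ`. -/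
def forms : Submodule ℂ ((Hat R)ˣ → WPoly F) where
  carrier := {φ | (∀ x, φ x ∈ V k) ∧ ∀ u ∈ hatUnits R, ∀ x, ∀ γ : Bˣ,
    φ (u * x * diagUnits R γ) = act θ γ (φ x)}
  zero_mem' := ⟨fun _ => zero_mem _, fun _ _ _ _ => by simp⟩
  add_mem' := fun ha hb => ⟨fun x => add_mem (ha.1 x) (hb.1 x), fun u hu x γ => by
    simp [ha.2 u hu x γ, hb.2 u hu x γ]⟩
  smul_mem' := fun c φ h => ⟨fun x => Submodule.smul_mem _ _ (h.1 x), fun u hu x γ => by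
    simp [h.2 u hu x γ]⟩

/-- The space `M_𝐤(R, 𝟙)` of forms fixed by `cl(F)`, i.e. by `F̂ˣ`. -/
def formsTrivial : Submodule ℂ ((Hat R)ˣ → WPoly F) where
  carrier := {φ | φ ∈ forms R θ k ∧ ∀ c x, φ (scalarUnits R c * x) = φ x}
  zero_mem' := ⟨zero_mem _, fun _ _ => rfl⟩
  add_mem' := fun ha hb => ⟨add_mem ha.1 hb.1, fun c x => by simp [ha.2 c x, hb.2 c x]⟩
  smul_mem' := fun c _ h => ⟨Submodule.smul_mem _ c h.1, fun d x => by simp [h.2 d x]⟩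

/-- The space `M_𝐤(R, 𝟙)^{Bil(R)}`. -/
def formsBil : Submodule ℂ ((Hat R)ˣ → WPoly F) where
  carrier := {φ | φ ∈ formsTrivial R θ k ∧ ∀ z ∈ hatNormalizer R, ∀ x, φ (z * x) = φ x}
  zero_mem' := ⟨zero_mem _, fun _ _ _ => rfl⟩
  add_mem' := fun ha hb => ⟨add_mem ha.1 hb.1, fun z hz x => by
    simp [ha.2 z hz x, hb.2 z hz x]⟩
  smul_mem' := fun c _ h => ⟨Submodule.smul_mem _ c h.1, fun z hz x => by simp [h.2 z hz x]⟩

variable {R} in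
/-- The action `(φ · z)(x) = φ(z x)` of `Bil(R)` on `M_𝐤(R, 𝟙)`; on that space it does not
depend on the representative of `z`. -/
def slash (φ : (Hat R)ˣ → WPoly F) (z : Bil R) : (Hat R)ˣ → WPoly F :=
  fun x => φ ((z.out : hatNormalizer R) * x)

variable (F B) in
/-- The group `Bˣ / 𝓞_Fˣ`. -/
abbrev UnitsModScalars : Type _ :=
  Bˣ ⧸ (Units.map (algebraMap (𝓞 F) B : 𝓞 F →* B)).range

/-- `Γ_{x,y} = (Bˣ ∩ x⁻¹ R̂ˣ y) / 𝓞_Fˣ`. -/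
def Gam (x y : (Hat R)ˣ) : Set (UnitsModScalars F B) :=
  {g | ∃ γ : Bˣ, (γ : UnitsModScalars F B) = g ∧ x * diagUnits R γ * y⁻¹ ∈ hatUnits R}

/-- `w_x = |Γ_x|`, where `Γ_x = Γ_{x,x} = R_xˣ / 𝓞_Fˣ` (a finite group). -/
def wt (x : (Hat R)ˣ) : ℕ := Nat.card (Gam R x x)

/-- The action of `Bˣ` on polynomials factors through `Bˣ / 𝓞_Fˣ`. -/
def actMod (v : WPoly F) (g : UnitsModScalars F B) : WPoly F :=
  Quotient.liftOn' g (fun γ => act θ γ v) fun γ γ' h => by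
    rw [QuotientGroup.leftRel_apply] at h
    obtain ⟨u, hu⟩ := h
    have e : γ' = γ * Units.map (algebraMap (𝓞 F) B : 𝓞 F →* B) u := by rw [hu]; group
    have hM : conjMatrix θ γ' = conjMatrix θ γ := by
      funext τ
      ext i j
      have hs : ∀ w : 𝓞 F, θ.emb τ (algebraMap (𝓞 F) B w) =
          algebraMap ℝ ℍ[ℝ] (τ (w : F)) := fun w => by
        rw [IsScalarTower.algebraMap_apply (𝓞 F) F B]; exact θ.emb_algebraMap τ _
      simp only [conjMatrix, Matrix.of_apply]
      congr 1
      rw [e, mul_inv_rev, Units.val_mul, Units.val_mul, map_mul, map_mul, ← map_inv]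
      change θ.emb τ γ * θ.emb τ (algebraMap (𝓞 F) B u) * halfBasis j *
        (θ.emb τ (algebraMap (𝓞 F) B ((u⁻¹ : (𝓞 F)ˣ) : 𝓞 F)) * _) = _
      have h1 : algebraMap ℝ ℍ[ℝ] (τ ((u : 𝓞 F) : F)) *
          algebraMap ℝ ℍ[ℝ] (τ (((u⁻¹ : (𝓞 F)ˣ) : 𝓞 F) : F)) = 1 := by
        rw [← map_mul, ← map_mul, ← map_mul, Units.mul_inv, map_one, map_one, map_one]
      rw [hs, hs, mul_assoc (θ.emb τ γ), Algebra.commutes, ← mul_assoc, ← mul_assoc,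
        mul_assoc _ (algebraMap ℝ ℍ[ℝ] _) (algebraMap ℝ ℍ[ℝ] _), h1, mul_one]
    simp only [act, hM]

/-- The form with minimal support `φ_{x,v}(y) = ∑_{γ ∈ Γ_{x,y}} v · γ` (a finite sum). -/
def phi (x : (Hat R)ˣ) (v : WPoly F) : (Hat R)ˣ → WPoly F :=
  fun y => ∑ᶠ g : Gam R x y, actMod θ v (g : UnitsModScalars F B)

/-- `cl(R) = R̂ˣ \ B̂ˣ / Bˣ`. -/
abbrev OrderClasses : Type _ :=
  DoubleCoset.Quotient (hatUnits R : Set (Hat R)ˣ) ((diagUnits R).range : Set (Hat R)ˣ)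

variable {R} in
/-- The height pairing `⟨φ, ψ⟩ = ∑_{x ∈ cl(R)} w_x⁻¹ ⟨φ(x), ψ(x)⟩` (a finite sum); for
`φ, ψ ∈ M_𝐤(R)` the summands do not depend on the representatives. -/
def height (φ ψ : (Hat R)ˣ → WPoly F) : ℂ :=
  ∑ᶠ c : OrderClasses R, ((wt R c.out : ℂ))⁻¹ * fischer (φ c.out) (ψ c.out)

variable {K : Type*} [Field K] [Algebra F K] [FiniteDimensional F K]

variable {R} in
/-- `η_D = t_K⁻¹ ∑_{x ∈ X_D} φ_{x,P_D}` (a finite sum); the summands do not depend on the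
representatives when `P_D` is fixed by `Kˣ`. -/
def eta (ι : IntegralEmbedding K R) (PD : WPoly F) : (Hat R)ˣ → WPoly F :=
  ((unitIndex F K : ℂ))⁻¹ • ∑ᶠ p : SpecialPoints ι,
    phi R θ ((Quotient.out (s := specialSetoid ι) p : specialSet ι) : (Hat R)ˣ) PD

variable {R} in
/-- `ψ_v = t_K⁻¹ ∑_{a ∈ cl(K)} φ_{a,v}` (a finite sum); the summands do not depend on the
representatives when `v` is fixed by `Kˣ`. -/
def psi (ι : IntegralEmbedding K R) (v : WPoly F) : (Hat R)ˣ → WPoly F :=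
  ((unitIndex F K : ℂ))⁻¹ • ∑ᶠ a : ClassGp F K, phi R θ (ι.hatUnitsMap a.out) v

end Forms

end QuatForms

end

open QuatForms

noncomputable section

namespace QuatForms

/-! ## Integral quaternion algebras with an étale quadratic subring -/

namespace Model

section Ring

variable {O : Type*} [CommRing O] {c₁ c₂ c₃ : O}

/-! The whole theorem is a local statement followed by patching. Fix a prime and let `O` be the
completed ring of integers. If the prime divides `N`, the nonzero Eichler invariant produces an
element `g` of the completed order whose discriminant `t² - 4n` is a unit
(`exists_etale_of_eichler`); if it does not, a unit Gram determinant does (`exists_etale_of_gram`).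
Such a `g` splits off orthogonally, and the completed order is `O[g] ⊕ O[g]j` with `j² = c₃` and `jx
= x̄j` for `x` in `O[g]` (`exists_model`). Comparing Gram determinants, `c₃` is a unit exactly when
the prime does not divide `N`.

The heart is `Model.exists_conj`: two elements of such an order with equal trace and norm,
generating a maximal quadratic order, are conjugate by a unit or by a unit times `j`. The
conjugating element is an intertwiner `g'y - yḡ` for a well-chosen `y`. It is used twice. Applied to
`g` and its conjugate by an element of the normalizer, it leaves an element centralizing `g`, which
is a scalar times a unit by `exists_scalar_mul_unit`; so the local normalizer is generated by
scalars, units and `j`. Taken modulo scalars and units it has order two at the primes dividing `N`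
and is trivial elsewhere, which computes `Bil(R)`. Applied to a generator of the completion of
`𝓞_K`, it shows that the set of special ideles is `N(R̂) K̂ˣ` (`exists_eq_mul_hatUnitsMap`), hence
transitivity.

Freeness of `cl(K)` holds because an idele of `K` conjugate into `R̂ˣ` has integral trace and norm
everywhere, so it is a unit (`mem_localOrder_of_integral`). For freeness of `Bil(R)`, an element
fixing a class is, up to units, a conjugate of an idele `b` of `K` normalizing `R̂`. When the
discriminants are coprime, `K` is unramified at the primes dividing `N`, so `b` centralizes an étale
element of the order there and is again a scalar times a unit (`bil_free`).

On the analytic side, `V_𝐤` is stable under complex conjugation, so the bilinear Fischer form is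
nondegenerate on it and represents evaluation at `ω`; uniqueness makes `P_D` fixed by `Kˣ`. Then
`φ_{x,P_D}` depends only on the special point of `x`, and `X_D` is parametrised by `Bil(R) × cl(K)`
(`bijective_basePoint`). This gives the formula for `η_D`, and invariance of the height pairing
under the normalizer gives the factor `|Bil(R)|`. Finiteness of `cl(K)` or of the sets `Γ_{x,y}`
never enters: the identities also hold for the default value of an infinite `finsum`. -/

/-- The reduced trace of the quaternion algebra `ℍ[O,c₁,c₂,c₃]`. -/
def tr (x : ℍ[O,c₁,c₂,c₃]) : O := 2 * x.re + c₂ * x.imI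

/-- The reduced norm of the quaternion algebra `ℍ[O,c₁,c₂,c₃]`. -/
def nr (x : ℍ[O,c₁,c₂,c₃]) : O :=
  x.re ^ 2 + c₂ * x.re * x.imI - c₁ * x.imI ^ 2 -
    c₃ * (x.imJ ^ 2 + c₂ * x.imJ * x.imK - c₁ * x.imK ^ 2)

theorem mul_star_eq (x : ℍ[O,c₁,c₂,c₃]) : x * star x = algebraMap O _ (nr x) := by
  rw [QuaternionAlgebra.algebraMap_eq]
  ext <;> simp [nr] <;> ring

theorem star_mul_eq (x : ℍ[O,c₁,c₂,c₃]) : star x * x = algebraMap O _ (nr x) := by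
  rw [QuaternionAlgebra.algebraMap_eq]
  ext <;> simp [nr] <;> ring

theorem nr_mul (x y : ℍ[O,c₁,c₂,c₃]) : nr (x * y) = nr x * nr y := by
  simp [nr]; ring

theorem star_eq (x : ℍ[O,c₁,c₂,c₃]) : star x = algebraMap O _ (tr x) - x := by
  rw [QuaternionAlgebra.algebraMap_eq]
  ext <;> simp [tr]
  ring

theorem mul_self_eq (x : ℍ[O,c₁,c₂,c₃]) :
    x * x = algebraMap O _ (tr x) * x - algebraMap O _ (nr x) := by
  rw [← mul_star_eq, star_eq, mul_sub, Algebra.commutes]; abel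

theorem isUnit_of_isUnit_nr {x : ℍ[O,c₁,c₂,c₃]} (h : IsUnit (nr x)) : IsUnit x := by
  obtain ⟨u, hu⟩ := h
  refine isUnit_iff_exists.2 ⟨star x * algebraMap O _ (u⁻¹ : Oˣ), ?_, ?_⟩
  · rw [← mul_assoc, mul_star_eq, ← hu, ← map_mul, Units.mul_inv, map_one]
  · rw [mul_assoc, Algebra.commutes, ← mul_assoc, star_mul_eq, ← hu, ← map_mul, Units.mul_inv,
      map_one]

/-- If `g` and `g'` have the same trace and norm then `g' y - y ḡ` intertwines them. -/
theorem intertwine {g g' : ℍ[O,c₁,c₂,c₃]} (ht : tr g = tr g') (hn : nr g = nr g')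
    (y : ℍ[O,c₁,c₂,c₃]) : (g' * y - y * star g) * g = g' * (g' * y - y * star g) := by
  rw [sub_mul, mul_assoc y, star_mul_eq, mul_sub, ← mul_assoc, mul_self_eq g', hn, sub_mul,
    star_eq g, ht, ← Algebra.commutes]
  simp only [mul_sub, ← mul_assoc, ← Algebra.commutes (R := O)]
  abel

/-- The Gram matrix of the trace form is block diagonal on `1, i` and `j, k`, with block
determinants `Δ` and `-c₃²Δ`, where `Δ = c₂² + 4c₁`. Pairing with the four basis vectors and
applying Cramer's rule kills each coordinate. -/
theorem tr_eq_zero_forall [IsDomain O] {x : ℍ[O,c₁,c₂,c₃]} (hΔ : c₂ ^ 2 + 4 * c₁ ≠ 0) (hc : c₃ ≠ 0)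
    (hx : ∀ y, tr (x * y) = 0) : x = 0 := by
  have h1 := hx 1
  have h2 := hx ⟨0, 1, 0, 0⟩
  have h3 := hx ⟨0, 0, 1, 0⟩
  have h4 := hx ⟨0, 0, 0, 1⟩
  simp only [tr, mul_one, QuaternionAlgebra.re_mul, QuaternionAlgebra.imI_mul] at h1 h2 h3 h4
  have hI : x.imI = 0 := by
    refine (mul_eq_zero.1 ?_).resolve_left hΔ
    linear_combination 2 * h2 - c₂ * h1
  have hr : x.re = 0 := by
    refine (mul_eq_zero.1 ?_).resolve_left hΔ
    rw [hI] at h1 h2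
    linear_combination 2 * c₁ * h1 + c₂ * h2
  have hcΔ := mul_ne_zero hc hΔ
  have hJ : x.imJ = 0 := by
    refine (mul_eq_zero.1 ?_).resolve_left hcΔ
    linear_combination 2 * c₁ * h3 + c₂ * h4
  have hK : x.imK = 0 := by
    refine (mul_eq_zero.1 ?_).resolve_left hcΔ
    linear_combination c₂ * h3 - 2 * h4
  ext <;> assumption

end Ring

/-! ### Quaternion algebras over a finite field: splitting and intertwiners of nonzero norm. -/

section FiniteField

variable {κ : Type*} [Field κ] {c₁ c₂ c₃ : κ}

/-- In characteristic two squaring is already onto. Otherwise complete the square and use the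
counting argument that two quadratic polynomials in independent variables have a common value. -/
theorem exists_norm_eq [Finite κ] (hΔ : c₂ ^ 2 + 4 * c₁ ≠ 0) (c : κ) :
    ∃ p q : κ, p ^ 2 + c₂ * p * q - c₁ * q ^ 2 = c := by
  have := Fintype.ofFinite κ
  by_cases h2 : ringChar κ = 2
  · obtain ⟨r, hr⟩ := FiniteField.isSquare_of_char_two h2 c
    exact ⟨r, 0, by rw [hr]; ring⟩
  · have hodd := FiniteField.odd_card_of_char_ne_two h2
    have h20 : (2 : κ) ≠ 0 := Ring.two_ne_zero h2
    have hd : -((c₂ ^ 2 + 4 * c₁) / 4) ≠ 0 := by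
      have : (4 : κ) ≠ 0 := by
        rw [show (4 : κ) = 2 * 2 by norm_num]; exact mul_ne_zero h20 h20
      exact neg_ne_zero.2 (div_ne_zero hΔ this)
    obtain ⟨a, b, hab⟩ := FiniteField.exists_root_sum_quadratic (R := κ)
      (f := Polynomial.X ^ 2)
      (g := Polynomial.C (-((c₂ ^ 2 + 4 * c₁) / 4)) * Polynomial.X ^ 2 +
        Polynomial.C 0 * Polynomial.X + Polynomial.C (-c))
      (Polynomial.degree_X_pow 2) (Polynomial.degree_quadratic hd) hodd
    -- The shift by `c₂ b / 2` undoes the completion of the square.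
    refine ⟨a - c₂ * b / 2, b, ?_⟩
    simp only [Polynomial.eval_add, Polynomial.eval_mul, Polynomial.eval_pow, Polynomial.eval_X,
      Polynomial.eval_C] at hab
    have h4 : (4 : κ) = 2 * 2 := by norm_num
    rw [h4] at hab
    field_simp at hab ⊢
    linear_combination hab

/-- A splitting of a quaternion algebra, given a solution of the norm equation. -/
def splitBasis {p q : κ} (h : p ^ 2 + c₂ * p * q - c₁ * q ^ 2 = c₃) :
    QuaternionAlgebra.Basis (Matrix (Fin 2) (Fin 2) κ) c₁ c₂ c₃ where
  -- The algebra acts on `κ[i]` with basis `1, i`: `i` by multiplication, and `j` by conjugation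
  -- followed by multiplication by `p + qi`, an element of norm `c₃`.
  i := !![0, c₁; 1, c₂]
  j := !![p, c₂ * p - c₁ * q; q, -p]
  k := !![c₁ * q, -c₁ * p; p + c₂ * q, -c₁ * q]
  i_mul_i := by
    ext a b; fin_cases a <;> fin_cases b <;> simp <;> ring
  j_mul_j := by
    ext a b; fin_cases a <;> fin_cases b <;> simp <;>
      first | ring1 | linear_combination h
  i_mul_j := by
    ext a b; fin_cases a <;> fin_cases b <;> simp <;> ring
  j_mul_i := by
    ext a b; fin_cases a <;> fin_cases b <;> simp <;> ring

theorem split_apply {p q : κ} (h : p ^ 2 + c₂ * p * q - c₁ * q ^ 2 = c₃)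
    (x : ℍ[κ,c₁,c₂,c₃]) : (splitBasis h).liftHom x =
      !![x.re + x.imJ * p + x.imK * (c₁ * q),
          x.imI * c₁ + x.imJ * (c₂ * p - c₁ * q) - x.imK * (c₁ * p);
        x.imI + x.imJ * q + x.imK * (p + c₂ * q),
          x.re + x.imI * c₂ - x.imJ * p - x.imK * (c₁ * q)] := by
  change (splitBasis h).lift x = _
  ext a b
  fin_cases a <;> fin_cases b <;>
    simp [QuaternionAlgebra.Basis.lift, splitBasis, Matrix.algebraMap_eq_diagonal] <;> ring

theorem det_split {p q : κ} (h : p ^ 2 + c₂ * p * q - c₁ * q ^ 2 = c₃)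
    (x : ℍ[κ,c₁,c₂,c₃]) : ((splitBasis h).liftHom x).det = nr x := by
  rw [split_apply, Matrix.det_fin_two]
  simp only [Matrix.of_apply, Matrix.cons_val', Matrix.cons_val_zero, Matrix.cons_val_one,
    Matrix.cons_val_fin_one, nr, ← h]
  ring

/-- The matrix trace pulls back to the reduced trace, whose nondegeneracy forces injectivity; both
sides have dimension four. -/
theorem split_surjective {p q : κ} (h : p ^ 2 + c₂ * p * q - c₁ * q ^ 2 = c₃)
    (hΔ : c₂ ^ 2 + 4 * c₁ ≠ 0) (hc : c₃ ≠ 0) :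
    Function.Surjective (splitBasis h).liftHom := by
  have key : ∀ x, ((splitBasis h).liftHom x).trace = tr x := fun x => by
    rw [split_apply, Matrix.trace_fin_two]
    simp [tr]; ring
  refine (LinearMap.injective_iff_surjective_of_finrank_eq_finrank
    (f := (splitBasis h).liftHom.toLinearMap) ?_).1 ?_
  · rw [QuaternionAlgebra.finrank_eq_four, Module.finrank_matrix]; simp
  · refine (injective_iff_map_eq_zero (splitBasis h).liftHom).2 fun x hx => ?_
    refine tr_eq_zero_forall hΔ hc fun y => ?_
    rw [← key, map_mul, hx, zero_mul, Matrix.trace_zero]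

/-- The expression is `det (v, Gv)` with `v = (x, y)`. As a quadratic form in `v` it vanishes at
`e₁`, `e₂` and `e₁ + e₂` only when `G` is scalar. -/
theorem exists_cyclic_vector {a b c d : κ} (h : ¬(b = 0 ∧ c = 0 ∧ a = d)) :
    ∃ x y : κ, x * (c * x + d * y) - y * (a * x + b * y) ≠ 0 := by
  by_contra! H
  have h1 := H 1 0
  have h2 := H 0 1
  have h3 := H 1 1
  simp only [mul_zero, mul_one, one_mul, zero_mul, add_zero, sub_zero, zero_add, zero_sub,
    neg_eq_zero] at h1 h2 h3
  exact h ⟨h2, h1, by rw [h1, h2] at h3; linear_combination -h3⟩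

theorem eq_coe_of_split_scalar {p q : κ} (h : p ^ 2 + c₂ * p * q - c₁ * q ^ 2 = c₃)
    (hΔ : c₂ ^ 2 + 4 * c₁ ≠ 0) (hc : c₃ ≠ 0) (x : ℍ[κ,c₁,c₂,c₃])
    (hx : ((splitBasis h).liftHom x) 0 1 = 0 ∧ ((splitBasis h).liftHom x) 1 0 = 0 ∧
      ((splitBasis h).liftHom x) 0 0 = ((splitBasis h).liftHom x) 1 1) :
    ∃ r : κ, x = algebraMap κ _ r := by
  have hinj : Function.Injective (splitBasis h).liftHom := by
    refine (LinearMap.injective_iff_surjective_of_finrank_eq_finrank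
      (f := (splitBasis h).liftHom.toLinearMap) ?_).2 (split_surjective h hΔ hc)
    rw [QuaternionAlgebra.finrank_eq_four, Module.finrank_matrix]; simp
  refine ⟨(splitBasis h).liftHom x 0 0, hinj ?_⟩
  rw [AlgHom.commutes]
  ext a b
  fin_cases a <;> fin_cases b <;> simp [Matrix.algebraMap_eq_diagonal, hx.1, hx.2.1, hx.2.2]

/-- After splitting, take `y = v wᵀ` of rank one. Then `G'y` and `y adj(G)` have rank at most one,
and the determinant of their difference factors as `-det(v, G'v) det(w, Gᵀw)`. Nonscalar matrices
have cyclic vectors, so both factors can be made nonzero. -/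
theorem exists_nr_intertwiner_ne_zero [Finite κ] (hΔ : c₂ ^ 2 + 4 * c₁ ≠ 0) (hc : c₃ ≠ 0)
    {g g' : ℍ[κ,c₁,c₂,c₃]} (hg : ∀ r : κ, g ≠ algebraMap κ _ r)
    (hg' : ∀ r : κ, g' ≠ algebraMap κ _ r) : ∃ y, nr (g' * y - y * star g) ≠ 0 := by
  obtain ⟨p, q, h⟩ := exists_norm_eq hΔ c₃
  have htr : (splitBasis h).liftHom (star g) =
      !![(splitBasis h).liftHom g 1 1, -(splitBasis h).liftHom g 0 1;
        -(splitBasis h).liftHom g 1 0, (splitBasis h).liftHom g 0 0] := by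
    rw [split_apply, split_apply]
    ext a b
    fin_cases a <;> fin_cases b <;> simp <;> ring
  have hG := mt (eq_coe_of_split_scalar h hΔ hc g) (by simpa using hg)
  have hG' := mt (eq_coe_of_split_scalar h hΔ hc g') (by simpa using hg')
  set G := (splitBasis h).liftHom g with hGdef
  set G' := (splitBasis h).liftHom g' with hGdef'
  obtain ⟨x, y, hxy⟩ := exists_cyclic_vector hG'
  -- The off-diagonal entries are exchanged: a cyclic vector of the transpose of `G` is needed.
  obtain ⟨z, w, hzw⟩ := exists_cyclic_vector (a := G 0 0) (b := G 1 0) (c := G 0 1) (d := G 1 1)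
    (fun h => hG ⟨h.2.1, h.1, h.2.2⟩)
  obtain ⟨Y, hY⟩ := split_surjective h hΔ hc !![x * z, x * w; y * z, y * w]
  refine ⟨Y, ?_⟩
  rw [← det_split h, map_sub, map_mul, map_mul, hY, htr, ← hGdef', Matrix.det_fin_two]
  convert neg_ne_zero.2 (mul_ne_zero hxy hzw) using 1
  simp only [Matrix.sub_apply, Matrix.mul_apply, Fin.sum_univ_two, Matrix.of_apply,
    Matrix.cons_val', Matrix.cons_val_zero, Matrix.cons_val_one, Matrix.cons_val_fin_one]
  ring

end FiniteField

end Model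

namespace Model

/-! ### Reduction to the residue field, and conjugacy when `c₃` or the discriminant is a unit. -/

section Local

open IsLocalRing

variable {O : Type*} [CommRing O] {c₁ c₂ c₃ : O}

/-- The image of `x` under conjugation by `j`. -/
def twist (x : ℍ[O,c₁,c₂,c₃]) : ℍ[O,c₁,c₂,c₃] :=
  ⟨x.re + c₂ * x.imI, -x.imI, x.imJ + c₂ * x.imK, -x.imK⟩

/-- The generator `j`. -/
def jj : ℍ[O,c₁,c₂,c₃] := ⟨0, 0, 1, 0⟩

theorem jj_mul (x : ℍ[O,c₁,c₂,c₃]) : jj * x = twist x * jj := by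
  ext <;> simp [jj, twist]
  ring

theorem mul_jj (x : ℍ[O,c₁,c₂,c₃]) : x * jj = jj * twist x := by
  ext <;> simp [jj, twist]
  ring

theorem tr_twist (x : ℍ[O,c₁,c₂,c₃]) : tr (twist x) = tr x := by
  simp [tr, twist]; ring

theorem nr_twist (x : ℍ[O,c₁,c₂,c₃]) : nr (twist x) = nr x := by
  simp [nr, twist]; ring

/-- An element `p + qi` of trace and norm zero squares to zero, and `κ[i]` is reduced; concretely,
its trace squared minus four times its norm is `Δq²`. -/
theorem eq_zero_of_norm_trace {κ : Type*} [Field κ] {c₁ c₂ p q : κ} (hΔ : c₂ ^ 2 + 4 * c₁ ≠ 0)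
    (ht : 2 * p + c₂ * q = 0) (hn : p ^ 2 + c₂ * p * q - c₁ * q ^ 2 = 0) : p = 0 ∧ q = 0 := by
  have hq : q = 0 := by
    have : (c₂ ^ 2 + 4 * c₁) * q ^ 2 = 0 := by
      linear_combination (2 * p + c₂ * q) * ht - 4 * hn
    exact pow_eq_zero_iff two_ne_zero |>.1 ((mul_eq_zero.1 this).resolve_left hΔ)
  refine ⟨?_, hq⟩
  rw [hq] at hn
  exact pow_eq_zero_iff two_ne_zero |>.1 (by linear_combination hn)

/-- A finite field is perfect, so the double root of a quadratic polynomial of discriminant zero is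
rational: it is `t/2`, or a square root of `n` in characteristic two, where `t` vanishes. -/
theorem exists_double_root {κ : Type*} [Field κ] [Finite κ] {t n : κ} (h : t ^ 2 - 4 * n = 0) :
    ∃ r : κ, 2 * r = t ∧ r ^ 2 - r * t + n = 0 := by
  by_cases h2 : ringChar κ = 2
  · have : CharP κ 2 := by rw [← h2]; infer_instance
    have h20 : (2 : κ) = 0 := CharTwo.two_eq_zero
    obtain ⟨r, hr⟩ := FiniteField.isSquare_of_char_two h2 n
    have ht : t = 0 := pow_eq_zero_iff two_ne_zero |>.1 (by linear_combination h + 2 * n * h20)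
    exact ⟨r, by rw [ht, h20, zero_mul], by rw [ht, hr]; linear_combination r * r * h20⟩
  · have h20 : (2 : κ) ≠ 0 := Ring.two_ne_zero h2
    refine ⟨t / 2, by field_simp, ?_⟩
    have h40 : (4 : κ) ≠ 0 := by
      rw [show (4 : κ) = 2 * 2 by norm_num]; exact mul_ne_zero h20 h20
    refine (mul_eq_zero.1 (?_ : (4 : κ) * _ = 0)).resolve_left h40
    have : (t / 2) * 2 = t := by field_simp
    linear_combination (2 * (t / 2) - t) * this - h

variable [IsLocalRing O]

/-- Reduction to the residue field. -/
def red (x : ℍ[O,c₁,c₂,c₃]) :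
    ℍ[ResidueField O,residue O c₁,residue O c₂,residue O c₃] :=
  ⟨residue O x.re, residue O x.imI, residue O x.imJ, residue O x.imK⟩

theorem nr_red (x : ℍ[O,c₁,c₂,c₃]) : nr (red x) = residue O (nr x) := by
  simp [nr, red]

theorem red_mul (x y : ℍ[O,c₁,c₂,c₃]) : red (x * y) = red x * red y := by
  ext <;> simp [red]

theorem red_sub (x y : ℍ[O,c₁,c₂,c₃]) : red (x - y) = red x - red y := by
  ext <;> simp [red]

theorem red_star (x : ℍ[O,c₁,c₂,c₃]) : red (star x) = star (red x) := by
  ext <;> simp [red]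

theorem red_surjective : Function.Surjective (red (c₁ := c₁) (c₂ := c₂) (c₃ := c₃)) := by
  intro y
  obtain ⟨a, ha⟩ := residue_surjective y.re
  obtain ⟨b, hb⟩ := residue_surjective y.imI
  obtain ⟨c, hc⟩ := residue_surjective y.imJ
  obtain ⟨d, hd⟩ := residue_surjective y.imK
  exact ⟨⟨a, b, c, d⟩, by ext <;> simpa [red]⟩

/-- The polynomial `X² - tX + n` generates an order that is not contained in a bigger one of the
form `O[(X - α)/π]`. -/
def IsMaxPoly (t n : O) : Prop :=
  ∀ α : O, ¬ (t - 2 * α ∈ maximalIdeal O ∧ α ^ 2 - α * t + n ∈ maximalIdeal O ^ 2)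

/-- If `g` were congruent to `α` modulo the maximal ideal, `g - α` would have trace in the ideal and
norm in its square, which `IsMaxPoly` forbids. -/
theorem red_ne_scalar {g : ℍ[O,c₁,c₂,c₃]} (h : IsMaxPoly (tr g) (nr g))
    (r : ResidueField O) : red g ≠ algebraMap _ _ r := by
  intro H
  obtain ⟨α, rfl⟩ := residue_surjective r
  rw [QuaternionAlgebra.algebraMap_eq, QuaternionAlgebra.ext_iff] at H
  simp only [red] at H
  obtain ⟨h1, h2, h3, h4⟩ := H
  rw [← sub_eq_zero, ← map_sub, residue_eq_zero_iff] at h1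
  rw [residue_eq_zero_iff] at h2 h3 h4
  refine h α ⟨?_, ?_⟩
  · have : tr g - 2 * α = 2 * (g.re - α) + c₂ * g.imI := by simp [tr]; ring
    rw [this]
    exact add_mem (Ideal.mul_mem_left _ _ h1) (Ideal.mul_mem_left _ _ h2)
  · have : α ^ 2 - α * tr g + nr g = (g.re - α) * (g.re - α) + c₂ * ((g.re - α) * g.imI)
        - c₁ * (g.imI * g.imI) - c₃ * (g.imJ * g.imJ + c₂ * (g.imJ * g.imK) -
          c₁ * (g.imK * g.imK)) := by simp [tr, nr]; ring
    rw [this, pow_two]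
    refine sub_mem (sub_mem (add_mem (Ideal.mul_mem_mul h1 h1) ?_) ?_) ?_ <;>
      refine Ideal.mul_mem_left _ _ ?_
    · exact Ideal.mul_mem_mul h1 h2
    · exact Ideal.mul_mem_mul h2 h2
    · refine sub_mem (add_mem (Ideal.mul_mem_mul h3 h3) ?_) ?_ <;> refine Ideal.mul_mem_left _ _ ?_
      · exact Ideal.mul_mem_mul h3 h4
      · exact Ideal.mul_mem_mul h4 h4

theorem isUnit_iff_residue_ne_zero (x : O) : IsUnit x ↔ residue O x ≠ 0 := by
  simp

theorem isUnit_nr_iff (x : ℍ[O,c₁,c₂,c₃]) : IsUnit (nr x) ↔ nr (red x) ≠ 0 := by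
  rw [isUnit_iff_residue_ne_zero, nr_red]

/-- With `c₃` a unit the reduction is a nondegenerate quaternion algebra over a finite field and
`g`, `g'` reduce to nonscalars. An intertwiner of nonzero norm found there lifts to one of unit
norm. -/
theorem conj_of_isUnit [Finite (ResidueField O)] (hΔ : IsUnit (c₂ ^ 2 + 4 * c₁)) (hc : IsUnit c₃)
    {g g' : ℍ[O,c₁,c₂,c₃]} (ht : tr g = tr g') (hn : nr g = nr g')
    (hmax : IsMaxPoly (tr g) (nr g)) :
    ∃ r : ℍ[O,c₁,c₂,c₃], IsUnit (nr r) ∧ r * g = g' * r := by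
  have hΔ' : residue O c₂ ^ 2 + 4 * residue O c₁ ≠ 0 := by
    simpa only [map_add, map_pow, map_mul, map_ofNat] using (isUnit_iff_residue_ne_zero _).1 hΔ
  obtain ⟨y, hy⟩ := exists_nr_intertwiner_ne_zero hΔ' ((isUnit_iff_residue_ne_zero _).1 hc)
    (red_ne_scalar hmax) (red_ne_scalar (by rwa [← ht, ← hn]) : ∀ r, red g' ≠ algebraMap _ _ r)
  obtain ⟨Y, rfl⟩ := red_surjective y
  refine ⟨g' * Y - Y * star g, ?_, intertwine ht hn Y⟩
  rwa [isUnit_nr_iff, red_sub, red_mul, red_mul, red_star]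

/-- Modulo `j` the order becomes the commutative ring `κ[i]`. The two candidates are the intertwiner
`g' - ḡ` and its analogue with `g'` replaced by its conjugate under `j`. Their norms add up to minus
the discriminant of `g` modulo `c₃`, so one of them is a unit. -/
theorem conj_of_isUnit_disc (hc : ¬ IsUnit c₃)
    {g g' : ℍ[O,c₁,c₂,c₃]} (ht : tr g = tr g') (hn : nr g = nr g')
    (hg : IsUnit (tr g ^ 2 - 4 * nr g)) :
    ∃ r : ℍ[O,c₁,c₂,c₃], IsUnit (nr r) ∧ (r * g = g' * r ∨ (r * jj) * g = g' * (r * jj)) := by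
  by_cases h1 : IsUnit (nr (g' - star g))
  · refine ⟨_, h1, Or.inl ?_⟩
    simpa using intertwine ht hn 1
  by_cases h2 : IsUnit (nr (twist g' - star g))
  · refine ⟨twist (twist g' - star g), by rwa [nr_twist], Or.inr ?_⟩
    have h := intertwine (g := g) (g' := twist g') (by rw [tr_twist, ht]) (by rw [nr_twist, hn]) 1
    rw [mul_one, one_mul] at h
    rw [← jj_mul, mul_assoc, h, ← mul_assoc, ← mul_assoc, ← mul_jj]
  · exfalso
    rw [← mem_nonunits_iff, ← mem_maximalIdeal, ← residue_eq_zero_iff] at h1 h2 hc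
    rw [isUnit_iff_residue_ne_zero] at hg
    refine hg ?_
    -- The first two summands on the right vanish by hypothesis and the last is a multiple of `c₃`,
    -- so two non-unit norms would force a non-unit discriminant.
    have key : nr (g' - star g) + nr (twist g' - star g) + (tr g ^ 2 - 4 * nr g) =
        tr g * (tr g - tr g') + 2 * (nr g' - nr g) +
          c₃ * (-(2 * g'.imJ + c₂ * g'.imK) * (2 * g.imJ + c₂ * g.imK)) := by
      simp [nr, tr, twist]; ring
    have := congrArg (residue O) key
    rw [ht, hn, sub_self, sub_self] at this
    simp only [map_add, map_mul, h1, h2, hc] at this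
    rw [ht, hn]
    simpa using this

end Local

section Intertwine

variable {O : Type*} [CommRing O] {c₁ c₂ c₃ : O}

/-- Since `j² = c₃`, an element whose component in `O[i]` is divisible by `c₃` can be divided by `j`
on the right. -/
theorem intertwine_unit_mul_jj {z : ℍ[O,c₁,c₂,c₃]} {p q : O} (hp : z.re = c₃ * p)
    (hq : z.imI = c₃ * q) : (⟨z.imJ, z.imK, p, q⟩ : ℍ[O,c₁,c₂,c₃]) * jj = z := by
  ext <;> simp [jj, hp, hq]

end Intertwine

/-! ### Conjugacy in the Eisenstein case, and the general conjugacy theorem. -/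

section DVR

open IsLocalRing

variable {O : Type*} [CommRing O] [IsDomain O] [IsDiscreteValuationRing O] {c₁ c₂ c₃ : O}

theorem isUnit_nr_of_norm (hc : c₃ ∈ maximalIdeal O) {a b p q : O}
    (h : IsUnit (a ^ 2 + c₂ * a * b - c₁ * b ^ 2)) :
    IsUnit (nr (⟨a, b, p, q⟩ : ℍ[O,c₁,c₂,c₃])) := by
  rw [isUnit_iff_residue_ne_zero] at h ⊢
  rw [← residue_eq_zero_iff] at hc
  simpa [nr, hc] using h

/-- Write `g = a + bj` and `g' = a' + b'j` with components in `O[i]`. The Eisenstein condition makes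
`c₃` a uniformizer dividing `a` and `a'`, and makes `N(b)` a unit. So the intertwiners for `y = 1`
and `y = i` are divisible by `j`. Modulo the maximal ideal, the norm of the first quotient is `N(b'
+ b)`; if this vanishes then `b' ≡ -b`, and the second quotient has norm `-ΔN(b)`. -/
theorem conj_of_eisenstein
    (hΔ : IsUnit (c₂ ^ 2 + 4 * c₁)) (hc : ¬ IsUnit c₃)
    {g g' : ℍ[O,c₁,c₂,c₃]} (ht : tr g = tr g') (hn : nr g = nr g')
    (ht1 : tr g ∈ maximalIdeal O) (hn1 : nr g ∈ maximalIdeal O)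
    (hn2 : nr g ∉ maximalIdeal O ^ 2) :
    ∃ r : ℍ[O,c₁,c₂,c₃], IsUnit (nr r) ∧ (r * jj) * g = g' * (r * jj) := by
  have hΔ' : residue O c₂ ^ 2 + 4 * residue O c₁ ≠ 0 := by
    simpa only [map_add, map_pow, map_mul, map_ofNat] using (isUnit_iff_residue_ne_zero _).1 hΔ
  rw [← mem_nonunits_iff, ← mem_maximalIdeal] at hc
  have hc0 := (residue_eq_zero_iff _).2 hc
  -- Modulo `c₃`, trace and norm only see the component in `O[i]`, whose reduction is étale.
  have small : ∀ x : ℍ[O,c₁,c₂,c₃], tr x ∈ maximalIdeal O → nr x ∈ maximalIdeal O →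
      x.re ∈ maximalIdeal O ∧ x.imI ∈ maximalIdeal O := by
    intro x hxt hxn
    simp only [← residue_eq_zero_iff] at hxt hxn ⊢
    refine eq_zero_of_norm_trace hΔ' (by simpa only [tr, map_add, map_mul, map_ofNat] using hxt) ?_
    simpa [nr, hc0] using hxn
  obtain ⟨hp, hq⟩ := small g ht1 hn1
  obtain ⟨hp', hq'⟩ := small g' (ht ▸ ht1) (hn ▸ hn1)
  have hsq : ∀ x : ℍ[O,c₁,c₂,c₃], x.re ∈ maximalIdeal O → x.imI ∈ maximalIdeal O →
      x.re ^ 2 + c₂ * x.re * x.imI - c₁ * x.imI ^ 2 ∈ maximalIdeal O ^ 2 := by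
    intro x h1 h2
    rw [mul_assoc, pow_two, pow_two, pow_two]
    exact sub_mem (add_mem (Ideal.mul_mem_mul h1 h1)
      (Ideal.mul_mem_left _ _ (Ideal.mul_mem_mul h1 h2)))
      (Ideal.mul_mem_left _ _ (Ideal.mul_mem_mul h2 h2))
  -- Modulo the square of the maximal ideal the norm of `g` is `-c₃N(b)`. As it does not vanish
  -- there, `c₃` has valuation one and `N(b)` is a unit.
  have hcN : ∀ N : O, nr g - (g.re ^ 2 + c₂ * g.re * g.imI - c₁ * g.imI ^ 2) = - (c₃ * N) →
      c₃ ∉ maximalIdeal O ^ 2 ∧ IsUnit N := by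
    intro N hN
    have h : c₃ * N ∉ maximalIdeal O ^ 2 := by
      intro h
      refine hn2 ?_
      have := sub_mem (hsq g hp hq) h
      rwa [sub_eq_add_neg, ← hN, add_sub_cancel] at this
    refine ⟨fun h' => h (Ideal.mul_mem_right _ _ h'), ?_⟩
    by_contra hu
    refine h ?_
    rw [pow_two]
    exact Ideal.mul_mem_mul hc hu
  obtain ⟨hc2, hNb⟩ := hcN (g.imJ ^ 2 + c₂ * g.imJ * g.imK - c₁ * g.imK ^ 2) (by simp [nr])
  have hspan : maximalIdeal O = Ideal.span {c₃} := by
    obtain ⟨ϖ, hϖ⟩ := IsDiscreteValuationRing.exists_irreducible O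
    rw [hϖ.maximalIdeal_eq] at hc hc2 ⊢
    obtain ⟨d, rfl⟩ := Ideal.mem_span_singleton'.1 hc
    have hd : IsUnit d := by
      by_contra hd
      rw [← mem_nonunits_iff, ← mem_maximalIdeal, hϖ.maximalIdeal_eq] at hd
      refine hc2 ?_
      rw [pow_two]
      exact Ideal.mul_mem_mul hd (Ideal.mem_span_singleton_self _)
    exact (Ideal.span_singleton_mul_left_unit hd ϖ).symm
  have hdvd : ∀ x ∈ maximalIdeal O, ∃ y, x = c₃ * y := fun x hx => by
    rw [hspan] at hx; exact Ideal.mem_span_singleton.1 hx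
  have hc3 : c₃ ≠ 0 := by rintro rfl; exact hc2 (zero_mem _)
  obtain ⟨p, hp1⟩ := hdvd _ hp
  obtain ⟨q, hq1⟩ := hdvd _ hq
  obtain ⟨p', hp1'⟩ := hdvd _ hp'
  obtain ⟨q', hq1'⟩ := hdvd _ hq'
  -- Equality of the norms of `g` and `g'`, divided by `c₃`, gives `N(b) ≡ N(b')`.
  have hNN : (g.imJ ^ 2 + c₂ * g.imJ * g.imK - c₁ * g.imK ^ 2) -
      (g'.imJ ^ 2 + c₂ * g'.imJ * g'.imK - c₁ * g'.imK ^ 2) =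
      c₃ * ((p ^ 2 + c₂ * p * q - c₁ * q ^ 2) - (p' ^ 2 + c₂ * p' * q' - c₁ * q' ^ 2)) := by
    refine mul_left_cancel₀ hc3 ?_
    simp only [nr, hp1, hq1, hp1', hq1'] at hn
    linear_combination -hn
  by_cases h1 : IsUnit ((g'.imJ + g.imJ) ^ 2 + c₂ * (g'.imJ + g.imJ) * (g'.imK + g.imK) -
      c₁ * (g'.imK + g.imK) ^ 2)
  · have h := intertwine ht hn 1
    rw [mul_one, one_mul] at h
    rw [← intertwine_unit_mul_jj (z := g' - star g) (p := p' - p - c₂ * q) (q := q' + q)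
      (by simp [hp1, hp1', hq1]; ring) (by simp [hq1, hq1']; ring)] at h
    refine ⟨_, ?_, h⟩
    refine isUnit_nr_of_norm hc ?_
    simpa using h1
  · have h := intertwine ht hn (⟨0, 1, 0, 0⟩ : ℍ[O,c₁,c₂,c₃])
    rw [← intertwine_unit_mul_jj (z := g' * (⟨0, 1, 0, 0⟩ : ℍ[O,c₁,c₂,c₃]) - (⟨0, 1, 0, 0⟩ : ℍ[O,c₁,c₂,c₃]) * star g)
      (p := c₁ * q' + c₁ * q) (q := p' + c₂ * q' - p)
      (by simp [hq1, hq1']; ring) (by simp [hp1, hp1', hq1, hq1']; ring)] at h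
    refine ⟨_, ?_, h⟩
    refine isUnit_nr_of_norm hc ?_
    rw [isUnit_iff_residue_ne_zero, not_not] at h1
    rw [isUnit_iff_residue_ne_zero] at hNb
    have hNN' := congrArg (residue O) hNN
    simp only [map_add, map_sub, map_mul, map_pow, hc0, zero_mul] at h1 hNN' hNb
    -- The element tested is `(b' + b)b̄`. Its trace is `N(b' + b) + N(b) - N(b')` and its norm is
    -- `N(b' + b)N(b)`, both zero here; since `N(b)` is nonzero, `b' = -b` in the residue ring.
    have hw := eq_zero_of_norm_trace hΔ'
      (p := (residue O g'.imJ + residue O g.imJ) * (residue O g.imJ + residue O c₂ * residue O g.imK)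
        - residue O c₁ * (residue O g'.imK + residue O g.imK) * residue O g.imK)
      (q := (residue O g'.imK + residue O g.imK) * residue O g.imJ -
        (residue O g'.imJ + residue O g.imJ) * residue O g.imK)
      (by linear_combination h1 + hNN')
      (by linear_combination (residue O g.imJ ^ 2 + residue O c₂ * residue O g.imJ * residue O g.imK -
            residue O c₁ * residue O g.imK ^ 2) * h1)
    have hw1 : residue O g'.imJ + residue O g.imJ = 0 := by
      refine (mul_eq_zero.1 ?_).resolve_right hNb
      linear_combination residue O g.imJ * hw.1 + residue O c₁ * residue O g.imK * hw.2
    have hw2 : residue O g'.imK + residue O g.imK = 0 := by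
      refine (mul_eq_zero.1 ?_).resolve_right hNb
      linear_combination residue O g.imK * hw.1 +
        (residue O g.imJ + residue O c₂ * residue O g.imK) * hw.2
    rw [isUnit_iff_residue_ne_zero]
    convert neg_ne_zero.2 (mul_ne_zero hΔ' hNb) using 1
    simp only [QuaternionAlgebra.imJ_sub, QuaternionAlgebra.imK_sub, QuaternionAlgebra.imJ_mul,
      QuaternionAlgebra.imK_mul, QuaternionAlgebra.re_star, QuaternionAlgebra.imI_star,
      QuaternionAlgebra.imJ_star, QuaternionAlgebra.imK_star, map_add, map_sub, map_mul, map_pow,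
      map_neg, map_zero, map_one, eq_neg_of_add_eq_zero_left hw1, eq_neg_of_add_eq_zero_left hw2]
    ring

/-- Two elements of the same trace and norm that generate maximal quadratic orders are conjugate
by a unit, or by a unit times `j`. -/
theorem exists_conj [Finite (ResidueField O)]
    (hΔ : IsUnit (c₂ ^ 2 + 4 * c₁))
    {g g' : ℍ[O,c₁,c₂,c₃]} (ht : tr g = tr g') (hn : nr g = nr g')
    (hmax : IsMaxPoly (tr g) (nr g)) :
    ∃ r : ℍ[O,c₁,c₂,c₃], IsUnit (nr r) ∧ (r * g = g' * r ∨ (r * jj) * g = g' * (r * jj)) := by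
  by_cases hc : IsUnit c₃
  · obtain ⟨r, h, h'⟩ := conj_of_isUnit hΔ hc ht hn hmax
    exact ⟨r, h, Or.inl h'⟩
  by_cases hd : IsUnit (tr g ^ 2 - 4 * nr g)
  · exact conj_of_isUnit_disc hc ht hn hd
  rw [isUnit_iff_residue_ne_zero, not_not] at hd
  simp only [map_sub, map_pow, map_mul, map_ofNat] at hd
  -- In the remaining case the polynomial has a double root modulo the maximal ideal. Translating by
  -- a lift `α` puts trace and norm in the ideal, and maximality keeps the norm out of its square.
  obtain ⟨r, hr1, hr2⟩ := exists_double_root hd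
  obtain ⟨α, rfl⟩ := residue_surjective r
  have htr : ∀ x : ℍ[O,c₁,c₂,c₃], tr (x - algebraMap O _ α) = tr x - 2 * α := fun x => by
    rw [QuaternionAlgebra.algebraMap_eq]; simp [tr]; ring
  have hnr : ∀ x : ℍ[O,c₁,c₂,c₃], nr (x - algebraMap O _ α) = α ^ 2 - α * tr x + nr x :=
    fun x => by rw [QuaternionAlgebra.algebraMap_eq]; simp [tr, nr]; ring
  have ht1 : tr g - 2 * α ∈ maximalIdeal O := by
    rw [← residue_eq_zero_iff, map_sub, map_mul, map_ofNat, hr1, sub_self]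
  obtain ⟨r, h, h'⟩ := conj_of_eisenstein hΔ hc (g := g - algebraMap O _ α)
    (g' := g' - algebraMap O _ α) (by rw [htr, htr, ht]) (by rw [hnr, hnr, ht, hn])
    (by rwa [htr]) (by
      rw [hnr, ← residue_eq_zero_iff]
      simpa using hr2) (by
      rw [hnr]
      exact fun h => hmax α ⟨ht1, h⟩)
  refine ⟨r, h, Or.inr ?_⟩
  rw [mul_sub, sub_mul, Algebra.commutes] at h'
  exact sub_left_injective h'

/-- An element `α + β i`, with one of `α`, `β` equal to `1`, that maps `j` into the order by
conjugation has unit norm. -/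
theorem isUnit_nr_of_normalizes (hΔ : IsUnit (c₂ ^ 2 + 4 * c₁)) {a b : O} (hab : a = 1 ∨ b = 1)
    {r : ℍ[O,c₁,c₂,c₃]} (h : (⟨a, b, 0, 0⟩ : ℍ[O,c₁,c₂,c₃]) * jj = r * ⟨a, b, 0, 0⟩) :
    IsUnit (nr (⟨a, b, 0, 0⟩ : ℍ[O,c₁,c₂,c₃])) := by
  have hΔ' : residue O c₂ ^ 2 + 4 * residue O c₁ ≠ 0 := by
    simpa only [map_add, map_pow, map_mul, map_ofNat] using (isUnit_iff_residue_ne_zero _).1 hΔ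
  by_contra hu
  rw [isUnit_iff_residue_ne_zero, not_not] at hu
  -- With `x = a + bi`, multiplying by `x̄` gives `x²j = nr(x) r`. If `nr(x)` is not a unit, `x²`
  -- vanishes modulo the maximal ideal; the residue ring is reduced, so `x` vanishes too, although a
  -- coordinate of it is `1`.
  have h1 := congrArg (· * star (⟨a, b, 0, 0⟩ : ℍ[O,c₁,c₂,c₃])) h
  simp only [mul_assoc r, mul_star_eq] at h1
  rw [← Algebra.commutes, QuaternionAlgebra.algebraMap_eq, QuaternionAlgebra.ext_iff] at h1
  obtain ⟨-, -, h3, h4⟩ := h1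
  have h3 := congrArg (residue O) h3
  have h4 := congrArg (residue O) h4
  simp [jj, hu] at h3 h4
  rcases hab with rfl | rfl
  · have hb : residue O b = 0 := by
      refine (mul_eq_zero.1 ?_).resolve_left hΔ'
      simp only [map_one] at h3 h4
      linear_combination ((residue O c₂ ^ 2 + 4 * residue O c₁) * residue O b -
        4 * residue O c₁ * residue O b) * h3 -
        residue O c₁ * (residue O c₂ * residue O b - 2) * h4
    simp [hb] at h3
  · refine hΔ' ?_
    simp only [map_one] at h3 h4
    linear_combination (residue O c₂ - 2 * residue O a) * h4 + 4 * h3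

end DVR

end Model

/-! ## Algebras with a reduced trace and norm -/

/-- The reduced trace and norm of a quaternion algebra `A` over `k`. -/
structure QuatStr (k A : Type*) [Field k] [Ring A] [Algebra k A] where
  trd : A →ₗ[k] k
  nrd : A → k
  trd_one : trd 1 = 2
  mul_conj : ∀ x, x * (algebraMap k A (trd x) - x) = algebraMap k A (nrd x)
  conj_mul : ∀ x y, algebraMap k A (trd (x * y)) - x * y =
    (algebraMap k A (trd y) - y) * (algebraMap k A (trd x) - x)
  nondeg : ∀ x, (∀ y, trd (x * y) = 0) → x = 0
  finrank_eq : Module.finrank k A = 4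

namespace QuatStr

section Basic

variable {k A : Type*} [Field k] [Ring A] [Algebra k A] (q : QuatStr k A)

include q in
theorem algebraMap_injective : Function.Injective (algebraMap k A) := by
  have : Nontrivial A := Module.nontrivial_of_finrank_pos (R := k) (by rw [q.finrank_eq]; norm_num)
  exact (algebraMap k A).injective

/-- The standard involution. -/
def conj (x : A) : A := algebraMap k A (q.trd x) - x

theorem mul_conj' (x : A) : x * q.conj x = algebraMap k A (q.nrd x) := q.mul_conj x

theorem conj_mul_self (x : A) : q.conj x * x = algebraMap k A (q.nrd x) := by
  rw [← mul_conj', conj, sub_mul, mul_sub, Algebra.commutes]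

theorem conj_mul' (x y : A) : q.conj (x * y) = q.conj y * q.conj x := q.conj_mul x y

theorem trd_algebraMap (c : k) : q.trd (algebraMap k A c) = c * 2 := by
  rw [Algebra.algebraMap_eq_smul_one, map_smul, q.trd_one, smul_eq_mul]

theorem trd_conj (x : A) : q.trd (q.conj x) = q.trd x := by
  rw [conj, map_sub, trd_algebraMap]; ring

theorem conj_conj (x : A) : q.conj (q.conj x) = x := by
  rw [conj, trd_conj, conj, sub_sub_cancel]

theorem conj_add (x y : A) : q.conj (x + y) = q.conj x + q.conj y := by
  simp only [conj, map_add]; abel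

theorem conj_algebraMap (c : k) : q.conj (algebraMap k A c) = algebraMap k A c := by
  rw [conj, trd_algebraMap, mul_two, map_add, add_sub_cancel_right]

theorem add_conj (x : A) : x + q.conj x = algebraMap k A (q.trd x) := by
  rw [conj, add_sub_cancel]

theorem nrd_algebraMap (c : k) : q.nrd (algebraMap k A c) = c ^ 2 := by
  refine q.algebraMap_injective ?_
  rw [← mul_conj', conj_algebraMap, pow_two, map_mul]

theorem nrd_one : q.nrd 1 = 1 := by
  rw [← map_one (algebraMap k A), nrd_algebraMap, one_pow]

theorem nrd_mul (x y : A) : q.nrd (x * y) = q.nrd x * q.nrd y := by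
  refine q.algebraMap_injective ?_
  rw [← mul_conj', conj_mul', mul_assoc, ← mul_assoc y, mul_conj', Algebra.commutes (q.nrd y),
    ← mul_assoc, mul_conj', map_mul]

theorem nrd_conj (x : A) : q.nrd (q.conj x) = q.nrd x := by
  refine q.algebraMap_injective ?_
  rw [← mul_conj', conj_conj, conj_mul_self]

theorem nrd_add (x y : A) : q.nrd (x + y) = q.nrd x + q.nrd y + q.trd (x * q.conj y) := by
  refine q.algebraMap_injective ?_
  rw [map_add, map_add, ← mul_conj', ← mul_conj', ← mul_conj', ← add_conj, conj_mul', conj_conj,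
    conj_add, add_mul, mul_add, mul_add]
  abel

/-- Symmetry of the trace form comes from invariance of the norm under conjugation: compare the
polarised norm at `(x, y)` and at `(x̄, ȳ)`. -/
theorem trd_mul_comm (x y : A) : q.trd (x * y) = q.trd (y * x) := by
  have h : ∀ x y, q.trd (x * q.conj y) = q.trd (q.conj x * y) := fun x y => by
    have h1 := q.nrd_add x y
    rw [← nrd_conj, conj_add, nrd_add, nrd_conj, nrd_conj, conj_conj] at h1
    exact (add_left_cancel h1).symm
  have := h x (q.conj y)
  rw [conj_conj] at this
  rw [this, ← conj_mul', trd_conj]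

theorem mul_self (x : A) :
    x * x = algebraMap k A (q.trd x) * x - algebraMap k A (q.nrd x) := by
  rw [← conj_mul_self, conj, sub_mul]; abel

theorem trd_mul_self (x : A) : q.trd (x * x) = q.trd x ^ 2 - 2 * q.nrd x := by
  rw [q.mul_self, map_sub, ← Algebra.smul_def, map_smul, trd_algebraMap, smul_eq_mul]
  ring

theorem isUnit_of_nrd_ne_zero {x : A} (h : q.nrd x ≠ 0) : IsUnit x := by
  refine isUnit_iff_exists.2 ⟨q.conj x * algebraMap k A (q.nrd x)⁻¹, ?_, ?_⟩
  · rw [← mul_assoc, mul_conj', ← map_mul, mul_inv_cancel₀ h, map_one]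
  · rw [mul_assoc, Algebra.commutes, ← mul_assoc, conj_mul_self, ← map_mul, mul_inv_cancel₀ h,
      map_one]

theorem nrd_ne_zero_of_isUnit {x : A} (h : IsUnit x) : q.nrd x ≠ 0 := by
  obtain ⟨y, hy, -⟩ := isUnit_iff_exists.1 h
  intro h0
  have := congrArg q.nrd hy
  rw [nrd_mul, h0, zero_mul, nrd_one] at this
  exact zero_ne_one this

/-- Conjugate elements have the same trace and norm. -/
theorem trd_eq_of_conj {x g g' : A} (hx : IsUnit x) (h : x * g = g' * x) :
    q.trd g = q.trd g' := by
  obtain ⟨x, rfl⟩ := hx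
  have : g = (↑x⁻¹ : A) * (g' * x) := by rw [← h, ← mul_assoc, Units.inv_mul, one_mul]
  rw [this, trd_mul_comm, mul_assoc, Units.mul_inv, mul_one]

theorem nrd_eq_of_conj {x g g' : A} (hx : IsUnit x) (h : x * g = g' * x) :
    q.nrd g = q.nrd g' := by
  have := congrArg q.nrd h
  rw [nrd_mul, nrd_mul, mul_comm] at this
  exact mul_right_cancel₀ (q.nrd_ne_zero_of_isUnit hx) this

/-- Orthogonal decomposition with respect to `1, g`. -/
theorem exists_decomp (g x : A) (hg : q.trd g ^ 2 - 4 * q.nrd g ≠ 0) :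
    let α := ((q.trd g ^ 2 - 2 * q.nrd g) * q.trd x - q.trd g * q.trd (x * g)) /
      (q.trd g ^ 2 - 4 * q.nrd g)
    let β := (2 * q.trd (x * g) - q.trd g * q.trd x) / (q.trd g ^ 2 - 4 * q.nrd g)
    q.trd (x - algebraMap k A α - algebraMap k A β * g) = 0 ∧
      q.trd ((x - algebraMap k A α - algebraMap k A β * g) * g) = 0 := by
  -- The Gram matrix of `1, g` has determinant `t² - 4n`; `α` and `β` are the Cramer solution of the
  -- orthogonality equations.
  intro α β
  have hgg := q.trd_mul_self g
  have hα : α * (q.trd g ^ 2 - 4 * q.nrd g) = _ := div_mul_cancel₀ _ hg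
  have hβ : β * (q.trd g ^ 2 - 4 * q.nrd g) = _ := div_mul_cancel₀ _ hg
  simp only [sub_mul, map_sub, trd_algebraMap, ← Algebra.smul_def, map_smul, smul_eq_mul,
    smul_mul_assoc, hgg]
  clear_value α β
  constructor
  · refine (mul_eq_zero.1 ?_).resolve_right hg
    linear_combination -2 * hα - q.trd g * hβ
  · refine (mul_eq_zero.1 ?_).resolve_right hg
    linear_combination -q.trd g * hα - (q.trd g ^ 2 - 2 * q.nrd g) * hβ

theorem conj_eq_neg {y : A} (h : q.trd y = 0) : q.conj y = -y := by
  rw [conj, h, map_zero, zero_sub]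

/-- Trace zero means that `y` and `yg` are both negated by the involution; expanding the conjugate
of `yg` combines the two facts. -/
theorem anticomm {g y : A} (h1 : q.trd y = 0) (h2 : q.trd (y * g) = 0) :
    y * g = q.conj g * y := by
  have := q.add_conj (y * g)
  rw [h2, map_zero, conj_mul', q.conj_eq_neg h1, mul_neg, ← sub_eq_add_neg] at this
  exact sub_eq_zero.1 this

/-- The centralizer of `g` is spanned by `1` and `g`. -/
theorem exists_of_commute {g x : A} (hg : q.trd g ^ 2 - 4 * q.nrd g ≠ 0) (h : x * g = g * x) :
    ∃ α β : k, x = algebraMap k A α + algebraMap k A β * g := by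
  have hd := q.exists_decomp g x hg
  simp only at hd
  set α := ((q.trd g ^ 2 - 2 * q.nrd g) * q.trd x - q.trd g * q.trd (x * g)) /
      (q.trd g ^ 2 - 4 * q.nrd g)
  set β := (2 * q.trd (x * g) - q.trd g * q.trd x) / (q.trd g ^ 2 - 4 * q.nrd g)
  refine ⟨α, β, ?_⟩
  set w := x - algebraMap k A α - algebraMap k A β * g with hw
  have h1 := q.anticomm hd.1 hd.2
  have h2 : w * g = g * w := by
    rw [hw, sub_mul, mul_sub, sub_mul, mul_sub, h, ← Algebra.commutes α g, ← mul_assoc g,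
      ← Algebra.commutes β g]
  -- The orthogonal part `w` satisfies both `wg = gw` and `wg = ḡw`. It is killed by `g - ḡ`, whose
  -- square is the nonzero scalar `t² - 4n`.
  have h3 : (g - q.conj g) * w = 0 := by rw [sub_mul, ← h1, h2, sub_self]
  have h4 : (g - q.conj g) * (g - q.conj g) =
      algebraMap k A (q.trd g ^ 2 - 4 * q.nrd g) := by
    rw [sub_mul, mul_sub, mul_sub, mul_conj', conj_mul_self, q.mul_self, q.mul_self (q.conj g),
      trd_conj, nrd_conj, conj, map_sub, map_pow, map_mul, map_ofNat, mul_sub, pow_two]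
    have : (4 : A) * algebraMap k A (q.nrd g) = algebraMap k A (q.nrd g) +
      algebraMap k A (q.nrd g) + algebraMap k A (q.nrd g) + algebraMap k A (q.nrd g) := by
      noncomm_ring
    rw [this]; abel
  have h5 : algebraMap k A (q.trd g ^ 2 - 4 * q.nrd g) * w = 0 := by
    rw [← h4, mul_assoc, h3, mul_zero]
  have h6 : w = 0 := by
    rw [← Algebra.smul_def] at h5
    exact (smul_eq_zero.1 h5).resolve_left hg
  rw [hw, sub_sub, sub_eq_zero] at h6
  exact h6

/-- If the norm vanished on the complement of `k[g]`, so would its polarisation there. The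
complement would then lie in the radical of the trace form, hence be zero, and `A = k[g]` would have
dimension at most two. -/
theorem exists_anticomm_nrd_ne_zero {g : A} (hg : q.trd g ^ 2 - 4 * q.nrd g ≠ 0) :
    ∃ u, q.trd u = 0 ∧ q.trd (u * g) = 0 ∧ q.nrd u ≠ 0 := by
  by_contra! H
  have hW : ∀ y, q.trd y = 0 → q.trd (y * g) = 0 → y = 0 := by
    intro y h1 h2
    refine q.nondeg y fun x => ?_
    have hd := q.exists_decomp g x hg
    simp only at hd
    set α := ((q.trd g ^ 2 - 2 * q.nrd g) * q.trd x - q.trd g * q.trd (x * g)) /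
        (q.trd g ^ 2 - 4 * q.nrd g)
    set β := (2 * q.trd (x * g) - q.trd g * q.trd x) / (q.trd g ^ 2 - 4 * q.nrd g)
    set w := x - algebraMap k A α - algebraMap k A β * g with hw
    have hx : x = w + algebraMap k A α + algebraMap k A β * g := by rw [hw]; abel
    have h3 := q.nrd_add y w
    rw [H y h1 h2, H w hd.1 hd.2, H (y + w) (by rw [map_add, h1, hd.1, add_zero])
      (by rw [add_mul, map_add, h2, hd.2, add_zero]), q.conj_eq_neg hd.1, mul_neg, map_neg] at h3
    have h4 : q.trd (y * w) = 0 := by linear_combination h3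
    rw [hx, mul_add, mul_add, map_add, map_add, h4, ← Algebra.commutes, ← Algebra.smul_def,
      map_smul, h1, ← mul_assoc, ← Algebra.commutes, mul_assoc, ← Algebra.smul_def, map_smul, h2]
    simp
  have : Module.finrank k A ≤ 2 := by
    have hs : Submodule.span k ({1, g} : Set A) = ⊤ := by
      rw [eq_top_iff]
      rintro x -
      have hd := q.exists_decomp g x hg
      simp only at hd
      have := hW _ hd.1 hd.2
      rw [sub_sub, sub_eq_zero] at this
      rw [this, Submodule.mem_span_pair]
      exact ⟨_, _, by rw [Algebra.algebraMap_eq_smul_one, ← Algebra.smul_def]⟩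
    classical
    rw [← finrank_top, ← hs]
    have h1 := finrank_span_finset_le_card (R := k) ({1, g} : Finset A)
    have h2 := Finset.card_le_two (a := (1 : A)) (b := g)
    push_cast at h1
    exact h1.trans h2
  rw [q.finrank_eq] at this
  norm_num at this

end Basic

end QuatStr

/-! ## The structure of local orders -/

section Structure

set_option linter.unusedSectionVars false

open IsLocalRing

variable {k A : Type*} [Field k] [Ring A] [Algebra k A]
variable {O : Type*} [CommRing O] [IsDomain O] [Algebra O k] [IsFractionRing O k] [Algebra O A]
  [IsScalarTower O k A]

/-- The reduced trace and norm are integral on `R`. -/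
def IntegralOn (q : QuatStr k A) (R : Subalgebra O A) : Prop :=
  ∀ x ∈ R, ∃ t n : O, q.trd x = algebraMap O k t ∧ q.nrd x = algebraMap O k n

variable (O) in
theorem algebraMap_mem_of_tower (R : Subalgebra O A) (a : O) :
    algebraMap k A (algebraMap O k a) ∈ R := by
  rw [← IsScalarTower.algebraMap_apply]; exact R.algebraMap_mem a

theorem conj_mem {q : QuatStr k A} {R : Subalgebra O A} (hR : IntegralOn q R) {x : A}
    (hx : x ∈ R) : q.conj x ∈ R := by
  obtain ⟨t, n, ht, -⟩ := hR x hx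
  rw [QuatStr.conj, ht]
  exact sub_mem (algebraMap_mem_of_tower O R t) hx

theorem exists_smul_mem {R : Subalgebra O A} (hR : Submodule.span k (R : Set A) = ⊤) (x : A) :
    ∃ s : O, s ≠ 0 ∧ s • x ∈ R := by
  have hx : x ∈ Submodule.span k (R : Set A) := by rw [hR]; trivial
  induction hx using Submodule.span_induction with
  | mem x hx => exact ⟨1, one_ne_zero, by rwa [one_smul]⟩
  | zero => exact ⟨1, one_ne_zero, by rw [smul_zero]; exact zero_mem _⟩
  | add x y _ _ hx hy =>
    obtain ⟨s, hs, h1⟩ := hx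
    obtain ⟨r, hr, h2⟩ := hy
    refine ⟨r * s, mul_ne_zero hr hs, ?_⟩
    rw [smul_add]
    refine add_mem ?_ ?_
    · rw [mul_smul]; exact R.smul_mem h1 r
    · rw [mul_comm, mul_smul]; exact R.smul_mem h2 s
  | smul c x _ hx =>
    obtain ⟨s, hs, h1⟩ := hx
    obtain ⟨a, b, hb, rfl⟩ := IsFractionRing.div_surjective (A := O) c
    have hb0 : b ≠ 0 := nonZeroDivisors.ne_zero hb
    have hb1 : algebraMap O k b ≠ 0 := by
      rwa [Ne, IsFractionRing.to_map_eq_zero_iff]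
    refine ⟨b * s, mul_ne_zero hb0 hs, ?_⟩
    have : (b * s) • (algebraMap O k a / algebraMap O k b) • x = a • s • x := by
      rw [← algebraMap_smul k (b * s), ← algebraMap_smul k a, ← algebraMap_smul k s, smul_smul,
        smul_smul, map_mul]
      congr 1
      field_simp
    rw [this]
    exact R.smul_mem h1 a

/-- In a discrete valuation ring every nonempty set has an element dividing all the others. -/
theorem exists_dvd_all [IsDiscreteValuationRing O] {T : Set O} (hT : ∃ x ∈ T, x ≠ 0) :
    ∃ x ∈ T, x ≠ 0 ∧ ∀ y ∈ T, x ∣ y := by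
  have hwf : WellFounded (DvdNotUnit (α := O)) := IsWellFounded.wf
  obtain ⟨x, ⟨hx, hx0⟩, hmin⟩ := hwf.has_min {x | x ∈ T ∧ x ≠ 0} hT
  refine ⟨x, hx, hx0, fun y hy => ?_⟩
  by_cases hy0 : y = 0
  · rw [hy0]; exact dvd_zero x
  rcases ValuationRing.dvd_total x y with h | ⟨d, hd⟩
  · exact h
  · by_cases hu : IsUnit d
    · rw [hd, hu.mul_right_dvd]
    · exact (hmin y ⟨hy, hy0⟩ ⟨hy0, d, hu, hd⟩).elim

/-- An identification of the local order `R` with an integral quaternion algebra. -/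
structure LocalModel (q : QuatStr k A) (R : Subalgebra O A) where
  (c₁ c₂ c₃ : O)
  φ : ℍ[O,c₁,c₂,c₃] →ₐ[O] A
  isUnit_disc : IsUnit (c₂ ^ 2 + 4 * c₁)
  c₃_ne_zero : c₃ ≠ 0
  mem_iff : ∀ x, x ∈ R ↔ ∃ y, φ y = x
  trd_eq : ∀ y, q.trd (φ y) = algebraMap O k (Model.tr y)

/-- A unit discriminant makes `O[g]` an orthogonal direct summand of `R`. In the complement choose
`u` in `R` whose norm `-c` divides all norms of such elements. Any other element of `R` in the
complement is `κu` with `κ` in `k[g]`, and minimality forces `κ` into `O[g]`. Thus `R = O[g] ⊕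
O[g]u`. -/
theorem exists_model [IsDiscreteValuationRing O] {q : QuatStr k A} {R : Subalgebra O A}
    (hR : IntegralOn q R) (hspan : Submodule.span k (R : Set A) = ⊤) {g : A} (hg : g ∈ R)
    {t n : O} (ht : q.trd g = algebraMap O k t) (hn : q.nrd g = algebraMap O k n)
    (hu : IsUnit (t ^ 2 - 4 * n)) :
    ∃ M : LocalModel q R, M.φ ⟨0, 1, 0, 0⟩ = g := by
  have inj := IsFractionRing.injective O k
  obtain ⟨Δ, hΔ⟩ := hu
  have hΔk : q.trd g ^ 2 - 4 * q.nrd g = algebraMap O k Δ := by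
    rw [ht, hn, hΔ, map_sub, map_pow, map_mul, map_ofNat]
  have hΔ0 : q.trd g ^ 2 - 4 * q.nrd g ≠ 0 := by
    rw [hΔk]; simp
  have hdiv : ∀ a : O, algebraMap O k a / (q.trd g ^ 2 - 4 * q.nrd g) =
      algebraMap O k (a * (Δ⁻¹ : Oˣ)) := fun a => by
    rw [div_eq_iff hΔ0, hΔk, ← map_mul, mul_assoc, Units.inv_mul, mul_one]
  -- the anticommuting element of minimal norm
  obtain ⟨c, ⟨u, huR, hu1, hu2, huc⟩, hc0, hmin⟩ : ∃ c ∈ {c : O | ∃ u ∈ R, q.trd u = 0 ∧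
      q.trd (u * g) = 0 ∧ q.nrd u = algebraMap O k (-c)}, c ≠ 0 ∧ ∀ d ∈ {c : O | ∃ u ∈ R,
      q.trd u = 0 ∧ q.trd (u * g) = 0 ∧ q.nrd u = algebraMap O k (-c)}, c ∣ d := by
    refine exists_dvd_all ?_
    obtain ⟨u, hu1, hu2, hu3⟩ := q.exists_anticomm_nrd_ne_zero hΔ0
    obtain ⟨s, hs, hsu⟩ := exists_smul_mem hspan u
    obtain ⟨-, n', -, hn'⟩ := hR _ hsu
    have hsu' : s • u = algebraMap k A (algebraMap O k s) * u := by
      rw [← Algebra.smul_def, algebraMap_smul]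
    refine ⟨-n', ⟨s • u, hsu, ?_, ?_, by rw [neg_neg, hn']⟩, ?_⟩
    · rw [← algebraMap_smul k s u, map_smul, hu1, smul_zero]
    · rw [← algebraMap_smul k s u, smul_mul_assoc, map_smul, hu2, smul_zero]
    · rw [neg_ne_zero]
      rintro rfl
      rw [hsu', q.nrd_mul, q.nrd_algebraMap, map_zero] at hn'
      refine mul_ne_zero (pow_ne_zero 2 ?_) hu3 hn'
      rwa [Ne, IsFractionRing.to_map_eq_zero_iff]
  have hck : algebraMap O k c ≠ 0 := by rwa [Ne, IsFractionRing.to_map_eq_zero_iff]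
  have huu : u * u = algebraMap k A (algebraMap O k c) := by
    rw [q.mul_self, hu1, huc, map_zero, zero_mul, map_neg, map_neg, zero_sub, neg_neg]
  have hug : u * g = q.conj g * u := q.anticomm hu1 hu2
  have hgg : g * g = -n • (1 : A) + t • g := by
    rw [q.mul_self, ht, hn, ← Algebra.smul_def, algebraMap_smul, neg_smul,
      Algebra.smul_def n (1 : A), mul_one, ← IsScalarTower.algebraMap_apply]
    abel
  -- Because `g² = tg - n` and `u² = c`, the parameters are `(-n, t, c)` and `c₂² + 4c₁` is the
  -- discriminant of `g`.
  let b : QuaternionAlgebra.Basis A (-n) t c :=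
    { i := g, j := u, k := g * u
      i_mul_i := hgg
      j_mul_j := by
        rw [huu, Algebra.smul_def, mul_one, ← IsScalarTower.algebraMap_apply]
      i_mul_j := rfl
      j_mul_i := by
        rw [hug, QuatStr.conj, ht, sub_mul, ← Algebra.smul_def, algebraMap_smul] }
  have hb : ∀ y, b.liftHom y = algebraMap O A y.re + y.imI • g + y.imJ • u + y.imK • (g * u) :=
    fun y => rfl
  have hgu : g * u ∈ R := mul_mem hg huR
  have trd_gu : q.trd (g * u) = 0 := by rw [q.trd_mul_comm, hu2]
  have smul_eq : ∀ (a : O) (x : A), a • x = (algebraMap O k a) • x := fun a x =>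
    (algebraMap_smul k a x).symm
  refine ⟨⟨-n, t, c, b.liftHom, ⟨Δ, by rw [hΔ]; ring⟩, hc0, fun x => ⟨fun hx => ?_, ?_⟩, ?_⟩, ?_⟩
  · obtain ⟨tx, nx, htx, hnx⟩ := hR x hx
    obtain ⟨tg, ng, htg, hng⟩ := hR (x * g) (mul_mem hx hg)
    have hd := q.exists_decomp g x hΔ0
    have e1 : ((q.trd g ^ 2 - 2 * q.nrd g) * q.trd x - q.trd g * q.trd (x * g)) /
        (q.trd g ^ 2 - 4 * q.nrd g) =
        algebraMap O k (((t ^ 2 - 2 * n) * tx - t * tg) * (Δ⁻¹ : Oˣ)) := by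
      rw [← hdiv, ht, hn, htx, htg]; simp only [map_sub, map_mul, map_pow, map_ofNat]
    have e2 : (2 * q.trd (x * g) - q.trd g * q.trd x) / (q.trd g ^ 2 - 4 * q.nrd g) =
        algebraMap O k ((2 * tg - t * tx) * (Δ⁻¹ : Oˣ)) := by
      rw [← hdiv, ht, htx, htg]; simp only [map_sub, map_mul, map_ofNat]
    simp only [e1, e2] at hd
    set α := ((t ^ 2 - 2 * n) * tx - t * tg) * (Δ⁻¹ : Oˣ)
    set β := (2 * tg - t * tx) * (Δ⁻¹ : Oˣ)
    set w := x - algebraMap k A (algebraMap O k α) - algebraMap k A (algebraMap O k β) * g with hw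
    have hwR : w ∈ R := by
      refine sub_mem (sub_mem hx (algebraMap_mem_of_tower O R α)) (mul_mem ?_ hg)
      exact algebraMap_mem_of_tower O R β
    clear_value w
    -- `w = κ u` with `κ` in the centralizer of `g`
    have hwg := q.anticomm hd.1 hd.2
    have hconj : u * q.conj g = g * u := by
      rw [QuatStr.conj, mul_sub, hug, QuatStr.conj, sub_mul, Algebra.commutes, sub_sub_cancel]
    obtain ⟨γ, ε, hκ⟩ := q.exists_of_commute (g := g)
      (x := w * u * algebraMap k A (algebraMap O k c)⁻¹) hΔ0 (by
        rw [mul_assoc, Algebra.commutes, ← mul_assoc, mul_assoc w, hug, mul_assoc, mul_assoc]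
        have hwc : w * q.conj g = g * w := by
          rw [QuatStr.conj, mul_sub, hwg, QuatStr.conj, sub_mul, Algebra.commutes (q.trd g) w,
            sub_sub_cancel]
        rw [← mul_assoc (q.conj g), ← mul_assoc w, ← mul_assoc w, hwc]
        simp only [mul_assoc])
    set κ := w * u * algebraMap k A (algebraMap O k c)⁻¹ with hκdef
    have hwκ : w = κ * u := by
      rw [hκdef, mul_assoc, Algebra.commutes, ← mul_assoc, mul_assoc w, huu, mul_assoc, ← map_mul,
        mul_inv_cancel₀ hck, map_one, mul_one]
    -- The element `(κ + y)u` of `R` is orthogonal to `1` and `g`, so its norm is a multiple of `c`;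
    -- dividing by the norm of `u` makes `nrd (κ + y)` integral.
    have hκint : ∀ y ∈ R, (q.trd (y * u) = 0) → q.trd (y * u * g) = 0 →
        ∃ d : O, q.nrd (κ + y) = algebraMap O k d := by
      intro y hy hy1 hy2
      have hm : w + y * u ∈ R := add_mem hwR (mul_mem hy huR)
      obtain ⟨-, m, -, hm'⟩ := hR _ hm
      obtain ⟨d, hd'⟩ := hmin (-m) ⟨_, hm, by rw [map_add, hd.1, hy1, add_zero],
        by rw [add_mul, map_add, hd.2, hy2, add_zero], by rw [neg_neg, hm']⟩
      refine ⟨d, ?_⟩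
      rw [hwκ, ← add_mul, q.nrd_mul, huc] at hm'
      have : algebraMap O k (-m) = algebraMap O k c * algebraMap O k d := by rw [hd', map_mul]
      rw [map_neg] at this hm'
      refine mul_right_cancel₀ hck ?_
      linear_combination -hm' + this
    have hugg : q.trd (g * u * g) = 0 := by
      rw [mul_assoc, hug, ← mul_assoc, q.mul_conj', ← Algebra.smul_def, map_smul, hu1, smul_zero]
    -- Taking `y = 0, 1, g` makes `trd κ` and `trd (κḡ)` integral by polarisation. The coordinates
    -- of `κ` then follow by Cramer's rule with determinant the unit `Δ`, up to sign.
    obtain ⟨d0, hd0⟩ := hκint 0 (zero_mem _) (by simp) (by simp)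
    obtain ⟨d1, hd1⟩ := hκint 1 (one_mem _) (by rw [one_mul, hu1]) (by rw [one_mul, hu2])
    obtain ⟨d2, hd2⟩ := hκint g hg trd_gu hugg
    rw [add_zero] at hd0
    rw [q.nrd_add, hd0, q.nrd_one, ← map_one (algebraMap k A), q.conj_algebraMap, map_one, mul_one,
      hκ, map_add, q.trd_algebraMap, ← Algebra.smul_def, map_smul, smul_eq_mul, ht] at hd1
    rw [q.nrd_add, hd0, hn, hκ, add_mul, mul_assoc, q.mul_conj', map_add, ← Algebra.smul_def,
      map_smul, smul_eq_mul, q.trd_conj, ← map_mul, q.trd_algebraMap, ht, hn] at hd2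
    have hγ : γ = algebraMap O k ((t * (d2 - d0 - n) - 2 * n * (d1 - d0 - 1)) * (Δ⁻¹ : Oˣ)) := by
      rw [← hdiv, eq_div_iff hΔ0, ht, hn]
      simp only [map_sub, map_mul, map_ofNat, map_one]
      linear_combination algebraMap O k t * hd2 - 2 * algebraMap O k n * hd1
    have hε : ε = algebraMap O k ((t * (d1 - d0 - 1) - 2 * (d2 - d0 - n)) * (Δ⁻¹ : Oˣ)) := by
      rw [← hdiv, eq_div_iff hΔ0, ht, hn]
      simp only [map_sub, map_mul, map_ofNat, map_one]
      linear_combination algebraMap O k t * hd1 - 2 * hd2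
    obtain ⟨γ', hγ'⟩ : ∃ γ', γ = algebraMap O k γ' := ⟨_, hγ⟩
    obtain ⟨ε', hε'⟩ : ∃ ε', ε = algebraMap O k ε' := ⟨_, hε⟩
    refine ⟨⟨α, β, γ', ε'⟩, ?_⟩
    rw [hb, smul_eq, smul_eq, smul_eq, ← hγ', ← hε']
    have hx' : x = algebraMap k A (algebraMap O k α) + algebraMap k A (algebraMap O k β) * g +
        w := by rw [hw]; abel
    rw [hx', hwκ, hκ, add_mul, IsScalarTower.algebraMap_apply O k A, Algebra.smul_def,
      Algebra.smul_def, Algebra.smul_def, mul_assoc]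
    abel
  · rintro ⟨y, rfl⟩
    rw [hb]
    exact add_mem (add_mem (add_mem (R.algebraMap_mem _) (R.smul_mem hg _))
      (R.smul_mem huR _)) (R.smul_mem hgu _)
  · intro y
    change q.trd (b.liftHom y) = _
    rw [hb, smul_eq, smul_eq, smul_eq, IsScalarTower.algebraMap_apply O k A]
    simp only [map_add, map_smul, q.trd_algebraMap, ht, hu1, trd_gu, Model.tr, map_mul, map_ofNat,
      smul_eq_mul]
    ring
  · change b.liftHom _ = g
    rw [hb]; simp

end Structure

/-! ### Unit groups and normalizers of local orders, and their description in a model. -/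

/-- The units of a local order. -/
def localUnits {O A : Type*} [CommRing O] [Ring A] [Algebra O A] (R : Subalgebra O A) :
    Subgroup Aˣ := R.toSubmonoid.units

theorem mem_localUnits {O A : Type*} [CommRing O] [Ring A] [Algebra O A] {R : Subalgebra O A}
    {u : Aˣ} : u ∈ localUnits R ↔ (u : A) ∈ R ∧ ((u⁻¹ : Aˣ) : A) ∈ R :=
  Submonoid.mem_units_iff _ _

/-- The normalizer of a local order. -/
def localNormalizer {O A : Type*} [CommRing O] [Ring A] [Algebra O A] (R : Subalgebra O A) :
    Subgroup Aˣ where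
  carrier := {z | ∀ y : A, (z : A) * y * ((z⁻¹ : Aˣ) : A) ∈ R ↔ y ∈ R}
  one_mem' := by simp
  mul_mem' := by
    intro a b ha hb y
    rw [← hb y, ← ha ((b : A) * y * ((b⁻¹ : Aˣ) : A))]
    simp [mul_assoc]
  inv_mem' := by
    intro a ha y
    rw [← ha]
    simp [mul_assoc]

theorem localUnits_le {O A : Type*} [CommRing O] [Ring A] [Algebra O A] (R : Subalgebra O A) :
    localUnits R ≤ localNormalizer R := by
  intro u hu y
  rw [mem_localUnits] at hu
  constructor
  · intro h
    have := mul_mem (mul_mem hu.2 h) hu.1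
    simpa [mul_assoc] using this
  · intro h
    exact mul_mem (mul_mem hu.1 h) hu.2

/-- Conjugation by elements of the normalizer preserves the units. -/
theorem conj_mem_localUnits {O A : Type*} [CommRing O] [Ring A] [Algebra O A]
    {R : Subalgebra O A} {z u : Aˣ} (hz : z ∈ localNormalizer R) (hu : u ∈ localUnits R) :
    z * u * z⁻¹ ∈ localUnits R := by
  rw [mem_localUnits] at hu ⊢
  refine ⟨by simpa using (hz _).2 hu.1, ?_⟩
  have := (hz _).2 hu.2
  simpa [mul_assoc] using this

/-- The embedding `kˣ → Aˣ`. -/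
abbrev scalarMap (k A : Type*) [Field k] [Ring A] [Algebra k A] : kˣ →* Aˣ :=
  Units.map (algebraMap k A : k →* A)

theorem scalarMap_comm {k A : Type*} [Field k] [Ring A] [Algebra k A] (c : kˣ) (x : Aˣ) :
    scalarMap k A c * x = x * scalarMap k A c :=
  Units.ext (Algebra.commutes _ _)

section LocalGroups

set_option linter.unusedSectionVars false

open IsLocalRing

variable {k A : Type*} [Field k] [Ring A] [Algebra k A]
variable {O : Type*} [CommRing O] [IsDomain O] [Algebra O k] [IsFractionRing O k] [Algebra O A]
  [IsScalarTower O k A]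
variable {q : QuatStr k A} {R : Subalgebra O A}

namespace LocalModel

variable (M : LocalModel q R)

theorem conj_eq (y) : q.conj (M.φ y) = M.φ (star y) := by
  rw [QuatStr.conj, M.trd_eq, Model.star_eq, map_sub, AlgHom.commutes,
    ← IsScalarTower.algebraMap_apply]

theorem nrd_eq (y) : q.nrd (M.φ y) = algebraMap O k (Model.nr y) := by
  refine q.algebraMap_injective ?_
  rw [← q.mul_conj', conj_eq, ← map_mul, Model.mul_star_eq, AlgHom.commutes,
    ← IsScalarTower.algebraMap_apply]

theorem injective : Function.Injective M.φ := by
  refine (injective_iff_map_eq_zero M.φ).2 fun x hx => ?_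
  refine Model.tr_eq_zero_forall M.isUnit_disc.ne_zero M.c₃_ne_zero fun y => ?_
  refine IsFractionRing.injective O k ?_
  rw [← M.trd_eq, map_mul, hx, zero_mul, map_zero, map_zero]

theorem exists_unit {y : ℍ[O,M.c₁,M.c₂,M.c₃]} (hy : IsUnit (Model.nr y)) :
    ∃ r ∈ localUnits R, (r : A) = M.φ y := by
  obtain ⟨u, rfl⟩ := Model.isUnit_of_isUnit_nr hy
  refine ⟨Units.map (M.φ : _ →* A) u, mem_localUnits.2 ⟨?_, ?_⟩, rfl⟩
  · exact (M.mem_iff _).2 ⟨_, rfl⟩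
  · rw [← map_inv]
    exact (M.mem_iff _).2 ⟨_, rfl⟩

theorem exists_of_mem_localUnits {r : Aˣ} (hr : r ∈ localUnits R) :
    ∃ y, M.φ y = r ∧ IsUnit (Model.nr y) := by
  rw [mem_localUnits] at hr
  obtain ⟨y, hy⟩ := (M.mem_iff _).1 hr.1
  obtain ⟨y', hy'⟩ := (M.mem_iff _).1 hr.2
  refine ⟨y, hy, IsUnit.of_mul_eq_one (Model.nr y') ?_⟩
  have : y * y' = 1 := M.injective (by rw [map_mul, hy, hy', Units.mul_inv, map_one])
  rw [← Model.nr_mul, this]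
  simp [Model.nr]

theorem exists_u : ∃ u : Aˣ, (u : A) = M.φ Model.jj := by
  have : IsUnit (M.φ Model.jj) := by
    refine q.isUnit_of_nrd_ne_zero ?_
    rw [nrd_eq, Ne, IsFractionRing.to_map_eq_zero_iff]
    simpa [Model.nr, Model.jj] using M.c₃_ne_zero
  exact ⟨this.unit, this.unit_spec⟩

/-- The image of the generator `j`. -/
def u : Aˣ := M.exists_u.choose

theorem coe_u : (M.u : A) = M.φ Model.jj := M.exists_u.choose_spec

theorem u_mem : M.u ∈ localNormalizer R := by
  intro y
  constructor
  · intro h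
    obtain ⟨x, hx⟩ := (M.mem_iff _).1 h
    refine (M.mem_iff _).2 ⟨Model.twist x, ?_⟩
    have h1 := congrArg (· * (M.u : A)) hx
    simp only [mul_assoc, Units.inv_mul, mul_one] at h1
    rw [coe_u, ← map_mul, Model.mul_jj, map_mul, ← coe_u] at h1
    exact M.u.isUnit.mul_left_cancel h1
  · intro h
    obtain ⟨x, rfl⟩ := (M.mem_iff _).1 h
    refine (M.mem_iff _).2 ⟨Model.twist x, ?_⟩
    rw [Units.eq_mul_inv_iff_mul_eq, coe_u, ← map_mul, ← map_mul, Model.jj_mul]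

theorem u_mul_u : ∃ c : kˣ, M.u * M.u = scalarMap k A c := by
  have h0 : algebraMap O k M.c₃ ≠ 0 := by
    rw [Ne, IsFractionRing.to_map_eq_zero_iff]; exact M.c₃_ne_zero
  refine ⟨Units.mk0 _ h0, Units.ext ?_⟩
  change (M.u : A) * M.u = algebraMap k A (algebraMap O k M.c₃)
  rw [coe_u, ← map_mul, ← IsScalarTower.algebraMap_apply, ← M.φ.commutes,
    QuaternionAlgebra.algebraMap_eq]
  congr 1
  ext <;> simp [Model.jj]

theorem u_mem_localUnits (h : IsUnit M.c₃) : M.u ∈ localUnits R := by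
  obtain ⟨r, hr, hr'⟩ := M.exists_unit (y := Model.jj) (by
    have : Model.nr (Model.jj : ℍ[O,M.c₁,M.c₂,M.c₃]) = -M.c₃ := by simp [Model.nr, Model.jj]
    rw [this]; exact h.neg)
  have : M.u = r := Units.ext (by rw [coe_u, hr'])
  rwa [this]

/-- Clearing denominators in `j = cr`, a nonzero multiple of `r` is a multiple of `j`. So `r` has no
component in `O[i]`, and its norm, a unit, would be divisible by `c₃`. -/
theorem u_ne (h : ¬ IsUnit M.c₃) (c : kˣ) {r : Aˣ} (hr : r ∈ localUnits R) :
    M.u ≠ scalarMap k A c * r := by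
  intro H
  obtain ⟨y, hy, hy'⟩ := M.exists_of_mem_localUnits hr
  obtain ⟨a, b, hb, hc⟩ := IsFractionRing.div_surjective (A := O) (c : k)
  have hb0 : b ≠ 0 := nonZeroDivisors.ne_zero hb
  have hb1 : algebraMap O k b ≠ 0 := by rwa [Ne, IsFractionRing.to_map_eq_zero_iff]
  have ha0 : a ≠ 0 := by
    rintro rfl
    rw [map_zero, zero_div] at hc
    exact c.ne_zero hc.symm
  have h1 : M.φ (b • Model.jj) = M.φ (a • y) := by
    rw [map_smul, map_smul, ← coe_u, H, hy]
    change b • (algebraMap k A c * (r : A)) = _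
    rw [← hc, ← Algebra.smul_def, ← algebraMap_smul k b, ← algebraMap_smul k a (r : A), smul_smul]
    congr 1
    field_simp
  have h2 := M.injective h1
  rw [QuaternionAlgebra.ext_iff] at h2
  simp only [QuaternionAlgebra.re_smul, QuaternionAlgebra.imI_smul, Model.jj, smul_eq_mul,
    mul_zero] at h2
  have hre := (mul_eq_zero.1 h2.1.symm).resolve_left ha0
  have him := (mul_eq_zero.1 h2.2.1.symm).resolve_left ha0
  rw [Model.nr, hre, him] at hy'
  refine h (isUnit_of_dvd_unit ?_ hy')
  exact ⟨-(y.imJ ^ 2 + M.c₂ * y.imJ * y.imK - M.c₁ * y.imK ^ 2), by ring⟩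

/-- Two maximal embeddings of a quadratic order are conjugate under the group generated by the
units and `u`. -/
theorem exists_decomp [IsDiscreteValuationRing O] [Finite (ResidueField O)] {h g' : A} (hh : h ∈ R)
    (hg' : g' ∈ R) {x : Aˣ} (hx : x * h = g' * x) {t n : O} (ht : q.trd h = algebraMap O k t)
    (hn : q.nrd h = algebraMap O k n) (hmax : Model.IsMaxPoly t n) :
    ∃ r ∈ localUnits R, ∃ κ : Aˣ, (κ : A) * h = h * κ ∧ (x = r * κ ∨ x = r * M.u * κ) := by
  have inj := IsFractionRing.injective O k
  have ht' := q.trd_eq_of_conj x.isUnit hx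
  have hn' := q.nrd_eq_of_conj x.isUnit hx
  obtain ⟨y, rfl⟩ := (M.mem_iff _).1 hh
  obtain ⟨y', rfl⟩ := (M.mem_iff _).1 hg'
  rw [M.trd_eq] at ht
  rw [M.nrd_eq] at hn
  rw [M.trd_eq, M.trd_eq] at ht'
  rw [M.nrd_eq, M.nrd_eq] at hn'
  rw [← inj ht, ← inj hn] at hmax
  obtain ⟨w, hw, hconj⟩ := Model.exists_conj M.isUnit_disc (inj ht') (inj hn') hmax
  obtain ⟨r, hr, hrw⟩ := M.exists_unit hw
  -- Two elements conjugating the same source to the same target differ by an element centralizing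
  -- the source.
  have key : ∀ z : Aˣ, (z : A) * M.φ y = M.φ y' * z →
      ((z⁻¹ * x : Aˣ) : A) * M.φ y = M.φ y * ((z⁻¹ * x : Aˣ) : A) := by
    intro z hz
    rw [Units.val_mul, mul_assoc, hx, ← mul_assoc, ← mul_assoc]
    congr 1
    rw [Units.inv_mul_eq_iff_eq_mul, ← mul_assoc, hz, mul_assoc, Units.mul_inv, mul_one]
  refine ⟨r, hr, ?_⟩
  rcases hconj with hc | hc
  · refine ⟨r⁻¹ * x, key r ?_, Or.inl (by group)⟩
    rw [hrw, ← map_mul, hc, map_mul]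
  · refine ⟨(r * M.u)⁻¹ * x, key (r * M.u) ?_, Or.inr (by group)⟩
    rw [Units.val_mul, hrw, coe_u, ← map_mul, ← map_mul, hc, map_mul]

end LocalModel

/-- The discriminant equals `(t - 2α)² - 4(α² - αt + n)`, so an `α` violating maximality would put
it in the maximal ideal. -/
theorem isMaxPoly_of_isUnit [IsLocalRing O] {t n : O} (h : IsUnit (t ^ 2 - 4 * n)) :
    Model.IsMaxPoly t n := by
  rintro α ⟨h1, h2⟩
  have h3 : t ^ 2 - 4 * n ∈ maximalIdeal O := by
    have : t ^ 2 - 4 * n = (t - 2 * α) * (t - 2 * α) - 4 * (α ^ 2 - α * t + n) := by ring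
    rw [this]
    exact sub_mem (Ideal.mul_mem_left _ _ h1)
      (Ideal.mul_mem_left _ _ (Ideal.pow_le_self two_ne_zero h2))
  exact h3 h

/-- Elements of the normalizer that centralize an étale quadratic subring are scalar multiples of
units. -/
theorem exists_scalar_mul_unit [IsDiscreteValuationRing O]
    (hR : IntegralOn q R) (hspan : Submodule.span k (R : Set A) = ⊤) {g : A} (hg : g ∈ R)
    {t n : O} (ht : q.trd g = algebraMap O k t) (hn : q.nrd g = algebraMap O k n)
    (hu : IsUnit (t ^ 2 - 4 * n)) {κ : Aˣ} (hκ : κ ∈ localNormalizer R)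
    (hκg : (κ : A) * g = g * κ) :
    ∃ c : kˣ, ∃ r ∈ localUnits R, κ = scalarMap k A c * r := by
  -- The model is built on `g` itself, so that `κ` lies in the span of `1` and `i`.
  obtain ⟨M, rfl⟩ := exists_model hR hspan hg ht hn hu
  have hΔ0 : q.trd (M.φ ⟨0, 1, 0, 0⟩) ^ 2 - 4 * q.nrd (M.φ ⟨0, 1, 0, 0⟩) ≠ 0 := by
    have : q.trd (M.φ ⟨0, 1, 0, 0⟩) ^ 2 - 4 * q.nrd (M.φ ⟨0, 1, 0, 0⟩) =
        algebraMap O k (t ^ 2 - 4 * n) := by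
      rw [ht, hn, map_sub, map_pow, map_mul, map_ofNat]
    rw [this, Ne, IsFractionRing.to_map_eq_zero_iff]
    exact hu.ne_zero
  obtain ⟨α, β, hαβ⟩ := q.exists_of_commute hΔ0 hκg
  have hφ : ∀ a b : O, M.φ ⟨a, b, 0, 0⟩ = algebraMap k A (algebraMap O k a) +
      algebraMap k A (algebraMap O k b) * M.φ ⟨0, 1, 0, 0⟩ := by
    intro a b
    have : (⟨a, b, 0, 0⟩ : ℍ[O,M.c₁,M.c₂,M.c₃]) = algebraMap O _ a + b • ⟨0, 1, 0, 0⟩ := by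
      rw [QuaternionAlgebra.algebraMap_eq]; ext <;> simp
    rw [this, map_add, AlgHom.commutes, map_smul, Algebra.smul_def,
      IsScalarTower.algebraMap_apply O k A, IsScalarTower.algebraMap_apply O k A]
  -- In a valuation ring one of the ratios of the two coordinates is integral, so `κ` can be scaled
  -- to a primitive element of `O[i]`.
  obtain ⟨c, a, b, hab, hc0, hκ'⟩ : ∃ (c : k) (a b : O), (a = 1 ∨ b = 1) ∧ c ≠ 0 ∧
      (κ : A) = algebraMap k A c * M.φ ⟨a, b, 0, 0⟩ := by
    by_cases hα : α = 0
    · refine ⟨β, 0, 1, Or.inr rfl, ?_, ?_⟩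
      · rintro rfl
        rw [hα, map_zero, zero_mul, zero_add] at hαβ
        have := q.nrd_ne_zero_of_isUnit κ.isUnit
        rw [hαβ, ← map_zero (algebraMap k A), q.nrd_algebraMap] at this
        simp at this
      · rw [hφ, hαβ, hα]; simp
    · rcases ValuationRing.isInteger_or_isInteger O (β / α) with ⟨b, hb⟩ | ⟨a, ha⟩
      · refine ⟨α, 1, b, Or.inl rfl, hα, ?_⟩
        rw [hφ, hαβ, hb, mul_add, ← mul_assoc, ← map_mul, ← map_mul, map_one, mul_one,
          mul_div_cancel₀ _ hα]
      · by_cases hβ : β = 0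
        · refine ⟨α, 1, 0, Or.inl rfl, hα, ?_⟩
          rw [hφ, hαβ, hβ]; simp
        · refine ⟨β, a, 1, Or.inr rfl, hβ, ?_⟩
          rw [hφ, hαβ, ha, mul_add, ← mul_assoc, ← map_mul, ← map_mul, map_one, mul_one, inv_div,
            mul_div_cancel₀ _ hβ]
  -- The normalizing condition is only needed at `j`: it prevents the primitive element from having
  -- non-unit norm.
  have hnorm := (hκ (M.u : A)).2 (by rw [M.coe_u]; exact (M.mem_iff _).2 ⟨_, rfl⟩)
  obtain ⟨r, hr⟩ := (M.mem_iff _).1 hnorm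
  rw [Units.eq_mul_inv_iff_mul_eq] at hr
  have hu' : IsUnit (Model.nr (⟨a, b, 0, 0⟩ : ℍ[O,M.c₁,M.c₂,M.c₃])) := by
    refine Model.isUnit_nr_of_normalizes M.isUnit_disc hab (r := r) (M.injective ?_)
    rw [map_mul, map_mul, ← M.coe_u]
    have hcu : IsUnit (algebraMap k A c) := (IsUnit.mk0 c hc0).map _
    refine hcu.mul_left_cancel ?_
    rw [← mul_assoc, ← hκ', ← hr, hκ', ← mul_assoc, ← mul_assoc, Algebra.commutes]
  obtain ⟨w, hw, hw'⟩ := M.exists_unit hu'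
  exact ⟨Units.mk0 c hc0, w, hw, Units.ext (by rw [hκ', Units.val_mul, hw']; rfl)⟩

/-- The normalizer of a local order is generated by scalars, units, and `u`. -/
theorem LocalModel.exists_of_mem_localNormalizer [IsDiscreteValuationRing O]
    [Finite (ResidueField O)] (M : LocalModel q R) (hR : IntegralOn q R)
    (hspan : Submodule.span k (R : Set A) = ⊤) {z : Aˣ} (hz : z ∈ localNormalizer R) :
    ∃ c : kˣ, ∃ r ∈ localUnits R, z = scalarMap k A c * r ∨ z = scalarMap k A c * r * M.u := by
  have hg : M.φ ⟨0, 1, 0, 0⟩ ∈ R := (M.mem_iff _).2 ⟨_, rfl⟩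
  have hu : IsUnit (Model.tr (⟨0, 1, 0, 0⟩ : ℍ[O,M.c₁,M.c₂,M.c₃]) ^ 2 -
      4 * Model.nr (⟨0, 1, 0, 0⟩ : ℍ[O,M.c₁,M.c₂,M.c₃])) := by
    convert M.isUnit_disc using 1
    simp [Model.tr, Model.nr]
  -- The elements `i` and `z i z⁻¹` both lie in `R` and are conjugate. Removing a unit, or a unit
  -- times `u`, from `z` leaves an element of the normalizer that centralizes `i`.
  obtain ⟨r, hr, κ, hκ, hz'⟩ := M.exists_decomp hg ((hz _).2 hg) (x := z) (by simp [mul_assoc])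
    (M.trd_eq _) (M.nrd_eq _) (isMaxPoly_of_isUnit hu)
  have hκN : κ ∈ localNormalizer R := by
    have hr' := localUnits_le R hr
    rcases hz' with rfl | rfl
    · exact (Subgroup.mul_mem_cancel_left _ hr').1 hz
    · exact (Subgroup.mul_mem_cancel_left _ (mul_mem hr' M.u_mem)).1 hz
  obtain ⟨c, r', hr', rfl⟩ := exists_scalar_mul_unit hR hspan hg (M.trd_eq _) (M.nrd_eq _) hu hκN hκ
  rcases hz' with rfl | rfl
  · refine ⟨c, r * r', mul_mem hr hr', Or.inl ?_⟩
    rw [← mul_assoc, ← scalarMap_comm, mul_assoc]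
  · refine ⟨c, r * (M.u * r' * M.u⁻¹), mul_mem hr (conj_mem_localUnits M.u_mem hr'), Or.inr ?_⟩
    rw [← mul_assoc (r * M.u), ← scalarMap_comm]
    group

end LocalGroups

/-! ## Gram determinants and étale elements -/

namespace Model

variable {O : Type*} [CommRing O] {c₁ c₂ c₃ : O}

/-- The coordinates of a quaternion. -/
def coords (x : ℍ[O,c₁,c₂,c₃]) : Fin 4 → O := ![x.re, x.imI, x.imJ, x.imK]

/-- The standard basis. -/
def stdBasis : Fin 4 → ℍ[O,c₁,c₂,c₃] :=
  ![⟨1, 0, 0, 0⟩, ⟨0, 1, 0, 0⟩, ⟨0, 0, 1, 0⟩, ⟨0, 0, 0, 1⟩]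

/-- The Gram matrix of the trace form. -/
def gram (c₁ c₂ c₃ : O) : Matrix (Fin 4) (Fin 4) O :=
  !![2, c₂, 0, 0; c₂, 2 * c₁ + c₂ ^ 2, 0, 0; 0, 0, 2 * c₃, c₂ * c₃;
    0, 0, c₂ * c₃, -(2 * c₁ * c₃)]

theorem det_gram : (gram c₁ c₂ c₃).det = -((c₂ ^ 2 + 4 * c₁) ^ 2 * c₃ ^ 2) := by
  simp [gram, Matrix.det_succ_row_zero, Fin.sum_univ_succ, Fin.succAbove]
  ring

theorem of_tr_mul (y : Fin 4 → ℍ[O,c₁,c₂,c₃]) :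
    Matrix.of (fun i j => tr (y i * y j)) =
      Matrix.of (fun i => coords (y i)) * gram c₁ c₂ c₃ *
        (Matrix.of (fun i => coords (y i))).transpose := by
  ext i j
  simp [Matrix.mul_apply, Fin.sum_univ_four, coords, gram, tr]
  ring

theorem det_of_tr_mul (y : Fin 4 → ℍ[O,c₁,c₂,c₃]) :
    (Matrix.of fun i j => tr (y i * y j)).det =
      -((Matrix.of fun i => coords (y i)).det * (c₂ ^ 2 + 4 * c₁) * c₃) ^ 2 := by
  rw [of_tr_mul, Matrix.det_mul, Matrix.det_mul, Matrix.det_transpose, det_gram]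
  ring

theorem det_coords_stdBasis :
    (Matrix.of fun i => coords (stdBasis i : ℍ[O,c₁,c₂,c₃])).det = 1 := by
  have : (Matrix.of fun i => coords (stdBasis i : ℍ[O,c₁,c₂,c₃])) = 1 := by
    ext i j
    fin_cases i <;> fin_cases j <;> simp [coords, stdBasis]
  rw [this, Matrix.det_one]

end Model

section Etale

set_option linter.unusedSectionVars false

open IsLocalRing

variable {k A : Type*} [Field k] [Ring A] [Algebra k A]
variable {O : Type*} [CommRing O] [IsDomain O] [Algebra O k] [IsFractionRing O k] [Algebra O A]
  [IsScalarTower O k A]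

/-- Some Gram determinant of the trace form on `S` is a unit. -/
def HasUnitGram (ι : Type*) [Fintype ι] [DecidableEq ι] (q : QuatStr k A) (S : Subalgebra O A) :
    Prop :=
  ∃ x : ι → A, (∀ i, x i ∈ S) ∧ ∃ d : O, IsUnit d ∧
    (Matrix.of fun i j => q.trd (x i * x j)).det = algebraMap O k d

/-- In the model every Gram determinant is minus the square of a coordinate determinant times `Δc₃`,
and the standard basis has coordinate determinant one. -/
theorem LocalModel.isUnit_c₃_iff {q : QuatStr k A} {R : Subalgebra O A} (M : LocalModel q R) :
    IsUnit M.c₃ ↔ HasUnitGram (Fin 4) q R := by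
  have key : ∀ y : Fin 4 → ℍ[O,M.c₁,M.c₂,M.c₃],
      (Matrix.of fun i j => q.trd (M.φ (y i) * M.φ (y j))).det =
        algebraMap O k (Matrix.of fun i j => Model.tr (y i * y j)).det := by
    intro y
    rw [RingHom.map_det]
    congr 1
    ext i j
    simp [← map_mul, M.trd_eq]
  constructor
  · intro h
    refine ⟨fun i => M.φ (Model.stdBasis i), fun i => (M.mem_iff _).2 ⟨_, rfl⟩, _, ?_, key _⟩
    rw [Model.det_of_tr_mul, Model.det_coords_stdBasis]
    exact (((isUnit_one.mul M.isUnit_disc).mul h).pow 2).neg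
  · rintro ⟨x, hx, d, hd, h⟩
    choose y hy using fun i => (M.mem_iff (x i)).1 (hx i)
    simp only [← hy] at h
    rw [key] at h
    have := IsFractionRing.injective O k h
    rw [Model.det_of_tr_mul] at this
    rw [← this, IsUnit.neg_iff, isUnit_pow_iff two_ne_zero] at hd
    exact (IsUnit.mul_iff.1 hd).2

/-- `g` generates an étale quadratic subring. -/
def IsEtaleElt (O : Type*) [CommRing O] [Algebra O k] (q : QuatStr k A) (g : A) : Prop :=
  ∃ t n : O, q.trd g = algebraMap O k t ∧ q.nrd g = algebraMap O k n ∧ IsUnit (t ^ 2 - 4 * n)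

/-- Suppose all discriminants `t² - 4n` lie in the maximal ideal. If `2` does too, all traces vanish
in the residue field and so does the Gram matrix. Otherwise, polarising the discriminant gives `2
trd(xy) ≡ trd(x) trd(y)`, so the Gram matrix has rank at most one, impossible for a unit determinant
of size at least two. -/
theorem exists_etale_of_gram [IsLocalRing O] {ι : Type*} [Fintype ι] [DecidableEq ι] [Nontrivial ι]
    {q : QuatStr k A} {S : Subalgebra O A} (hS : IntegralOn q S) (hG : HasUnitGram ι q S) :
    ∃ g ∈ S, IsEtaleElt O q g := by
  obtain ⟨x, hx, d, hd, hdet⟩ := hG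
  have inj := IsFractionRing.injective O k
  by_contra hno
  have hΔ : ∀ g ∈ S, ∀ t n : O, q.trd g = algebraMap O k t → q.nrd g = algebraMap O k n →
      t ^ 2 - 4 * n ∈ maximalIdeal O := fun g hg t n ht hn => by
    by_contra h
    exact hno ⟨g, hg, t, n, ht, hn, by simpa using h⟩
  choose! t n ht hn using hS
  have hdet' : (Matrix.of fun i j => t (x i * x j)).det = d := by
    refine inj ?_
    rw [← hdet, RingHom.map_det]
    congr 1
    ext i j
    simp [← ht _ (mul_mem (hx i) (hx j))]
  have hres : (Matrix.of fun i j => residue O (t (x i * x j))).det ≠ 0 := by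
    have : (Matrix.of fun i j => residue O (t (x i * x j))).det = residue O d := by
      rw [← hdet', RingHom.map_det]; rfl
    rw [this, Ne, residue_eq_zero_iff]
    simpa using hd
  by_cases h2 : (2 : O) ∈ maximalIdeal O
  · have ht0 : ∀ g ∈ S, residue O (t g) = 0 := fun g hg => by
      rw [residue_eq_zero_iff]
      have h := hΔ g hg _ _ (ht g hg) (hn g hg)
      have h' : t g ^ 2 ∈ maximalIdeal O := by
        have : t g ^ 2 = (t g ^ 2 - 4 * n g) + (2 * n g) * 2 := by ring
        rw [this]
        exact add_mem h (Ideal.mul_mem_left _ _ h2)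
      exact (Ideal.IsPrime.pow_mem_iff_mem inferInstance 2 two_pos).1 h'
    apply hres
    have : (Matrix.of fun i j => residue O (t (x i * x j))) = 0 := by
      ext i j
      exact ht0 _ (mul_mem (hx i) (hx j))
    rw [this, Matrix.det_zero]
  · have h2' : residue O 2 ≠ 0 := by rwa [Ne, residue_eq_zero_iff]
    have hT : ∀ i j, 2 * residue O (t (x i * x j)) = residue O (t (x i)) * residue O (t (x j)) := by
      intro i j
      have h1 := hΔ _ (hx i) _ _ (ht _ (hx i)) (hn _ (hx i))
      have h3 := hΔ _ (hx j) _ _ (ht _ (hx j)) (hn _ (hx j))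
      have hij : q.trd (x i * q.conj (x j)) =
          algebraMap O k (t (x i) * t (x j) - t (x i * x j)) := by
        rw [QuatStr.conj, mul_sub, map_sub, ← Algebra.commutes, ← Algebra.smul_def, map_smul,
          ht _ (hx i), ht _ (hx j), ht _ (mul_mem (hx i) (hx j)), map_sub, map_mul, smul_eq_mul,
          mul_comm]
      have h4 := hΔ _ (add_mem (hx i) (hx j)) (t (x i) + t (x j))
        (n (x i) + n (x j) + (t (x i) * t (x j) - t (x i * x j)))
        (by rw [map_add, map_add, ht _ (hx i), ht _ (hx j)])
        (by rw [q.nrd_add, hij, hn _ (hx i), hn _ (hx j), map_add, map_add])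
      rw [← residue_eq_zero_iff] at h1 h3 h4
      refine mul_left_cancel₀ h2' ?_
      simp only [map_sub, map_add, map_mul, map_pow, map_ofNat] at h1 h3 h4 ⊢
      linear_combination h4 - h1 - h3
    have h5 : ((2 : ResidueField O) • Matrix.of fun i j => residue O (t (x i * x j))).det = 0 := by
      have : ((2 : ResidueField O) • Matrix.of fun i j => residue O (t (x i * x j))) =
          Matrix.vecMulVec (fun i => residue O (t (x i))) (fun i => residue O (t (x i))) := by
        ext i j
        simpa [Matrix.vecMulVec_apply] using hT i j
      rw [this, Matrix.det_vecMulVec]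
    rw [Matrix.det_smul] at h5
    refine hres ((mul_eq_zero.1 h5).resolve_left (pow_ne_zero _ ?_))
    rwa [map_ofNat] at h2'

/-- Without étale elements, all elements of a reduced quotient of `R` are scalars. -/
theorem exists_eq_algebraMap [IsLocalRing O] [Finite (ResidueField O)] {q : QuatStr k A}
    {R : Subalgebra O A} (hR : IntegralOn q R) (hno : ¬ ∃ g ∈ R, IsEtaleElt O q g)
    {E : Type*} [Ring E] [IsReduced E] [Algebra O E] (f : R →ₐ[O] E)
    (hm : ∀ a ∈ maximalIdeal O, algebraMap O E a = 0) (x : R) :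
    ∃ α : O, f x = algebraMap O E α := by
  obtain ⟨t, n, ht, hn⟩ := hR x x.2
  have hΔ : residue O t ^ 2 - 4 * residue O n = 0 := by
    rw [← map_ofNat (residue O) 4, ← map_pow, ← map_mul, ← map_sub, residue_eq_zero_iff]
    by_contra h
    exact hno ⟨x, x.2, t, n, ht, hn, by simpa using h⟩
  obtain ⟨r, hr1, hr2⟩ := Model.exists_double_root hΔ
  obtain ⟨α, rfl⟩ := residue_surjective r
  refine ⟨α, ?_⟩
  rw [← sub_eq_zero]
  have e1 : algebraMap O E (t - 2 * α) = 0 := hm _ (by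
    rw [← residue_eq_zero_iff, map_sub, map_mul, map_ofNat, hr1, sub_self])
  have e2 : algebraMap O E (α ^ 2 - n) = 0 := hm _ (by
    rw [← residue_eq_zero_iff]
    simp only [map_sub, map_pow]
    linear_combination -hr2 + residue O α * hr1)
  have hx : x * x = algebraMap O R t * x - algebraMap O R n := by
    apply Subtype.ext
    have := q.mul_self (x : A)
    rw [ht, hn, ← IsScalarTower.algebraMap_apply, ← IsScalarTower.algebraMap_apply] at this
    exact this
  -- Here `α` lifts the double root of the polynomial of `x`. Both coefficients on the right lie in
  -- the maximal ideal, so `f x - α` squares to zero in a reduced ring.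
  have hsq : (x - algebraMap O R α) * (x - algebraMap O R α) =
      algebraMap O R (t - 2 * α) * x + algebraMap O R (α ^ 2 - n) := by
    rw [sub_mul, mul_sub, mul_sub, hx, ← Algebra.commutes α x]
    simp only [map_sub, map_mul, map_add, sub_mul, two_mul, add_mul, pow_two]
    abel
  have h0 : (f x - algebraMap O E α) * (f x - algebraMap O E α) = 0 := by
    have := congrArg f hsq
    rw [map_mul, map_add, map_mul, AlgHom.commutes, AlgHom.commutes, e1, e2, zero_mul, add_zero,
      map_sub, AlgHom.commutes] at this
    exact this
  exact pow_eq_zero_iff two_ne_zero |>.1 ((pow_two _).trans h0)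

/-- Without étale elements the quotient by the radical would consist of images of `O`. This
contradicts the idempotent `(1, 0)` in the split case and the cardinality `|κ|²` in the field case.
-/
theorem exists_etale_of_eichler [IsDiscreteValuationRing O] [Finite (ResidueField O)]
    {q : QuatStr k A} {R : Subalgebra O A} (hR : IntegralOn q R)
    (hE : Nonempty ((R ⧸ Ring.jacobson R) ≃ₐ[O] (ResidueField O × ResidueField O)) ∨
      (IsField (R ⧸ Ring.jacobson R) ∧
        Nat.card (R ⧸ Ring.jacobson R) = Nat.card (ResidueField O) ^ 2)) :
    ∃ g ∈ R, IsEtaleElt O q g := by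
  by_contra hno
  rcases hE with ⟨⟨e⟩⟩ | ⟨hf, hcard⟩
  · obtain ⟨y, hy⟩ := e.surjective (1, 0)
    obtain ⟨x, rfl⟩ := Ideal.Quotient.mk_surjective y
    obtain ⟨α, hα⟩ := exists_eq_algebraMap hR hno
      ((e : _ →ₐ[O] (ResidueField O × ResidueField O)).comp
        (Ideal.Quotient.mkₐ O (Ring.jacobson R)))
      (fun a ha => Prod.ext ((residue_eq_zero_iff a).2 ha) ((residue_eq_zero_iff a).2 ha)) x
    have h : ((1, 0) : ResidueField O × ResidueField O) = algebraMap O _ α := hy.symm.trans hα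
    have h1 := congrArg Prod.fst h
    have h2 := congrArg Prod.snd h
    exact one_ne_zero (α := ResidueField O) (h1.trans h2.symm)
  · letI := hf.toField
    have hq : 1 < Nat.card (ResidueField O) := Finite.one_lt_card
    have hfin : Finite (R ⧸ Ring.jacobson R) := by
      refine Nat.finite_of_card_ne_zero ?_
      rw [hcard]; positivity
    let f : O →+* (R ⧸ Ring.jacobson R) := algebraMap O _
    have hm : ∀ a ∈ maximalIdeal O, f a = 0 := by
      -- A trivial kernel would make `O` a finite domain, hence a field.
      have hker : RingHom.ker f ≠ ⊥ := by
        intro h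
        have := Finite.of_injective f ((RingHom.injective_iff_ker_eq_bot f).2 h)
        exact IsDiscreteValuationRing.not_isField O (Finite.isField_of_domain O)
      have := (IsLocalRing.eq_maximalIdeal
        ((RingHom.ker_isPrime f).isMaximal hker))
      intro a ha
      rwa [← this] at ha
    have hsurj : Function.Surjective
        (Ideal.Quotient.lift (maximalIdeal O) f hm) := by
      intro y
      obtain ⟨x, rfl⟩ := Ideal.Quotient.mk_surjective y
      obtain ⟨α, hα⟩ := exists_eq_algebraMap hR hno (Ideal.Quotient.mkₐ O (Ring.jacobson R)) hm x
      exact ⟨Ideal.Quotient.mk _ α, hα.symm⟩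
    have : Finite (O ⧸ maximalIdeal O) := inferInstanceAs (Finite (ResidueField O))
    have := Nat.card_le_card_of_surjective _ hsurj
    rw [hcard] at this
    change _ ≤ Nat.card (ResidueField O) at this
    nlinarith

end Etale

/-! ## The reduced trace and norm of a totally definite quaternion algebra -/

section Definite

variable {F : Type*} [Field F] [NumberField F] {B : Type*} [Ring B] [Algebra F B]

theorem trace_mulLeft_quaternion (q : ℍ[ℝ]) :
    LinearMap.trace ℝ ℍ[ℝ] (LinearMap.mulLeft ℝ q) = 4 * q.re := by
  let b : Module.Basis (Fin 4) ℝ ℍ[ℝ] := QuaternionAlgebra.basisOneIJK (-1 : ℝ) 0 (-1)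
  refine (LinearMap.trace_eq_matrix_trace ℝ b _).trans ?_
  have hrepr : ∀ (x : ℍ[ℝ]) i, b.repr x i = ![x.re, x.imI, x.imJ, x.imK] i := fun x i => rfl
  have hb : ∀ i, b i = (![⟨1, 0, 0, 0⟩, ⟨0, 1, 0, 0⟩, ⟨0, 0, 1, 0⟩, ⟨0, 0, 0, 1⟩] :
      Fin 4 → ℍ[ℝ]) i := by
    intro i
    refine b.repr.injective (Finsupp.ext fun j => ?_)
    rw [b.repr_self, hrepr, Finsupp.single_apply]
    fin_cases i <;> fin_cases j <;> simp
  have hM : ∀ i, LinearMap.toMatrix b b (LinearMap.mulLeft ℝ q) i i = q.re := by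
    intro i
    rw [LinearMap.toMatrix_apply b b, hrepr, LinearMap.mulLeft_apply, hb]
    fin_cases i
    · exact (Quaternion.re_mul _ _).trans (by simp)
    · exact (Quaternion.imI_mul _ _).trans (by simp)
    · exact (Quaternion.imJ_mul _ _).trans (by simp)
    · exact (Quaternion.imK_mul _ _).trans (by simp)
  rw [Matrix.trace, Fin.sum_univ_four]
  simp only [Matrix.diag_apply, hM]
  ring

theorem HamiltonIdent.emb_injective [IsSimpleRing B] (θ : HamiltonIdent F B) (τ : F →+* ℝ) :
    Function.Injective (θ.emb τ) := (θ.emb τ).injective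

/-- The trace of left multiplication is compatible with base change and with isomorphisms, and on
`ℍ` it is four times the real part. -/
theorem HamiltonIdent.reducedTrace_eq [FiniteDimensional F B] (θ : HamiltonIdent F B)
    (τ : F →+* ℝ) (b : B) : τ (reducedTrace b) = 2 * (θ.emb τ b).re := by
  letI : Algebra F ℝ := τ.toAlgebra
  have h1 : (LinearMap.mulLeft ℝ (θ.emb τ b)) =
      (θ τ).toLinearEquiv.conj (LinearMap.baseChange ℝ (LinearMap.mulLeft F b)) := by
    refine LinearMap.ext fun q => ?_
    obtain ⟨y, rfl⟩ := (θ τ).surjective q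
    rw [LinearEquiv.conj_apply_apply]
    have e : (θ τ).toLinearEquiv.symm (θ τ y) = y := (θ τ).symm_apply_apply y
    rw [e]
    change θ τ ((1 : ℝ) ⊗ₜ[F] b) * θ τ y = θ τ _
    rw [← map_mul]
    congr 1
    clear e
    induction y with
    | zero => simp
    | add y z hy hz => rw [mul_add, map_add, hy, hz]
    | tmul l c => simp
  have h2 := trace_mulLeft_quaternion (θ.emb τ b)
  rw [h1, LinearMap.trace_conj', LinearMap.trace_baseChange] at h2
  change τ _ = _ at h2
  rw [reducedTrace, map_div₀, h2, map_ofNat]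
  ring

theorem HamiltonIdent.emb_conj [FiniteDimensional F B] (θ : HamiltonIdent F B)
    (τ : F →+* ℝ) (b : B) :
    θ.emb τ (algebraMap F B (reducedTrace b) - b) = star (θ.emb τ b) := by
  rw [map_sub, θ.emb_algebraMap, θ.reducedTrace_eq]
  ext <;> simp
  ring

variable (F B) in
/-- The reduced trace as a linear map. -/
def reducedTraceLin : B →ₗ[F] F :=
  (2⁻¹ : F) • (LinearMap.trace F B ∘ₗ LinearMap.mul F B)

theorem reducedTraceLin_apply (b : B) : reducedTraceLin F B b = reducedTrace b := by
  change 2⁻¹ * LinearMap.trace F B (LinearMap.mulLeft F b) = _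
  rw [reducedTrace, div_eq_inv_mul]

/-- One real place suffices, since `B` is simple and embeds in `ℍ`. There `b b̄` is a real number,
so it is central in `B` and lies in `F`. Anisotropy of the norm on `ℍ` gives the nondegeneracy, by
testing `x` against its conjugate. -/
theorem exists_quatStr [IsTotallyReal F] [IsSimpleRing B] [Algebra.IsCentral F B]
    (hB : Module.finrank F B = 4) (θ : HamiltonIdent F B) :
    ∃ q : QuatStr F B, (∀ b, q.trd b = reducedTrace b) ∧ ∀ b, b ≠ 0 → q.nrd b ≠ 0 := by
  have : FiniteDimensional F B := Module.finite_of_finrank_pos (by rw [hB]; norm_num)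
  obtain ⟨φ⟩ : Nonempty (F →+* ℂ) := inferInstance
  let τ : F →+* ℝ := (IsTotallyReal.complexEmbedding_isReal φ).embedding
  have inj := θ.emb_injective τ
  have hc := θ.emb_conj τ
  have hnrd : ∀ b : B, ∃ n : F, b * (algebraMap F B (reducedTrace b) - b) = algebraMap F B n := by
    intro b
    have : b * (algebraMap F B (reducedTrace b) - b) ∈ Subalgebra.center F B := by
      rw [Subalgebra.mem_center_iff]
      intro y
      apply inj
      rw [map_mul, map_mul _ _ y, map_mul _ b, hc, Quaternion.self_mul_star]
      exact (Quaternion.coe_commutes (Quaternion.normSq (θ.emb τ b)) (θ.emb τ y)).symm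
    obtain ⟨n, hn⟩ := Algebra.IsCentral.out this
    exact ⟨n, hn.symm⟩
  choose n hn using hnrd
  have hn0 : ∀ b, b ≠ 0 → n b ≠ 0 := by
    intro b hb h0
    have h := congrArg (θ.emb τ) (hn b)
    rw [h0, map_zero, map_zero, map_mul, hc, Quaternion.self_mul_star] at h
    have h' : Quaternion.normSq (θ.emb τ b) = 0 :=
      Quaternion.coe_injective h
    rw [Quaternion.normSq_eq_zero] at h'
    exact hb (inj (h'.trans (map_zero _).symm))
  refine ⟨⟨reducedTraceLin F B, n, ?_, ?_, ?_, ?_, hB⟩, reducedTraceLin_apply, hn0⟩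
  · rw [reducedTraceLin_apply, reducedTrace, LinearMap.mulLeft_one, LinearMap.trace_id, hB]
    norm_num
  · intro x
    rw [reducedTraceLin_apply, hn]
  · intro x y
    simp only [reducedTraceLin_apply]
    apply inj
    rw [hc, map_mul, map_mul, hc, hc, star_mul]
  · intro x hx
    by_contra hx0
    have h := hx (algebraMap F B (reducedTrace x) - x)
    rw [hn, Algebra.algebraMap_eq_smul_one, map_smul, smul_eq_mul, reducedTraceLin_apply,
      reducedTrace, LinearMap.mulLeft_one, LinearMap.trace_id, hB] at h
    exact hn0 x hx0 ((mul_eq_zero.1 h).resolve_right (by norm_num))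

end Definite

/-! ### Base change -/

namespace QuatStr

open TensorProduct

variable {F : Type*} [Field F] {B : Type*} [Ring B] [Algebra F B] (q : QuatStr F B)
  (L : Type*) [Field L] [Algebra F L]

/-- The base change of the reduced trace. -/
def trdBC : L ⊗[F] B →ₗ[L] L :=
  (AlgebraTensorModule.rid F L L).toLinearMap ∘ₗ q.trd.baseChange L

theorem trdBC_tmul (l : L) (b : B) : q.trdBC L (l ⊗ₜ b) = l * algebraMap F L (q.trd b) := by
  simp [trdBC, Algebra.smul_def, mul_comm]

/-- The base change of the standard involution. -/
def conjBC (x : L ⊗[F] B) : L ⊗[F] B := algebraMap L _ (q.trdBC L x) - x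

theorem conjBC_tmul (l : L) (b : B) : q.conjBC L (l ⊗ₜ b) = l ⊗ₜ q.conj b := by
  rw [conjBC, trdBC_tmul, conj, tmul_sub, Algebra.TensorProduct.algebraMap_apply]
  congr 1
  rw [Algebra.algebraMap_self, RingHom.id_apply, Algebra.algebraMap_eq_smul_one (A := B),
    ← smul_tmul, Algebra.smul_def, mul_comm]

theorem conjBC_add (x y : L ⊗[F] B) : q.conjBC L (x + y) = q.conjBC L x + q.conjBC L y := by
  simp only [conjBC, map_add]; abel

theorem conjBC_zero : q.conjBC L 0 = 0 := by
  simp only [conjBC, map_zero, sub_zero]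

theorem conjBC_mul (x y : L ⊗[F] B) : q.conjBC L (x * y) = q.conjBC L y * q.conjBC L x := by
  induction x with
  | zero => rw [zero_mul, conjBC_zero, mul_zero]
  | add x z hx hz => rw [add_mul, conjBC_add, hx, hz, conjBC_add, mul_add]
  | tmul l b =>
    induction y with
    | zero => rw [mul_zero, conjBC_zero, zero_mul]
    | add x z hx hz => rw [mul_add, conjBC_add, hx, hz, conjBC_add, add_mul]
    | tmul m c =>
      rw [Algebra.TensorProduct.tmul_mul_tmul, conjBC_tmul, conjBC_tmul, conjBC_tmul,
        Algebra.TensorProduct.tmul_mul_tmul, conj_mul', mul_comm]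

theorem trdBC_conjBC (x : L ⊗[F] B) : q.trdBC L (q.conjBC L x) = q.trdBC L x := by
  induction x with
  | zero => rw [conjBC_zero]
  | add x z hx hz => rw [conjBC_add, map_add, hx, hz, map_add]
  | tmul l b => rw [conjBC_tmul, trdBC_tmul, trdBC_tmul, trd_conj]

theorem conjBC_conjBC (x : L ⊗[F] B) : q.conjBC L (q.conjBC L x) = x := by
  rw [conjBC, trdBC_conjBC, conjBC, sub_sub_cancel]

/-- The norm is not linear, so it is extended by induction on sums of pure tensors; the cross terms
form the trace of `x ȳ`. -/
theorem exists_mul_conjBC (x : L ⊗[F] B) : ∃ n : L, x * q.conjBC L x = algebraMap L _ n := by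
  induction x with
  | zero => exact ⟨0, by rw [zero_mul, map_zero]⟩
  | add x y hx hy =>
    obtain ⟨a, ha⟩ := hx
    obtain ⟨b, hb⟩ := hy
    refine ⟨a + b + q.trdBC L (x * q.conjBC L y), ?_⟩
    have h : x * q.conjBC L y + y * q.conjBC L x =
        algebraMap L _ (q.trdBC L (x * q.conjBC L y)) := by
      have : y * q.conjBC L x = q.conjBC L (x * q.conjBC L y) := by
        rw [conjBC_mul, conjBC_conjBC]
      rw [this]; exact add_sub_cancel _ _
    rw [map_add, map_add, ← ha, ← hb, ← h, conjBC_add, add_mul, mul_add, mul_add]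
    abel
  | tmul l b =>
    refine ⟨l ^ 2 * algebraMap F L (q.nrd b), ?_⟩
    rw [conjBC_tmul, Algebra.TensorProduct.tmul_mul_tmul, mul_conj',
      Algebra.algebraMap_eq_smul_one (A := B), ← smul_tmul, Algebra.smul_def,
      Algebra.TensorProduct.algebraMap_apply, Algebra.algebraMap_self, RingHom.id_apply, mul_comm,
      pow_two]

/-- Nondegeneracy over `F` is the nonvanishing of the Gram determinant of a basis, which persists
over `L`. -/
theorem nondegBC (x : L ⊗[F] B) (hx : ∀ y, q.trdBC L (x * y) = 0) : x = 0 := by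
  have : FiniteDimensional F B :=
    Module.finite_of_finrank_pos (by rw [q.finrank_eq]; norm_num)
  let b := Module.finBasis F B
  let G : Matrix _ _ F := Matrix.of fun i j => q.trd (b i * b j)
  have hG : G.det ≠ 0 := by
    intro h
    obtain ⟨c, hc0, hc⟩ := Matrix.exists_vecMul_eq_zero_iff.2 h
    have h0 : ∑ i, c i • b i = 0 := by
      refine q.nondeg _ fun y => ?_
      have hlin : (q.trd ∘ₗ LinearMap.mulLeft F (∑ i, c i • b i)) = 0 := by
        refine b.ext fun j => ?_
        have := congrFun hc j
        simpa [G, Matrix.vecMul, dotProduct, Finset.sum_mul] using this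
      exact LinearMap.congr_fun hlin y
    exact hc0 (funext fun i => Fintype.linearIndependent_iff.1 b.linearIndependent c h0 i)
  have hG' : (G.map (algebraMap F L)).det ≠ 0 := by
    have := RingHom.map_det (algebraMap F L) G
    change _ = (G.map (algebraMap F L)).det at this
    rw [← this]
    simpa using hG
  let b' := Algebra.TensorProduct.basis L b
  have hx0 : (fun i => b'.repr x i) = 0 := by
    refine Matrix.eq_zero_of_vecMul_eq_zero hG' ?_
    funext j
    have := hx (1 ⊗ₜ b j)
    rw [← b'.sum_repr x] at this
    simpa [b', G, Matrix.vecMul, dotProduct, Finset.sum_mul, trdBC_tmul] using this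
  rw [← b'.sum_repr x]
  refine Finset.sum_eq_zero fun i _ => ?_
  have := congrFun hx0 i
  simp only [Pi.zero_apply] at this
  rw [this, zero_smul]

/-- The base change of the reduced trace and norm. -/
def baseChange : QuatStr L (L ⊗[F] B) where
  trd := q.trdBC L
  nrd x := (q.exists_mul_conjBC L x).choose
  trd_one := by
    rw [Algebra.TensorProduct.one_def, trdBC_tmul, q.trd_one, one_mul, map_ofNat]
  mul_conj x := (q.exists_mul_conjBC L x).choose_spec
  conj_mul := q.conjBC_mul L
  nondeg := q.nondegBC L
  finrank_eq := by rw [Module.finrank_baseChange, q.finrank_eq]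

theorem baseChange_trd_one_tmul (b : B) :
    (q.baseChange L).trd (1 ⊗ₜ b) = algebraMap F L (q.trd b) := by
  rw [← one_mul (algebraMap F L _)]; exact q.trdBC_tmul L 1 b

theorem baseChange_nrd_one_tmul (b : B) :
    (q.baseChange L).nrd (1 ⊗ₜ b) = algebraMap F L (q.nrd b) := by
  refine (q.baseChange L).algebraMap_injective ?_
  rw [← mul_conj']
  change 1 ⊗ₜ b * q.conjBC L (1 ⊗ₜ b) = _
  rw [conjBC_tmul, Algebra.TensorProduct.tmul_mul_tmul, mul_conj',
    Algebra.algebraMap_eq_smul_one (A := B), ← smul_tmul, Algebra.smul_def,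
    Algebra.TensorProduct.algebraMap_apply, Algebra.algebraMap_self, RingHom.id_apply, mul_one,
    mul_one]

end QuatStr

/-! ## Completions of the base field -/

section Completion

open IsLocalRing

variable {F : Type*} [Field F] [NumberField F] (v : HeightOneSpectrum (𝓞 F))

theorem valued_algebraMap (x : F) :
    Valued.v (algebraMap F (v.adicCompletion F) x) = v.valuation F x :=
  HeightOneSpectrum.valuedAdicCompletion_eq_valuation' v x

theorem mem_maximalIdeal_iff (x : v.adicCompletionIntegers F) :
    x ∈ maximalIdeal (v.adicCompletionIntegers F) ↔ Valued.v (x : v.adicCompletion F) < 1 := by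
  rw [mem_maximalIdeal, mem_nonunits_iff,
    HeightOneSpectrum.adicCompletionIntegers.isUnit_iff_valued_eq_one]
  exact ⟨fun h => lt_of_le_of_ne x.2 h, fun h => h.ne⟩

theorem algebraMap_mem_maximalIdeal_iff (a : 𝓞 F) :
    algebraMap (𝓞 F) (v.adicCompletionIntegers F) a ∈
      maximalIdeal (v.adicCompletionIntegers F) ↔ a ∈ v.asIdeal := by
  rw [mem_maximalIdeal_iff]
  exact (iff_of_eq (congrArg (· < 1) (valued_algebraMap v (a : F)))).trans
    (v.valuation_lt_one_iff_mem a)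

theorem isUnit_algebraMap_iff (a : 𝓞 F) :
    IsUnit (algebraMap (𝓞 F) (v.adicCompletionIntegers F) a) ↔ a ∉ v.asIdeal := by
  rw [← algebraMap_mem_maximalIdeal_iff, mem_maximalIdeal, mem_nonunits_iff, not_not]

theorem exists_valued_sub_lt (x : v.adicCompletion F) {s : v.adicCompletion F} (hs : s ≠ 0) :
    ∃ f : F, Valued.v (algebraMap F (v.adicCompletion F) f - x) < Valued.v s := by
  have hopen : IsOpen {y : v.adicCompletion F | Valued.v (y - x) < Valued.v s} :=
by
    have := (Valued.isOpen_ball _ (Valued.v.restrict s)).preimage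
      (continuous_id.sub (continuous_const (y := x)))
    simp only [Set.preimage_ofPred_eq, Valuation.restrict_lt_iff] at this
    exact this
  obtain ⟨f, hf⟩ := (HeightOneSpectrum.denseRange_algebraMap F v).exists_mem_open hopen
    ⟨x, by simpa [zero_lt_iff] using hs⟩
  exact ⟨f, hf⟩

/-- Approximate first by an element of `F`, which is then integral at `v`, and next by an element of
`𝓞 F`. -/
theorem exists_sub_mem_maximalIdeal (x : v.adicCompletionIntegers F) :
    ∃ a : 𝓞 F, x - algebraMap (𝓞 F) _ a ∈ maximalIdeal (v.adicCompletionIntegers F) := by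
  obtain ⟨f, hf⟩ := exists_valued_sub_lt v (x : v.adicCompletion F) one_ne_zero
  rw [map_one] at hf
  have hf1 : v.valuation F f ≤ 1 := by
    rw [← valued_algebraMap, ← sub_add_cancel (algebraMap F (v.adicCompletion F) f) x]
    exact (Valuation.map_add _ _ _).trans (max_le hf.le x.2)
  obtain ⟨a, ha⟩ := v.exists_valuation_sub_lt_of_integer hf1 1
  refine ⟨a, ?_⟩
  rw [mem_maximalIdeal_iff]
  have : ((x - algebraMap (𝓞 F) _ a : v.adicCompletionIntegers F) : v.adicCompletion F) =
      -(algebraMap F (v.adicCompletion F) f - x) -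
        algebraMap F (v.adicCompletion F) (algebraMap (𝓞 F) F a - f) := by
    rw [map_sub]
    change (x : v.adicCompletion F) - algebraMap F (v.adicCompletion F) (a : F) = _
    ring
  rw [this]
  refine (Valuation.map_sub _ _ _).trans_lt (max_lt ?_ ?_)
  · rwa [Valuation.map_neg]
  · rw [valued_algebraMap]; exact ha

instance : Finite (ResidueField (v.adicCompletionIntegers F)) := by
  have : Finite (𝓞 F ⧸ v.asIdeal) := Ideal.finiteQuotientOfFreeOfNeBot _ v.ne_bot
  refine Finite.of_surjective (Ideal.Quotient.lift v.asIdeal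
    ((residue (v.adicCompletionIntegers F)).comp (algebraMap (𝓞 F) _)) fun a ha => ?_) ?_
  · exact (residue_eq_zero_iff _).2 ((algebraMap_mem_maximalIdeal_iff v a).2 ha)
  · intro y
    obtain ⟨x, rfl⟩ := residue_surjective y
    obtain ⟨a, ha⟩ := exists_sub_mem_maximalIdeal v x
    refine ⟨Ideal.Quotient.mk _ a, ?_⟩
    rw [Ideal.Quotient.lift_mk]
    refine (sub_eq_zero.1 ?_).symm
    rw [RingHom.comp_apply, ← map_sub, residue_eq_zero_iff]
    exact ha

end Completion

/-! ## Integrality -/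

section Integrality

open Polynomial

variable {F : Type*} [Field F] [NumberField F] {B : Type*} [Ring B] [Algebra F B]

/-- For nonscalar `r` the polynomial `X² - trd(r) X + nrd(r)` divides every polynomial over `F`
killing `r`, in particular a monic one with coefficients in `𝓞 F`. Over an integrally closed ring,
monic factors of monic polynomials are integral. -/
theorem integralOn_of_finite (q : QuatStr F B) (R : Subalgebra (𝓞 F) B) [IsOrder R] :
    IntegralOn q R := by
  intro r hr
  have hint : IsIntegral (𝓞 F) r :=
    IsIntegral.of_mem_of_fg R (Module.Finite.iff_fg.1 (IsOrder.finite (R := R))) r hr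
  by_cases hsc : ∃ c : F, r = algebraMap F B c
  · obtain ⟨c, rfl⟩ := hsc
    have : IsIntegral (𝓞 F) c := (isIntegral_algebraMap_iff q.algebraMap_injective).1 hint
    obtain ⟨a, rfl⟩ := IsIntegrallyClosed.isIntegral_iff.1 this
    exact ⟨a * 2, a ^ 2, by rw [q.trd_algebraMap, map_mul, map_ofNat],
      by rw [q.nrd_algebraMap, map_pow]⟩
  obtain ⟨p, hp, hpr⟩ := hint
  let f : F[X] := X ^ 2 + (C (-q.trd r) * X + C (q.nrd r))
  have hdeg : (C (-q.trd r) * X + C (q.nrd r)).degree < 2 :=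
    degree_linear_le.trans_lt (by norm_num)
  have hf : f.Monic := monic_X_pow_add hdeg
  have hfdeg : f.natDegree = 2 := by
    rw [natDegree_add_eq_left_of_degree_lt (by rwa [degree_X_pow]), natDegree_X_pow]
  have hfr : aeval r f = 0 := by
    simp only [f, map_add, map_mul, map_neg, aeval_X, map_pow, aeval_C, pow_two, q.mul_self r]
    rw [neg_mul]; abel
  have hdvd : f ∣ p.map (algebraMap (𝓞 F) F) := by
    rw [← modByMonic_eq_zero_iff_dvd hf]
    -- The remainder has degree at most one and kills `r`, which is not a scalar, so it vanishes.
    set g := p.map (algebraMap (𝓞 F) F) %ₘ f with hg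
    have hgr : aeval r g = 0 := by
      have h := congrArg (aeval r) (modByMonic_add_div (p.map (algebraMap (𝓞 F) F)) f)
      rw [map_add, map_mul, hfr, zero_mul, add_zero, aeval_map_algebraMap] at h
      exact h.trans hpr
    have hgd : g.natDegree ≤ 1 := by
      have := natDegree_modByMonic_lt (p.map (algebraMap (𝓞 F) F)) hf (by
        intro h; rw [h, natDegree_one] at hfdeg; exact absurd hfdeg (by norm_num))
      rw [hfdeg] at this
      exact Nat.le_of_lt_succ this
    obtain ⟨a, b, hab⟩ := exists_eq_X_add_C_of_natDegree_le_one hgd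
    rw [hab] at hgr ⊢
    simp only [map_add, map_mul, aeval_C, aeval_X] at hgr
    have ha : a = 0 := by
      by_contra ha
      refine hsc ⟨-(a⁻¹ * b), ?_⟩
      have : algebraMap F B a⁻¹ * (algebraMap F B a * r + algebraMap F B b) = 0 := by
        rw [hgr, mul_zero]
      rw [mul_add, ← mul_assoc, ← map_mul, ← map_mul, inv_mul_cancel₀ ha, map_one, one_mul] at this
      rw [map_neg]
      exact eq_neg_of_add_eq_zero_left this
    rw [ha, map_zero, zero_mul, zero_add] at hgr
    have hb : b = 0 := q.algebraMap_injective (hgr.trans (map_zero _).symm)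
    rw [ha, hb]; simp
  obtain ⟨g, hg⟩ := IsIntegrallyClosed.eq_map_mul_C_of_dvd F hp hdvd
  rw [hf.leadingCoeff, C_1, mul_one] at hg
  have h0 := congrArg (fun P => P.coeff 0) hg
  have h1 := congrArg (fun P => P.coeff 1) hg
  simp only [coeff_map, f, coeff_add, coeff_X_pow, coeff_C_mul, coeff_X, coeff_C] at h0 h1
  refine ⟨-g.coeff 1, g.coeff 0, ?_, ?_⟩
  · rw [map_neg, h1]; simp
  · rw [h0]; simp

variable (v : HeightOneSpectrum (𝓞 F))

theorem mem_localOrder_iff_span (R : Subalgebra (𝓞 F) B) (x : LocalAlg F B v) :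
    x ∈ localOrder R v ↔ x ∈ Submodule.span (v.adicCompletionIntegers F)
      ((fun a : B => (1 : v.adicCompletion F) ⊗ₜ[F] a) '' (R : Set B)) := by
  rw [localOrder, ← Subalgebra.mem_toSubmodule, Algebra.adjoin_eq_span]
  have : ((fun a : B => (1 : v.adicCompletion F) ⊗ₜ[F] a) '' (R : Set B)) =
      (R.toSubmonoid.map (Algebra.TensorProduct.includeRight :
        B →ₐ[F] v.adicCompletion F ⊗[F] B) : Set (LocalAlg F B v)) := rfl
  rw [this, Submonoid.closure_eq]

theorem smul_one_tmul (c : 𝓞 F) (a : B) :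
    (algebraMap (𝓞 F) (v.adicCompletionIntegers F) c) • ((1 : v.adicCompletion F) ⊗ₜ[F] a) =
      (1 : v.adicCompletion F) ⊗ₜ[F] (c • a) := by
  have h1 : c • a = (c : F) • a := (algebraMap_smul F c a).symm
  rw [h1, ← TensorProduct.smul_tmul, Algebra.smul_def (c : F)]
  rfl

/-- The trace is linear, so it suffices to check it on global elements. The norm is not additive,
but its cross term is the trace of `x ȳ`, and the local order is stable under conjugation once
traces are known to be integral. -/
theorem integralOn_localOrder (q : QuatStr F B) (R : Subalgebra (𝓞 F) B) [IsOrder R] :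
    IntegralOn (q.baseChange (v.adicCompletion F)) (localOrder R v) := by
  set qv := q.baseChange (v.adicCompletion F)
  have hint := integralOn_of_finite q R
  have hsm : ∀ (a : v.adicCompletionIntegers F) (x : LocalAlg F B v),
      a • x = algebraMap (v.adicCompletion F) _ (a : v.adicCompletion F) * x := fun a x =>
    Algebra.smul_def (a : v.adicCompletion F) x
  have htr : ∀ x ∈ localOrder R v, ∃ t : v.adicCompletionIntegers F,
      qv.trd x = algebraMap _ (v.adicCompletion F) t := by
    intro x hx
    rw [mem_localOrder_iff_span] at hx
    induction hx using Submodule.span_induction with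
    | mem x hx =>
      obtain ⟨b, hb, rfl⟩ := hx
      obtain ⟨t, n, ht, -⟩ := hint b hb
      exact ⟨algebraMap _ _ t, by rw [q.baseChange_trd_one_tmul, ht]; rfl⟩
    | zero => exact ⟨0, by rw [map_zero, map_zero]⟩
    | add x y _ _ hx hy =>
      obtain ⟨a, ha⟩ := hx
      obtain ⟨b, hb⟩ := hy
      exact ⟨a + b, by rw [map_add, map_add, ha, hb]⟩
    | smul c x _ hx =>
      obtain ⟨a, ha⟩ := hx
      exact ⟨c * a, by rw [hsm, ← Algebra.smul_def, map_smul, ha, map_mul]; rfl⟩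
  have hnr : ∀ x ∈ localOrder R v, ∃ n : v.adicCompletionIntegers F,
      qv.nrd x = algebraMap _ (v.adicCompletion F) n := by
    intro x hx
    rw [mem_localOrder_iff_span] at hx
    induction hx using Submodule.span_induction with
    | mem x hx =>
      obtain ⟨b, hb, rfl⟩ := hx
      obtain ⟨t, n, -, hn⟩ := hint b hb
      exact ⟨algebraMap _ _ n, by rw [q.baseChange_nrd_one_tmul, hn]; rfl⟩
    | zero => exact ⟨0, by rw [← map_zero (algebraMap (v.adicCompletion F) _), qv.nrd_algebraMap,
        map_zero, zero_pow two_ne_zero]⟩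
    | add x y hx' hy' hx hy =>
      rw [← mem_localOrder_iff_span] at hx' hy'
      obtain ⟨a, ha⟩ := hx
      obtain ⟨b, hb⟩ := hy
      have hy'' : qv.conj y ∈ localOrder R v := by
        obtain ⟨t, ht⟩ := htr y hy'
        rw [QuatStr.conj, ht]
        exact sub_mem ((localOrder R v).algebraMap_mem t) hy'
      obtain ⟨c, hc⟩ := htr _ (mul_mem hx' hy'')
      exact ⟨a + b + c, by rw [qv.nrd_add, ha, hb, hc, map_add, map_add]⟩
    | smul c x _ hx =>
      obtain ⟨a, ha⟩ := hx
      exact ⟨c ^ 2 * a, by rw [hsm, qv.nrd_mul, qv.nrd_algebraMap, ha, map_mul, map_pow]; rfl⟩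
  intro x hx
  obtain ⟨t, ht⟩ := htr x hx
  obtain ⟨n, hn⟩ := hnr x hx
  exact ⟨t, n, ht, hn⟩

theorem span_localOrder (R : Subalgebra (𝓞 F) B) [IsOrder R] :
    Submodule.span (v.adicCompletion F) (localOrder R v : Set (LocalAlg F B v)) = ⊤ := by
  rw [eq_top_iff]
  rintro x -
  induction x using TensorProduct.induction_on with
  | zero => exact zero_mem _
  | add x y hx hy => exact add_mem hx hy
  | tmul l b =>
    have hb : b ∈ Submodule.span F (R : Set B) := by rw [IsOrder.span_eq_top]; trivial
    induction hb using Submodule.span_induction with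
    | mem b hb =>
      have : l ⊗ₜ[F] b = l • ((1 : v.adicCompletion F) ⊗ₜ[F] b) := by
        rw [TensorProduct.smul_tmul', smul_eq_mul, mul_one]
      rw [this]
      exact Submodule.smul_mem _ _ (Submodule.subset_span (one_tmul_mem_localOrder hb v))
    | zero => rw [TensorProduct.tmul_zero]; exact zero_mem _
    | add x y _ _ hx hy => rw [TensorProduct.tmul_add]; exact add_mem hx hy
    | smul c x _ hx =>
      have : l ⊗ₜ[F] (c • x) = algebraMap F (v.adicCompletion F) c • (l ⊗ₜ[F] x) := by
        rw [← TensorProduct.smul_tmul, Algebra.smul_def, ← smul_eq_mul, TensorProduct.smul_tmul']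
      rw [this]
      exact Submodule.smul_mem _ _ hx

end Integrality

/-! ## Reduced discriminant and local models -/

section Discriminant

open IsLocalRing

variable {F : Type*} [Field F] [NumberField F] {B : Type*} [Ring B] [Algebra F B]

/-- Modulo the maximal ideal, traces of products only see global elements. -/
theorem exists_trd_mul_congr (q : QuatStr F B) (R : Subalgebra (𝓞 F) B) [IsOrder R]
    (v : HeightOneSpectrum (𝓞 F)) {x : LocalAlg F B v} (hx : x ∈ localOrder R v) :
    ∃ r ∈ R, ∀ z ∈ localOrder R v, ∃ a ∈ maximalIdeal (v.adicCompletionIntegers F),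
      (q.baseChange (v.adicCompletion F)).trd (x * z) =
        (q.baseChange (v.adicCompletion F)).trd ((1 ⊗ₜ r) * z) +
          algebraMap _ (v.adicCompletion F) a := by
  set qv := q.baseChange (v.adicCompletion F)
  have hint := integralOn_localOrder v q R
  rw [mem_localOrder_iff_span] at hx
  induction hx using Submodule.span_induction with
  | mem x hx =>
    obtain ⟨b, hb, rfl⟩ := hx
    exact ⟨b, hb, fun z _ => ⟨0, zero_mem _, by rw [map_zero, add_zero]⟩⟩
  | zero =>
    exact ⟨0, zero_mem _, fun z _ => ⟨0, zero_mem _, by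
      rw [map_zero, add_zero, TensorProduct.tmul_zero]⟩⟩
  | add x y _ _ hx hy =>
    obtain ⟨r, hr, h1⟩ := hx
    obtain ⟨s, hs, h2⟩ := hy
    refine ⟨r + s, add_mem hr hs, fun z hz => ?_⟩
    obtain ⟨a, ha, h1⟩ := h1 z hz
    obtain ⟨b, hb, h2⟩ := h2 z hz
    refine ⟨a + b, add_mem ha hb, ?_⟩
    rw [add_mul, map_add, h1, h2, TensorProduct.tmul_add, add_mul, map_add, map_add]
    ring
  | smul c x _ hx =>
    obtain ⟨r, hr, h1⟩ := hx
    obtain ⟨c0, hc0⟩ := exists_sub_mem_maximalIdeal v c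
    refine ⟨c0 • r, R.smul_mem hr c0, fun z hz => ?_⟩
    obtain ⟨a, ha, h1⟩ := h1 z hz
    obtain ⟨t, n, ht, -⟩ := hint _ (mul_mem (one_tmul_mem_localOrder hr v) hz)
    refine ⟨c * a + (c - algebraMap _ _ c0) * t,
      add_mem (Ideal.mul_mem_left _ _ ha) (Ideal.mul_mem_right _ _ hc0), ?_⟩
    have hsm : ∀ (a : v.adicCompletionIntegers F) (x : LocalAlg F B v),
        qv.trd (a • x) = algebraMap _ (v.adicCompletion F) a * qv.trd x := fun a x =>
      qv.trd.map_smul (a : v.adicCompletion F) x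
    rw [← smul_one_tmul, smul_mul_assoc, smul_mul_assoc, hsm, hsm, h1, ht]
    simp only [map_add, map_mul, map_sub]
    ring

/-- The square of `N` is generated by global Gram determinants, so `v` does not divide `N` exactly
when one of them is a unit at `v`. A local quadruple may be replaced by a global one with the same
Gram matrix modulo the maximal ideal. -/
theorem hasUnitGram_iff (q : QuatStr F B) (hq : ∀ b, q.trd b = reducedTrace b)
    (R : Subalgebra (𝓞 F) B) [IsOrder R] {N : Ideal (𝓞 F)} (hN : IsReducedDiscriminant R N)
    (v : HeightOneSpectrum (𝓞 F)) :
    HasUnitGram (Fin 4) (q.baseChange (v.adicCompletion F)) (localOrder R v) ↔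
      ¬ v.asIdeal ∣ N := by
  set qv := q.baseChange (v.adicCompletion F) with hqv
  have hdvd : v.asIdeal ∣ N ↔ ∀ (d : 𝓞 F) (x : Fin 4 → B), (∀ i, x i ∈ R) →
      (d : F) = Matrix.det (Matrix.of fun i j => (reducedTrace (x i * x j) : F)) →
      d ∈ v.asIdeal := by
    rw [← (v.prime).dvd_pow_iff_dvd two_ne_zero, Ideal.dvd_iff_le, hN, Ideal.span_le]
    exact ⟨fun h d x hx hd => h ⟨x, hx, hd⟩, fun h d ⟨x, hx, hd⟩ => h d x hx hd⟩
  have hmul : ∀ a b : B, ((1 : v.adicCompletion F) ⊗ₜ[F] a) * (1 ⊗ₜ b) = 1 ⊗ₜ (a * b) :=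
    fun a b => by rw [Algebra.TensorProduct.tmul_mul_tmul, one_mul]
  have hdet : ∀ x : Fin 4 → B,
      (Matrix.of fun i j => qv.trd ((1 ⊗ₜ x i) * (1 ⊗ₜ x j))).det =
        algebraMap F (v.adicCompletion F)
          (Matrix.det (Matrix.of fun i j => (reducedTrace (x i * x j) : F))) := by
    intro x
    rw [RingHom.map_det]
    congr 1
    ext i j
    rw [Matrix.of_apply, hmul, hqv, q.baseChange_trd_one_tmul, hq]
    rfl
  constructor
  · rintro ⟨x, hx, d, hd, hdx⟩ hv
    rw [hdvd] at hv
    choose r hr hrx using fun i => exists_trd_mul_congr q R v (hx i)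
    obtain ⟨t, n, ht, hn⟩ : ∃ t n : B → 𝓞 F, (∀ b ∈ R, q.trd b = algebraMap (𝓞 F) F (t b)) ∧
        ∀ b ∈ R, q.nrd b = algebraMap (𝓞 F) F (n b) := by
      have := integralOn_of_finite q R
      choose! t n ht hn using this
      exact ⟨t, n, ht, hn⟩
    let d0 : 𝓞 F := (Matrix.of fun i j => t (r i * r j)).det
    have hd0 : (d0 : F) = Matrix.det (Matrix.of fun i j => (reducedTrace (r i * r j) : F)) := by
      change algebraMap (𝓞 F) F _ = _
      rw [RingHom.map_det]
      congr 1
      ext i j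
      rw [Matrix.of_apply, ← hq, ht _ (mul_mem (hr i) (hr j))]
      rfl
    have hd0v := hv d0 r hr hd0
    rw [← algebraMap_mem_maximalIdeal_iff, ← residue_eq_zero_iff] at hd0v
    -- entries agree modulo the maximal ideal
    have hent : ∀ i j, ∃ a ∈ maximalIdeal (v.adicCompletionIntegers F), qv.trd (x i * x j) =
        algebraMap _ (v.adicCompletion F) (algebraMap (𝓞 F) _ (t (r i * r j)) + a) := by
      intro i j
      -- The two factors are replaced one after the other, with symmetry of the trace form in
      -- between.
      obtain ⟨a, ha, h1⟩ := hrx i (x j) (hx j)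
      obtain ⟨b, hb, h2⟩ := hrx j (1 ⊗ₜ r i) (one_tmul_mem_localOrder (hr i) v)
      refine ⟨a + b, add_mem ha hb, ?_⟩
      rw [h1, qv.trd_mul_comm, h2, qv.trd_mul_comm, hmul, q.baseChange_trd_one_tmul,
        ht _ (mul_mem (hr i) (hr j)), map_add, map_add]
      have : ∀ c : 𝓞 F, algebraMap F (v.adicCompletion F) (algebraMap (𝓞 F) F c) =
        algebraMap (v.adicCompletionIntegers F) _ (algebraMap (𝓞 F) _ c) := fun _ => rfl
      rw [this]; ring
    choose a ha hent using hent
    have : d = (Matrix.of fun i j => algebraMap (𝓞 F) _ (t (r i * r j)) + a i j).det := by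
      refine IsFractionRing.injective (v.adicCompletionIntegers F) (v.adicCompletion F) ?_
      rw [← hdx, RingHom.map_det]
      congr 1
      ext i j
      rw [Matrix.of_apply, hent]
      rfl
    have hres : residue _ d = 0 := by
      rw [this, RingHom.map_det, ← hd0v, RingHom.map_det, RingHom.map_det]
      congr 1
      ext i j
      change residue _ (algebraMap (𝓞 F) _ (t (r i * r j)) + a i j) =
        residue _ (algebraMap (𝓞 F) _ (t (r i * r j)))
      rw [map_add, (residue_eq_zero_iff _).2 (ha i j), add_zero]
    rw [residue_eq_zero_iff] at hres
    exact hres hd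
  · intro h
    rw [hdvd] at h
    push Not at h
    obtain ⟨d, x, hx, hd, hdv⟩ := h
    refine ⟨fun i => 1 ⊗ₜ x i, fun i => one_tmul_mem_localOrder (hx i) v,
      algebraMap (𝓞 F) _ d, (isUnit_algebraMap_iff v d).2 hdv, ?_⟩
    rw [hdet, ← hd]
    rfl

/-- The hypothesis on Eichler invariants gives a model of every local order. -/
theorem exists_localModel (q : QuatStr F B) (hq : ∀ b, q.trd b = reducedTrace b)
    (R : Subalgebra (𝓞 F) B) [IsOrder R] {N : Ideal (𝓞 F)} (hN : IsReducedDiscriminant R N)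
    (v : HeightOneSpectrum (𝓞 F)) (hR : v.asIdeal ∣ N → eichlerInvariant R v ≠ 0) :
    ∃ M : LocalModel (q.baseChange (v.adicCompletion F)) (localOrder R v),
      IsUnit M.c₃ ↔ ¬ v.asIdeal ∣ N := by
  have hint := integralOn_localOrder v q R
  obtain ⟨g, hg, t, n, ht, hn, hu⟩ : ∃ g ∈ localOrder R v,
      IsEtaleElt (v.adicCompletionIntegers F) (q.baseChange (v.adicCompletion F)) g := by
    by_cases hv : v.asIdeal ∣ N
    · refine exists_etale_of_eichler hint ?_
      have := hR hv
      rw [eichlerInvariant] at this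
      split_ifs at this with h1 h2
      · exact Or.inl h1
      · exact Or.inr h2
      · exact absurd rfl this
    · exact exists_etale_of_gram hint ((hasUnitGram_iff q hq R hN v).2 hv)
  obtain ⟨M, -⟩ := exists_model hint (span_localOrder v R) hg ht hn hu
  exact ⟨M, by rw [M.isUnit_c₃_iff, hasUnitGram_iff q hq R hN v]⟩

/-- A basis of `B` scaled into `R` has nonzero Gram determinant because the trace form is
nondegenerate. -/
theorem reducedDiscriminant_ne_bot (q : QuatStr F B) (hq : ∀ b, q.trd b = reducedTrace b)
    (R : Subalgebra (𝓞 F) B) [IsOrder R] {N : Ideal (𝓞 F)} (hN : IsReducedDiscriminant R N) :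
    N ≠ ⊥ := by
  rintro rfl
  have : FiniteDimensional F B :=
    Module.finite_of_finrank_pos (by rw [q.finrank_eq]; norm_num)
  let b : Module.Basis (Fin 4) F B := Module.finBasisOfFinrankEq F B q.finrank_eq
  choose s hs hsb using fun i => exists_smul_mem (O := 𝓞 F) (IsOrder.span_eq_top (R := R)) (b i)
  have hint := integralOn_of_finite q R
  choose! t n ht hn using hint
  have hsb' : ∀ i, s i • b i = (s i : F) • b i := fun i => (algebraMap_smul F (s i) (b i)).symm
  have hd : (((Matrix.of fun i j => t ((s i • b i) * (s j • b j))).det : 𝓞 F) : F) =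
      Matrix.det (Matrix.of fun i j => (reducedTrace ((s i • b i) * (s j • b j)) : F)) := by
    change algebraMap (𝓞 F) F _ = _
    rw [RingHom.map_det]
    congr 1
    ext i j
    rw [Matrix.of_apply, ← hq, ht _ (mul_mem (hsb i) (hsb j))]
    rfl
  have hmem : (Matrix.of fun i j => t ((s i • b i) * (s j • b j))).det ∈
      (⊥ : Ideal (𝓞 F)) ^ 2 := by
    rw [hN]
    exact Ideal.subset_span ⟨fun i => s i • b i, hsb, hd⟩
  have h0 : (Matrix.of fun i j => t ((s i • b i) * (s j • b j))).det = 0 :=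
    Ideal.pow_le_self two_ne_zero hmem
  rw [h0] at hd
  obtain ⟨c, hc0, hc⟩ := Matrix.exists_vecMul_eq_zero_iff.2 (hd.symm.trans (map_zero _))
  have h1 : ∑ i, (c i * s i) • b i = 0 := by
    refine q.nondeg _ fun y => ?_
    have hlin : (q.trd ∘ₗ LinearMap.mulLeft F (∑ i, (c i * s i) • b i)) = 0 := by
      refine b.ext fun j => ?_
      have := congrFun hc j
      simp only [Matrix.vecMul, dotProduct, Matrix.of_apply, ← hq, hsb', smul_mul_smul_comm,
        map_smul, smul_eq_mul, Pi.zero_apply] at this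
      have hsj : (s j : F) ≠ 0 := by simpa using hs j
      refine (mul_eq_zero.1 (?_ : (s j : F) * _ = 0)).resolve_left hsj
      rw [← this]
      simp only [LinearMap.comp_apply, LinearMap.mulLeft_apply, Finset.sum_mul, map_sum,
        smul_mul_assoc, map_smul, smul_eq_mul, Finset.mul_sum]
      exact Finset.sum_congr rfl fun i _ => by ring
    exact LinearMap.congr_fun hlin y
  have h2 := Fintype.linearIndependent_iff.1 b.linearIndependent _ h1
  refine hc0 (funext fun i => (mul_eq_zero.1 (h2 i)).resolve_right ?_)
  simpa using hs i

theorem finite_dvd {N : Ideal (𝓞 F)} (hN : N ≠ ⊥) :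
    {v : HeightOneSpectrum (𝓞 F) | v.asIdeal ∣ N}.Finite :=
  Ideal.finite_factors hN

end Discriminant

/-! ## Local quadratic orders -/

section Quadratic

open IsLocalRing

variable {F : Type*} [Field F] [NumberField F] {K : Type*} [Field K] [Algebra F K]

theorem exists_eq_add_mul [FiniteDimensional F K] {D : F} {δ : K}
    (hδ : δ ^ 2 = -algebraMap F K D) (hK : IntermediateField.adjoin F {δ} = ⊤) (x : K) :
    ∃ a b : F, x = algebraMap F K a + algebraMap F K b * δ := by
  have hx : x ∈ Algebra.adjoin F {δ} := by
    rw [← IntermediateField.adjoin_simple_toSubalgebra_of_isAlgebraic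
      (Algebra.IsAlgebraic.isAlgebraic δ), hK]
    trivial
  induction hx using Algebra.adjoin_induction with
  | mem y hy =>
    rw [Set.mem_singleton_iff.1 hy]
    exact ⟨0, 1, by simp⟩
  | algebraMap r => exact ⟨r, 0, by simp⟩
  | add y z _ _ hy hz =>
    obtain ⟨a, b, rfl⟩ := hy
    obtain ⟨c, d, rfl⟩ := hz
    exact ⟨a + c, b + d, by simp only [map_add]; ring⟩
  | mul y z _ _ hy hz =>
    obtain ⟨a, b, rfl⟩ := hy
    obtain ⟨c, d, rfl⟩ := hz
    refine ⟨a * c - b * d * D, a * d + b * c, ?_⟩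
    simp only [map_add, map_mul, map_sub]
    linear_combination algebraMap F K b * algebraMap F K d * hδ

/-- At a real place `-D` is negative, so it is not a square in `F`. -/
theorem algebraMap_ne_of_sq [IsTotallyReal F] {D : F} (hD : ∀ τ : F →+* ℝ, 0 < τ D) {δ : K}
    (hδ : δ ^ 2 = -algebraMap F K D) (c : F) : algebraMap F K c ≠ δ := by
  rintro rfl
  obtain ⟨φ⟩ : Nonempty (F →+* ℂ) := inferInstance
  let τ : F →+* ℝ := (IsTotallyReal.complexEmbedding_isReal φ).embedding
  rw [← map_pow, ← map_neg] at hδ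
  have := congrArg τ ((algebraMap F K).injective hδ)
  rw [map_pow, map_neg] at this
  nlinarith [hD τ, sq_nonneg (τ c)]

variable {B : Type*} [Ring B] [Algebra F B] {R : Subalgebra (𝓞 F) B}

/-- Two monic quadratic relations for `f δ` are compared; a nonzero trace would make `δ` a scalar.
-/
theorem trd_nrd_of_sq (q : QuatStr F B) (f : K →ₐ[F] B) {D : F} {δ : K}
    (hδ : δ ^ 2 = -algebraMap F K D) (hsc : ∀ c, algebraMap F K c ≠ δ) :
    q.trd (f δ) = 0 ∧ q.nrd (f δ) = D := by
  have : Nontrivial B := Module.nontrivial_of_finrank_pos (R := F) (by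
    rw [q.finrank_eq]; norm_num)
  have hinj : Function.Injective f := f.toRingHom.injective
  have hsq : f δ * f δ = -algebraMap F B D := by
    rw [← map_mul, ← pow_two, hδ, map_neg, AlgHom.commutes]
  have h := q.mul_self (f δ)
  rw [hsq] at h
  have ht : q.trd (f δ) = 0 := by
    by_contra ht
    refine hsc ((q.trd (f δ))⁻¹ * (q.nrd (f δ) - D)) (hinj ?_)
    rw [AlgHom.commutes, map_mul, map_sub]
    have : algebraMap F B (q.nrd (f δ)) - algebraMap F B D = algebraMap F B (q.trd (f δ)) * f δ := by
      rw [sub_eq_add_neg, h, add_sub_cancel]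
    rw [this, ← mul_assoc, ← map_mul, inv_mul_cancel₀ ht, map_one, one_mul]
  refine ⟨ht, q.algebraMap_injective ?_⟩
  rw [ht, map_zero, zero_mul, zero_sub, neg_inj] at h
  exact h.symm

theorem trace_eq_trd [FiniteDimensional F K] (q : QuatStr F B) (f : K →ₐ[F] B) {D : F} {δ : K}
    (hδ : δ ^ 2 = -algebraMap F K D) (hK : IntermediateField.adjoin F {δ} = ⊤)
    (hsc : ∀ c, algebraMap F K c ≠ δ) (x : K) : Algebra.trace F K x = q.trd (f x) := by
  have hli : LinearIndependent F ![1, δ] := by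
    rw [LinearIndependent.pair_iff]
    intro s t hst
    by_cases ht : t = 0
    · refine ⟨?_, ht⟩
      rw [ht, zero_smul, add_zero] at hst
      exact (smul_eq_zero.1 hst).resolve_right one_ne_zero
    · refine absurd ?_ (hsc (-(t⁻¹ * s)))
      rw [Algebra.smul_def, Algebra.smul_def, mul_one] at hst
      have ht' : algebraMap F K t ≠ 0 := by simpa using ht
      rw [map_neg, map_mul, map_inv₀]
      field_simp
      linear_combination -hst
  have hsp : ⊤ ≤ Submodule.span F (Set.range ![1, δ]) := by
    rintro x -
    obtain ⟨a, b, rfl⟩ := exists_eq_add_mul hδ hK x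
    rw [Matrix.range_cons, Matrix.range_cons, Matrix.range_empty, Set.union_empty,
      Set.singleton_union, Submodule.mem_span_pair]
    exact ⟨a, b, by rw [Algebra.smul_def, Algebra.smul_def, mul_one]⟩
  let b : Module.Basis (Fin 2) F K := Module.Basis.mk hli hsp
  have b0 : b 0 = 1 := by simp [b]
  have b1 : b 1 = δ := by simp [b]
  have hδtr : Algebra.trace F K δ = 0 := by
    rw [Algebra.trace_eq_matrix_trace b, Matrix.trace, Fin.sum_univ_two]
    simp only [Matrix.diag_apply, Algebra.leftMulMatrix_eq_repr_mul]
    have h0 : δ * b 0 = b 1 := by rw [b0, b1, mul_one]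
    have h1 : δ * b 1 = (-D) • b 0 := by
      rw [b0, b1, ← pow_two, hδ, neg_smul, Algebra.smul_def, mul_one]
    rw [h0, h1, b.repr_self, map_smul, b.repr_self]
    simp
  have h2 : Module.finrank F K = 2 := by
    rw [Module.finrank_eq_card_basis b, Fintype.card_fin]
  obtain ⟨c, d, rfl⟩ := exists_eq_add_mul hδ hK x
  rw [map_add, map_add, map_add, Algebra.trace_algebraMap, h2, ← Algebra.smul_def, map_smul,
    map_smul, map_smul, hδtr, AlgHom.commutes, q.trd_algebraMap,
    (trd_nrd_of_sq q f hδ hsc).1, nsmul_eq_mul]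
  push_cast; ring

theorem IntegralEmbedding.localMap_injective [Nontrivial B] (ι : IntegralEmbedding K R)
    (v : HeightOneSpectrum (𝓞 F)) : Function.Injective (ι.localMap v) :=
  Module.Flat.lTensor_preserves_injective_linearMap (M := v.adicCompletion F)
    ι.toAlgHom.toLinearMap ι.toAlgHom.toRingHom.injective

/-- Global elements are dense in a local algebra. -/
theorem exists_one_tmul_add_smul (R : Subalgebra (𝓞 F) B) [IsOrder R]
    (v : HeightOneSpectrum (𝓞 F)) (y : LocalAlg F B v) {s : v.adicCompletionIntegers F}
    (hs : s ≠ 0) : ∃ x : B, ∃ e ∈ localOrder R v, y = 1 ⊗ₜ x + s • e := by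
  induction y using TensorProduct.induction_on with
  | zero => exact ⟨0, 0, zero_mem _, by rw [smul_zero, TensorProduct.tmul_zero, add_zero]⟩
  | add y z hy hz =>
    obtain ⟨x, e, he, rfl⟩ := hy
    obtain ⟨w, f, hf, rfl⟩ := hz
    exact ⟨x + w, e + f, add_mem he hf, by rw [TensorProduct.tmul_add, smul_add]; abel⟩
  | tmul l b =>
    obtain ⟨c, hc, hcb⟩ := exists_smul_mem (O := 𝓞 F) (IsOrder.span_eq_top (R := R)) b
    have hc' : (c : F) ≠ 0 := by simpa using hc
    have hcv : algebraMap F (v.adicCompletion F) c ≠ 0 := by simpa using hc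
    have hs' : (s : v.adicCompletion F) ≠ 0 := by simpa using hs
    obtain ⟨f, hf⟩ := exists_valued_sub_lt v l (mul_ne_zero hs' hcv)
    let μ : v.adicCompletion F := (l - algebraMap F _ f) / (s * algebraMap F _ c)
    have hμ : μ ∈ v.adicCompletionIntegers F := by
      rw [HeightOneSpectrum.mem_adicCompletionIntegers, map_div₀]
      refine div_le_one_of_le₀ ?_ zero_le
      rw [Valuation.map_sub_swap]
      exact hf.le
    refine ⟨f • b, (⟨μ, hμ⟩ : v.adicCompletionIntegers F) • (1 ⊗ₜ (c • b)),
      Subalgebra.smul_mem _ (one_tmul_mem_localOrder hcb v) _, ?_⟩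
    have e1 : s • (⟨μ, hμ⟩ : v.adicCompletionIntegers F) •
        ((1 : v.adicCompletion F) ⊗ₜ[F] (c • b)) =
        ((s : v.adicCompletion F) * μ * algebraMap F _ c) ⊗ₜ[F] b := by
      have : c • b = (c : F) • b := (algebraMap_smul F c b).symm
      rw [this]
      change (s : v.adicCompletion F) • μ • ((1 : v.adicCompletion F) ⊗ₜ[F] ((c : F) • b)) = _
      rw [smul_smul, TensorProduct.smul_tmul', ← TensorProduct.smul_tmul, Algebra.smul_def,
        smul_eq_mul, mul_one]
      congr 1; ring
    have e2 : (s : v.adicCompletion F) * μ * algebraMap F _ c = l - algebraMap F _ f := by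
      simp only [μ]; field_simp
    rw [e1, e2, ← TensorProduct.smul_tmul, Algebra.smul_def, mul_one, ← TensorProduct.add_tmul,
      add_sub_cancel]

variable [FiniteDimensional F K] [IsOrder R] (ι : IntegralEmbedding K R) (q : QuatStr F B)
  (v : HeightOneSpectrum (𝓞 F))

theorem localMap_one_tmul (x : K) : ι.localMap v (1 ⊗ₜ x) = 1 ⊗ₜ ι.toAlgHom x := by
  simp [IntegralEmbedding.localMap]

/-- Elements of `K_𝔭` with integral trace and norm lie in the completion of `𝓞_K`. -/
theorem mem_localOrder_of_integral {y : LocalAlg F K v} {t n : v.adicCompletionIntegers F}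
    (ht : (q.baseChange (v.adicCompletion F)).trd (ι.localMap v y) = algebraMap _ _ t)
    (hn : (q.baseChange (v.adicCompletion F)).nrd (ι.localMap v y) = algebraMap _ _ n) :
    y ∈ localOrder (maxOrder F K) v := by
  set qv := q.baseChange (v.adicCompletion F) with hqv
  have : Nontrivial B := Module.nontrivial_of_finrank_pos (R := F) (by
    rw [q.finrank_eq]; norm_num)
  have hint := integralOn_localOrder v q R
  obtain ⟨s, hs, hsy⟩ := exists_smul_mem (O := v.adicCompletionIntegers F)
    (span_localOrder v (maxOrder F K)) y
  -- The same `s` that carries `y` into the local order is the precision of the approximation by a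
  -- global `x`. This keeps the cross term in the norm of `y - se` integral, since it is the trace
  -- of `sy` times the conjugate of `e`, up to sign.
  obtain ⟨x, e, he, rfl⟩ := exists_one_tmul_add_smul (maxOrder F K) v y hs
  set y : LocalAlg F K v := 1 ⊗ₜ x + s • e with hy
  refine add_mem ?_ (Subalgebra.smul_mem _ he s)
  have hιs : ∀ (a : v.adicCompletionIntegers F) (z : LocalAlg F K v),
      ι.localMap v (a • z) = a • ι.localMap v z := fun a z =>
    map_smul (ι.localMap v) (a : v.adicCompletion F) z
  have hsm : ∀ (a : v.adicCompletionIntegers F) (x : LocalAlg F B v),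
      qv.trd (a • x) = algebraMap _ (v.adicCompletion F) a * qv.trd x := fun a x =>
    qv.trd.map_smul (a : v.adicCompletion F) x
  have hx : ι.localMap v (1 ⊗ₜ x) = ι.localMap v y - s • ι.localMap v e := by
    rw [← hιs, ← map_sub, hy, add_sub_cancel_right]
  have heR := ι.localMap_mem v he
  obtain ⟨te, ne, hte, hne⟩ := hint _ heR
  -- the trace and norm of `x` are integral at `v`
  have htx : ∃ t' : v.adicCompletionIntegers F,
      qv.trd (ι.localMap v (1 ⊗ₜ x)) = algebraMap _ _ t' :=
    ⟨t - s * te, by rw [hx, map_sub, hsm, ht, hte, map_sub, map_mul]⟩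
  have hnx : ∃ n' : v.adicCompletionIntegers F,
      qv.nrd (ι.localMap v (1 ⊗ₜ x)) = algebraMap _ _ n' := by
    have hmem := mul_mem (ι.localMap_mem v hsy) (conj_mem hint heR)
    obtain ⟨m, -, hm, -⟩ := hint _ hmem
    obtain ⟨-, ns, -, hns⟩ := hint _ (Subalgebra.smul_mem _ heR (-s))
    refine ⟨n + ns - m, ?_⟩
    have hconj : qv.conj (-s • ι.localMap v e) = -s • qv.conj (ι.localMap v e) := by
      have : algebraMap _ (LocalAlg F B v) (algebraMap _ (v.adicCompletion F) (-s) *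
          qv.trd (ι.localMap v e)) = -s • algebraMap _ _ (qv.trd (ι.localMap v e)) := by
        rw [map_mul, ← Algebra.smul_def]; rfl
      rw [QuatStr.conj, QuatStr.conj, smul_sub, hsm, this]
    have h4 : qv.trd (ι.localMap v y * qv.conj (-s • ι.localMap v e)) = -algebraMap _ _ m := by
      rw [hconj, mul_smul_comm, neg_smul, map_neg, ← smul_mul_assoc, ← hιs, hm]
    rw [hx, sub_eq_add_neg, ← neg_smul, qv.nrd_add, hn, hns, h4]
    simp only [map_add, map_sub]
    ring
  have hval : ∀ c : F, (∃ c' : v.adicCompletionIntegers F,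
      algebraMap F (v.adicCompletion F) c = algebraMap _ _ c') → v.valuation F c ≤ 1 := by
    rintro c ⟨c', hc'⟩
    rw [← valued_algebraMap, hc']
    exact c'.2
  rw [localMap_one_tmul, hqv, q.baseChange_trd_one_tmul] at htx
  rw [localMap_one_tmul, hqv, q.baseChange_nrd_one_tmul] at hnx
  -- Trace and norm of `x` are integral at `v`, so their denominators can be taken prime to `v`.
  -- Then `d x` is integral over `𝓞 F`, and `d` is a unit at `v`.
  obtain ⟨t1, d1, h1⟩ := v.exists_primeCompl_mul_eq_of_integer _ (hval _ htx)
  obtain ⟨n2, d2, h2⟩ := v.exists_primeCompl_mul_eq_of_integer _ (hval _ hnx)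
  let d : 𝓞 F := d1 * d2
  have hd : d ∉ v.asIdeal := fun h => (v.isPrime.mem_or_mem h).elim d1.2 d2.2
  have hdx : d • x ∈ maxOrder F K := by
    have hx2 : x * x - algebraMap F K (q.trd (ι.toAlgHom x)) * x +
        algebraMap F K (q.nrd (ι.toAlgHom x)) = 0 := by
      refine ι.toAlgHom.toRingHom.injective ?_
      change ι.toAlgHom _ = ι.toAlgHom 0
      rw [map_add, map_sub, map_mul, map_mul, AlgHom.commutes, AlgHom.commutes, map_zero,
        q.mul_self]
      abel
    have key : (d • x) ^ 2 - algebraMap (𝓞 F) K (t1 * d2) * (d • x) +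
        algebraMap (𝓞 F) K (n2 * d1 * d) = 0 := by
      have hd1 : algebraMap (𝓞 F) K t1 = algebraMap F K (q.trd (ι.toAlgHom x)) *
          algebraMap (𝓞 F) K (d1 : 𝓞 F) := by
        rw [IsScalarTower.algebraMap_apply (𝓞 F) F K, IsScalarTower.algebraMap_apply (𝓞 F) F K,
          ← h1, map_mul]
      have hd2 : algebraMap (𝓞 F) K n2 = algebraMap F K (q.nrd (ι.toAlgHom x)) *
          algebraMap (𝓞 F) K (d2 : 𝓞 F) := by
        rw [IsScalarTower.algebraMap_apply (𝓞 F) F K, IsScalarTower.algebraMap_apply (𝓞 F) F K,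
          ← h2, map_mul]
      simp only [Algebra.smul_def, map_mul, hd1, hd2, d]
      linear_combination (algebraMap (𝓞 F) K (d1 : 𝓞 F) * algebraMap (𝓞 F) K (d2 : 𝓞 F)) ^ 2 * hx2
    refine ⟨Polynomial.X ^ 2 + (Polynomial.C (-(t1 * (d2 : 𝓞 F))) * Polynomial.X +
      Polynomial.C (n2 * d1 * d)), Polynomial.monic_X_pow_add
        (Polynomial.degree_linear_le.trans_lt (by norm_num)), ?_⟩
    rw [← key]
    simp only [Polynomial.eval₂_add, Polynomial.eval₂_mul, Polynomial.eval₂_C, Polynomial.eval₂_X,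
      Polynomial.eval₂_pow, (algebraMap (𝓞 F) K).map_neg]
    ring
  obtain ⟨w, hw⟩ := (isUnit_algebraMap_iff v d).2 hd
  have : (1 : v.adicCompletion F) ⊗ₜ[F] x = ((w⁻¹ : (v.adicCompletionIntegers F)ˣ) :
      v.adicCompletionIntegers F) • (1 : v.adicCompletion F) ⊗ₜ[F] (d • x) := by
    rw [← smul_one_tmul, ← hw, smul_smul, Units.inv_mul, one_smul]
  rw [this]
  exact Subalgebra.smul_mem _ (one_tmul_mem_localOrder hdx v) _

end Quadratic

/-! ## Local optimal embeddings -/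

section LocalEmbedding

open IsLocalRing

variable {F : Type*} [Field F] [NumberField F] {K : Type*} [Field K] [Algebra F K]
  {B : Type*} [Ring B] [Algebra F B] {R : Subalgebra (𝓞 F) B}
  [FiniteDimensional F K] [IsOrder R] (ι : IntegralEmbedding K R) (q : QuatStr F B)
  (v : HeightOneSpectrum (𝓞 F))

/-- The map `K_𝔭ˣ → B_𝔭ˣ`. -/
abbrev IntegralEmbedding.localUnitsMap {F : Type*} [Field F] [NumberField F] {K : Type*} [Field K]
    [Algebra F K] {B : Type*} [Ring B] [Algebra F B] {R : Subalgebra (𝓞 F) B}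
    (ι : IntegralEmbedding K R) (v : HeightOneSpectrum (𝓞 F)) :
    (LocalAlg F K v)ˣ →* (LocalAlg F B v)ˣ :=
  Units.map (ι.localMap v : LocalAlg F K v →* LocalAlg F B v)

/-- The completion of `𝓞_K` is generated by an element with a maximal polynomial. -/
theorem exists_maxPoly {D : F} {δ : K} (hδ : δ ^ 2 = -algebraMap F K D) (hD : D ≠ 0)
    (hsc : ∀ c, algebraMap F K c ≠ δ) :
    ∃ h ∈ localOrder (maxOrder F K) v, ∃ t n : v.adicCompletionIntegers F,
      (q.baseChange (v.adicCompletion F)).trd (ι.localMap v h) = algebraMap _ _ t ∧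
      (q.baseChange (v.adicCompletion F)).nrd (ι.localMap v h) = algebraMap _ _ n ∧
      Model.IsMaxPoly t n ∧ t ^ 2 - 4 * n ≠ 0 := by
  set qv := q.baseChange (v.adicCompletion F) with hqv
  have hint := integralOn_localOrder v q R
  have inj := IsFractionRing.injective (v.adicCompletionIntegers F) (v.adicCompletion F)
  -- The generator is chosen with discriminant of minimal valuation; a multiple of `δ` shows that
  -- nonzero discriminants occur.
  obtain ⟨d, ⟨h, hh, t, n, ht, hn, rfl⟩, hd0, hdvd⟩ := exists_dvd_all (T := {d |
      ∃ h ∈ localOrder (maxOrder F K) v, ∃ t n : v.adicCompletionIntegers F,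
      qv.trd (ι.localMap v h) = algebraMap _ _ t ∧ qv.nrd (ι.localMap v h) = algebraMap _ _ n ∧
      d = t ^ 2 - 4 * n}) (by
    obtain ⟨c, hc, hcδ⟩ := exists_smul_mem (O := 𝓞 F)
      (IsOrder.span_eq_top (R := maxOrder F K)) δ
    have hh := one_tmul_mem_localOrder hcδ v
    obtain ⟨t, n, ht, hn⟩ := hint _ (ι.localMap_mem v hh)
    refine ⟨t ^ 2 - 4 * n, ⟨_, hh, t, n, ht, hn, rfl⟩, fun h0 => ?_⟩
    obtain ⟨h1, h2⟩ := trd_nrd_of_sq q ι.toAlgHom hδ hsc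
    have e1 : ι.toAlgHom (c • δ) = algebraMap F B c * ι.toAlgHom δ := by
      have : c • δ = (c : F) • δ := (algebraMap_smul F c δ).symm
      rw [this, map_smul, Algebra.smul_def]
    rw [localMap_one_tmul, q.baseChange_trd_one_tmul, e1, ← Algebra.smul_def, map_smul, h1,
      smul_zero, map_zero] at ht
    rw [localMap_one_tmul, q.baseChange_nrd_one_tmul, e1, q.nrd_mul, q.nrd_algebraMap,
      h2] at hn
    have h3 := congrArg (algebraMap (v.adicCompletionIntegers F) (v.adicCompletion F)) h0
    rw [map_sub, map_pow, map_mul, ← ht, ← hn, map_ofNat, map_zero, zero_pow two_ne_zero,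
      zero_sub, neg_eq_zero] at h3
    have hc' : (c : F) ≠ 0 := by simpa using hc
    rcases mul_eq_zero.1 h3 with h4 | h4
    · have : algebraMap F (v.adicCompletion F) 4 = 0 := by rw [map_ofNat]; exact h4
      rw [map_eq_zero] at this
      norm_num at this
    · rw [map_eq_zero] at h4
      exact mul_ne_zero (pow_ne_zero 2 hc') hD h4)
  refine ⟨h, hh, t, n, ht, hn, ?_, hd0⟩
  rintro α ⟨h1, h2⟩
  obtain ⟨ϖ, hϖ⟩ := IsDiscreteValuationRing.exists_irreducible (v.adicCompletionIntegers F)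
  rw [hϖ.maximalIdeal_eq, Ideal.mem_span_singleton] at h1
  rw [hϖ.maximalIdeal_eq, Ideal.span_singleton_pow, Ideal.mem_span_singleton] at h2
  obtain ⟨t', ht'⟩ := h1
  obtain ⟨n', hn'⟩ := h2
  have hϖ0 : algebraMap _ (v.adicCompletion F) ϖ ≠ 0 := by
    rw [Ne, IsFractionRing.to_map_eq_zero_iff]; exact hϖ.ne_zero
  set w := algebraMap (v.adicCompletionIntegers F) (v.adicCompletion F) ϖ with hw
  set a := algebraMap (v.adicCompletionIntegers F) (v.adicCompletion F) α with ha
  -- A failure of maximality makes `(h - α)/ϖ` integral, hence an element of the completed `𝓞_K`,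
  -- with discriminant smaller by the factor `ϖ²`.
  set h' : LocalAlg F K v := algebraMap _ _ w⁻¹ * (h + algebraMap _ _ (-a)) with hh'
  have hι : ι.localMap v h' = algebraMap _ _ w⁻¹ * (ι.localMap v h + algebraMap _ _ (-a)) := by
    rw [hh', map_mul, map_add, AlgHom.commutes, AlgHom.commutes]
  have ht2 : qv.trd (ι.localMap v h') = algebraMap _ _ t' := by
    rw [hι, ← Algebra.smul_def, map_smul, map_add, qv.trd_algebraMap, ht, smul_eq_mul]
    have := congrArg (algebraMap _ (v.adicCompletion F)) ht'
    simp only [map_sub, map_mul, map_ofNat] at this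
    rw [inv_mul_eq_iff_eq_mul₀ hϖ0]
    linear_combination this
  have hn2 : qv.nrd (ι.localMap v h') = algebraMap _ _ n' := by
    rw [hι, qv.nrd_mul, qv.nrd_algebraMap, qv.nrd_add, qv.conj_algebraMap, qv.nrd_algebraMap,
      ← Algebra.commutes, ← Algebra.smul_def, map_smul, ht, hn, smul_eq_mul, inv_pow,
      inv_mul_eq_iff_eq_mul₀ (pow_ne_zero 2 hϖ0)]
    have := congrArg (algebraMap _ (v.adicCompletion F)) hn'
    simp only [map_sub, map_mul, map_add, map_pow] at this
    linear_combination this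
  have hh2 := mem_localOrder_of_integral ι q v ht2 hn2
  obtain ⟨e, he⟩ := hdvd _ ⟨h', hh2, t', n', ht2, hn2, rfl⟩
  have h3 : t ^ 2 - 4 * n = ϖ ^ 2 * (t' ^ 2 - 4 * n') := by
    linear_combination (t - 2 * α + ϖ * t') * ht' - 4 * hn'
  have h4 : (t ^ 2 - 4 * n) * (ϖ * (ϖ * e)) = (t ^ 2 - 4 * n) * 1 := by
    rw [mul_one]; conv_rhs => rw [h3, he]
    ring
  exact hϖ.not_isUnit (IsUnit.of_mul_eq_one _ (mul_left_cancel₀ hd0 h4))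

include q in
theorem nontrivial_of_quatStr : Nontrivial B :=
  Module.nontrivial_of_finrank_pos (R := F) (by rw [q.finrank_eq]; norm_num)

/-- The centralizer of a non-scalar element of `K_𝔭` is `K_𝔭`. -/
theorem exists_localUnitsMap_eq {h : LocalAlg F K v}
    (hΔ : (q.baseChange (v.adicCompletion F)).trd (ι.localMap v h) ^ 2 -
      4 * (q.baseChange (v.adicCompletion F)).nrd (ι.localMap v h) ≠ 0)
    {κ : (LocalAlg F B v)ˣ} (hκ : (κ : LocalAlg F B v) * ι.localMap v h = ι.localMap v h * κ) :
    ∃ c : (LocalAlg F K v)ˣ, ι.localUnitsMap v c = κ := by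
  have := nontrivial_of_quatStr q
  have key : ∀ x : LocalAlg F B v, x * ι.localMap v h = ι.localMap v h * x →
      ∃ y, ι.localMap v y = x := by
    intro x hx
    obtain ⟨α, β, rfl⟩ := QuatStr.exists_of_commute _ hΔ hx
    exact ⟨algebraMap _ _ α + algebraMap _ _ β * h, by
      rw [map_add, map_mul, AlgHom.commutes, AlgHom.commutes]⟩
  obtain ⟨y, hy⟩ := key κ hκ
  obtain ⟨z, hz⟩ := key (κ⁻¹ : (LocalAlg F B v)ˣ) (by
    rw [Units.inv_mul_eq_iff_eq_mul, ← mul_assoc, hκ, mul_assoc, Units.mul_inv, mul_one])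
  have inj := ι.localMap_injective v
  refine ⟨⟨y, z, inj ?_, inj ?_⟩, Units.ext hy⟩
  · rw [map_mul, hy, hz, Units.mul_inv, map_one]
  · rw [map_mul, hy, hz, Units.inv_mul, map_one]

include q in
/-- Units of `K_𝔭` conjugate to units of `R_𝔭` are units of the completion of `𝓞_K`. -/
theorem mem_localUnits_of_conj {κ : (LocalAlg F K v)ˣ} {x r : (LocalAlg F B v)ˣ}
    (hr : r ∈ localUnits (localOrder R v)) (h : x * ι.localUnitsMap v κ = r * x) :
    κ ∈ localUnits (localOrder (maxOrder F K) v) := by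
  have hint := integralOn_localOrder v q R
  have key : ∀ {κ : (LocalAlg F K v)ˣ} {r : (LocalAlg F B v)ˣ},
      (r : LocalAlg F B v) ∈ localOrder R v → x * ι.localUnitsMap v κ = r * x →
      (κ : LocalAlg F K v) ∈ localOrder (maxOrder F K) v := by
    intro κ r hr h
    obtain ⟨t, n, ht, hn⟩ := hint _ hr
    have h' := congrArg Units.val h
    exact mem_localOrder_of_integral ι q v
      ((QuatStr.trd_eq_of_conj _ x.isUnit h').trans ht)
      ((QuatStr.nrd_eq_of_conj _ x.isUnit h').trans hn)
  rw [mem_localUnits] at hr ⊢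
  refine ⟨key hr.1 h, key hr.2 ?_⟩
  rw [map_inv, mul_inv_eq_iff_eq_mul, mul_assoc, h, inv_mul_cancel_left]

/-- Apply the conjugacy theorem to a generator `h` of the completed `𝓞_K` and its conjugate under
`x`. The factor left over centralizes `h`, so it comes from `K_𝔭ˣ`. -/
theorem exists_local_decomp {D : F} {δ : K} (hδ : δ ^ 2 = -algebraMap F K D) (hD : D ≠ 0)
    (hsc : ∀ c, algebraMap F K c ≠ δ)
    (M : LocalModel (q.baseChange (v.adicCompletion F)) (localOrder R v)) {x : (LocalAlg F B v)ˣ}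
    (hx : ∀ y ∈ localOrder (maxOrder F K) v,
      (x : LocalAlg F B v) * ι.localMap v y * (x⁻¹ : (LocalAlg F B v)ˣ) ∈ localOrder R v) :
    ∃ r ∈ localUnits (localOrder R v), ∃ κ : (LocalAlg F K v)ˣ,
      x = r * ι.localUnitsMap v κ ∨ x = r * M.u * ι.localUnitsMap v κ := by
  obtain ⟨h, hh, t, n, ht, hn, hmax, hne⟩ := exists_maxPoly ι q v hδ hD hsc
  obtain ⟨r, hr, κ, hκ, hxκ⟩ := M.exists_decomp (ι.localMap_mem v hh) (hx h hh) (x := x)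
    (by rw [mul_assoc, Units.inv_mul, mul_one]) ht hn hmax
  obtain ⟨c, rfl⟩ := exists_localUnitsMap_eq ι q v (h := h) (by
    rw [ht, hn, ← map_ofNat (algebraMap (v.adicCompletionIntegers F) (v.adicCompletion F)),
      ← map_pow, ← map_mul, ← map_sub, Ne, IsFractionRing.to_map_eq_zero_iff]
    exact hne) hκ
  exact ⟨r, hr, c, hxκ⟩

/-- By coprimality some relative discriminant is a unit at `v`. It is a Gram determinant of size two
for the reduced trace on the image of the completed `𝓞_K`, so `exists_etale_of_gram` applies. -/
theorem exists_etale_of_isCoprime {D : F} {δ : K} (hδ : δ ^ 2 = -algebraMap F K D)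
    (hK : IntermediateField.adjoin F {δ} = ⊤) (hsc : ∀ c, algebraMap F K c ≠ δ)
    {N : Ideal (𝓞 F)} (hcop : IsCoprime (relDiscriminant F K) N) (hv : v.asIdeal ∣ N) :
    ∃ h ∈ localOrder (maxOrder F K) v, IsEtaleElt (v.adicCompletionIntegers F)
      (q.baseChange (v.adicCompletion F)) (ι.localMap v h) := by
  have hnot : ¬ relDiscriminant F K ≤ v.asIdeal := by
    intro h
    rw [Ideal.isCoprime_iff_sup_eq] at hcop
    have := sup_le h (Ideal.dvd_iff_le.1 hv)
    rw [hcop, top_le_iff] at this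
    exact v.isPrime.ne_top this
  rw [relDiscriminant, Ideal.span_le, Set.not_subset] at hnot
  obtain ⟨d, ⟨x, hx, hd⟩, hdv⟩ := hnot
  let S := (localOrder (maxOrder F K) v).map
    ((ι.localMap v).restrictScalars (v.adicCompletionIntegers F))
  have hint := integralOn_localOrder v q R
  have hS : IntegralOn (q.baseChange (v.adicCompletion F)) S := by
    rintro _ ⟨y, hy, rfl⟩
    exact hint _ (ι.localMap_mem v hy)
  obtain ⟨_, ⟨h, hh, rfl⟩, hg⟩ := exists_etale_of_gram (ι := Fin 2) hS
    ⟨fun i => 1 ⊗ₜ ι.toAlgHom (x i),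
      fun i => ⟨1 ⊗ₜ x i, one_tmul_mem_localOrder (hx i) v, localMap_one_tmul ι v (x i)⟩,
      algebraMap _ _ d, (isUnit_algebraMap_iff v d).2 hdv, by
        have : algebraMap (v.adicCompletionIntegers F) (v.adicCompletion F)
          (algebraMap (𝓞 F) _ d) = algebraMap F _ (d : F) := rfl
        rw [this, hd, Algebra.discr_def, RingHom.map_det]
        congr 1
        ext i j
        rw [Matrix.of_apply, Algebra.TensorProduct.tmul_mul_tmul, one_mul, ← map_mul,
          q.baseChange_trd_one_tmul, ← trace_eq_trd q ι.toAlgHom hδ hK hsc]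
        rfl⟩
  exact ⟨h, hh, hg⟩

end LocalEmbedding

/-! ## Adelic units and their components -/

section Components

open Filter

variable {F : Type*} [Field F] [NumberField F] {A : Type*} [Ring A] [Algebra F A]

/-- The component at `v` of an idele. -/
def comp (R : Subalgebra (𝓞 F) A) (v : HeightOneSpectrum (𝓞 F)) :
    (Hat R)ˣ →* (LocalAlg F A v)ˣ :=
  Units.map (RestrictedProduct.evalMonoidHom _ v)

variable {R : Subalgebra (𝓞 F) A}

theorem mem_hatUnits_iff {u : (Hat R)ˣ} :
    u ∈ hatUnits R ↔ ∀ v, comp R v u ∈ localUnits (localOrder R v) := by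
  simp only [mem_hatUnits, mem_localUnits]
  exact forall_and.symm

theorem eventually_comp_mem (x : (Hat R)ˣ) :
    ∀ᶠ v in cofinite, comp R v x ∈ localUnits (localOrder R v) := by
  filter_upwards [(x : Hat R).2, ((x⁻¹ : (Hat R)ˣ) : Hat R).2] with v h1 h2
  exact mem_localUnits.2 ⟨h1, h2⟩

theorem exists_comp_eq (z : ∀ v, (LocalAlg F A v)ˣ)
    (h : ∀ᶠ v in cofinite, z v ∈ localUnits (localOrder R v)) :
    ∃ x : (Hat R)ˣ, ∀ v, comp R v x = z v :=
  ⟨RestrictedProduct.mkUnit z h, fun _ => rfl⟩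

theorem mem_hatNormalizer_iff {z : (Hat R)ˣ} :
    z ∈ hatNormalizer R ↔ ∀ v, comp R v z ∈ localNormalizer (localOrder R v) := by
  classical
  constructor
  · intro hz v y
    -- The local condition at `v` is the global one tested on the adele supported at `v`.
    let Y : Hat R := ⟨fun w => if h : w = v then h ▸ y else 0, by
      filter_upwards [(Set.finite_singleton v).compl_mem_cofinite] with w hw
      rw [dif_neg (by simpa using hw)]
      exact zero_mem _⟩
    have hYv : Y v = y := by
      change (if h : v = v then h ▸ y else 0) = y
      rw [dif_pos rfl]
    have hYw : ∀ w, w ≠ v → Y w = 0 := fun w hw => dif_neg hw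
    have h := hz Y
    constructor
    · intro hy
      rw [← hYv]
      refine h.1 (fun w => ?_) v
      by_cases hw : w = v
      · subst hw
        change (comp R w z : LocalAlg F A w) * Y w * ((comp R w z)⁻¹ : (LocalAlg F A w)ˣ) ∈ _
        rw [hYv]; exact hy
      · change (comp R w z : LocalAlg F A w) * Y w * ((comp R w z)⁻¹ : (LocalAlg F A w)ˣ) ∈ _
        rw [hYw w hw, mul_zero, zero_mul]
        exact zero_mem _
    · intro hy
      have h2 := h.2 (fun w => ?_) v
      · change (comp R v z : LocalAlg F A v) * Y v * ((comp R v z)⁻¹ : (LocalAlg F A v)ˣ) ∈ _ at h2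
        rwa [hYv] at h2
      by_cases hw : w = v
      · subst hw
        rw [hYv]; exact hy
      · rw [hYw w hw]
        exact zero_mem _
  · intro hz y
    exact forall_congr' fun v => hz v (y v)

theorem hatUnits_le : hatUnits R ≤ hatNormalizer R := fun u hu =>
  mem_hatNormalizer_iff.2 fun v => localUnits_le _ (mem_hatUnits_iff.1 hu v)

theorem comp_scalarUnits (c : (FiniteAdeleRing (𝓞 F) F)ˣ) (v : HeightOneSpectrum (𝓞 F)) :
    ∃ d : (v.adicCompletion F)ˣ,
      comp R v (scalarUnits R c) = scalarMap (v.adicCompletion F) (LocalAlg F A v) d :=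
  ⟨Units.map (RestrictedProduct.evalMonoidHom _ v) c, rfl⟩

theorem exists_scalarUnits_eq (c : ∀ v : HeightOneSpectrum (𝓞 F), (v.adicCompletion F)ˣ)
    (hc : ∀ᶠ v in cofinite, c v = 1) : ∃ d : (FiniteAdeleRing (𝓞 F) F)ˣ,
      ∀ v, comp R v (scalarUnits R d) = scalarMap (v.adicCompletion F) (LocalAlg F A v) (c v) := by
  refine ⟨RestrictedProduct.mkUnit c ?_, fun _ => rfl⟩
  filter_upwards [hc] with v hv
  rw [hv]
  exact one_mem _

/-- The group generated by the scalars and the units of a local order. -/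
def scalarLocalUnits (k : Type*) {A O : Type*} [Field k] [Ring A] [Algebra k A] [CommRing O] [Algebra O A]
    (R : Subalgebra O A) : Subgroup Aˣ where
  carrier := {z | ∃ c : kˣ, ∃ r ∈ localUnits R, z = scalarMap k A c * r}
  one_mem' := ⟨1, 1, one_mem _, by rw [map_one, one_mul]⟩
  mul_mem' := by
    rintro _ _ ⟨c, r, hr, rfl⟩ ⟨d, s, hs, rfl⟩
    refine ⟨c * d, r * s, mul_mem hr hs, ?_⟩
    rw [map_mul, mul_assoc, ← mul_assoc r, ← scalarMap_comm, mul_assoc, mul_assoc]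
  inv_mem' := by
    rintro _ ⟨c, r, hr, rfl⟩
    exact ⟨c⁻¹, r⁻¹, inv_mem hr, by rw [mul_inv_rev, ← map_inv, scalarMap_comm]⟩

theorem localUnits_le_scalarLocalUnits (k : Type*) {A O : Type*} [Field k] [Ring A] [Algebra k A]
    [CommRing O] [Algebra O A] (R : Subalgebra O A) : localUnits R ≤ scalarLocalUnits k R :=
  fun r hr => ⟨1, r, hr, by rw [map_one, one_mul]⟩

theorem conj_mem_scalarLocalUnits {k A O : Type*} [Field k] [Ring A] [Algebra k A] [CommRing O]
    [Algebra O A] {R : Subalgebra O A} {z u : Aˣ} (hz : z ∈ localNormalizer R)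
    (hu : u ∈ scalarLocalUnits k R) : z * u * z⁻¹ ∈ scalarLocalUnits k R := by
  obtain ⟨c, r, hr, rfl⟩ := hu
  refine ⟨c, z * r * z⁻¹, conj_mem_localUnits hz hr, ?_⟩
  rw [← mul_assoc, ← scalarMap_comm]
  simp only [mul_assoc]

/-- An idele which is everywhere locally a scalar times a unit is so globally. -/
theorem exists_scalar_mul_hatUnits {z : (Hat R)ˣ}
    (h : ∀ v, comp R v z ∈ scalarLocalUnits (v.adicCompletion F) (localOrder R v)) :
    ∃ d : (FiniteAdeleRing (𝓞 F) F)ˣ, ∃ u ∈ hatUnits R, z = scalarUnits R d * u := by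
  classical
  choose c r hr hcr using h
  -- Taking the scalar `1` wherever the component is already a unit makes the family an idele of
  -- `F`.
  let c' : ∀ v : HeightOneSpectrum (𝓞 F), (v.adicCompletion F)ˣ := fun v =>
    if comp R v z ∈ localUnits (localOrder R v) then 1 else c v
  obtain ⟨d, hd⟩ := exists_scalarUnits_eq (R := R) c' (by
    filter_upwards [eventually_comp_mem z] with v hv
    exact if_pos hv)
  refine ⟨d, (scalarUnits R d)⁻¹ * z, mem_hatUnits_iff.2 fun v => ?_, (mul_inv_cancel_left _ _).symm⟩
  rw [map_mul, map_inv, hd]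
  by_cases hv : comp R v z ∈ localUnits (localOrder R v)
  · have : c' v = 1 := if_pos hv
    rwa [this, map_one, inv_one, one_mul]
  · have : c' v = c v := if_neg hv
    rw [this, hcr, inv_mul_cancel_left]
    exact hr v

end Components

/-! ## The group `Bil(R)` -/

/-- The character of a group defined by a subgroup of index at most two. -/
def indexTwoHom {G : Type*} [Group G] (T : Subgroup G)
    (h : ∀ a b, a ∉ T → b ∉ T → a * b ∈ T) : G →* Multiplicative (ZMod 2) := by
  classical
  exact
  { toFun := fun a => if a ∈ T then 1 else Multiplicative.ofAdd 1
    map_one' := if_pos (one_mem T)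
    map_mul' := by
      intro a b
      by_cases ha : a ∈ T
      · by_cases hb : b ∈ T
        · rw [if_pos (mul_mem ha hb), if_pos ha, if_pos hb, one_mul]
        · rw [if_neg (fun hab => hb ((T.mul_mem_cancel_left ha).1 hab)), if_pos ha, if_neg hb,
            one_mul]
      · by_cases hb : b ∈ T
        · rw [if_neg (fun hab => ha ((T.mul_mem_cancel_right hb).1 hab)), if_neg ha, if_pos hb,
            mul_one]
        · rw [if_pos (h a b ha hb), if_neg ha, if_neg hb]
          rfl }

theorem indexTwoHom_of_mem {G : Type*} [Group G] {T : Subgroup G}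
    (h : ∀ a b, a ∉ T → b ∉ T → a * b ∈ T) {a : G} (ha : a ∈ T) : indexTwoHom T h a = 1 :=
  if_pos ha

theorem indexTwoHom_of_notMem {G : Type*} [Group G] {T : Subgroup G}
    (h : ∀ a b, a ∉ T → b ∉ T → a * b ∈ T) {a : G} (ha : a ∉ T) :
    indexTwoHom T h a = Multiplicative.ofAdd 1 :=
  if_neg ha

theorem indexTwoHom_eq_one_iff {G : Type*} [Group G] {T : Subgroup G}
    (h : ∀ a b, a ∉ T → b ∉ T → a * b ∈ T) {a : G} : indexTwoHom T h a = 1 ↔ a ∈ T := by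
  refine ⟨fun h1 => ?_, indexTwoHom_of_mem h⟩
  by_contra ha
  rw [indexTwoHom_of_notMem h ha] at h1
  exact absurd (congrArg Multiplicative.toAdd h1) (by decide)

section BilGroup

open Filter

variable {F : Type*} [Field F] [NumberField F] {B : Type*} [Ring B] [Algebra F B]

/-- Models of all completions of `R`, compatible with the discriminant `N`. -/
structure LocalModels (q : QuatStr F B) (R : Subalgebra (𝓞 F) B) (N : Ideal (𝓞 F)) where
  M : ∀ v : HeightOneSpectrum (𝓞 F),
    LocalModel (q.baseChange (v.adicCompletion F)) (localOrder R v)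
  isUnit_iff : ∀ v, IsUnit (M v).c₃ ↔ ¬ v.asIdeal ∣ N
  finite : {v : HeightOneSpectrum (𝓞 F) | v.asIdeal ∣ N}.Finite

theorem exists_localModels (q : QuatStr F B) (hq : ∀ b, q.trd b = reducedTrace b)
    (R : Subalgebra (𝓞 F) B) [IsOrder R] {N : Ideal (𝓞 F)} (hN : IsReducedDiscriminant R N)
    (hR : ∀ v : HeightOneSpectrum (𝓞 F), v.asIdeal ∣ N → eichlerInvariant R v ≠ 0) :
    Nonempty (LocalModels q R N) := by
  choose M hM using fun v => exists_localModel q hq R hN v (hR v)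
  exact ⟨⟨M, hM, finite_dvd (reducedDiscriminant_ne_bot q hq R hN)⟩⟩

variable {q : QuatStr F B} {R : Subalgebra (𝓞 F) B} [IsOrder R] {N : Ideal (𝓞 F)}
  (L : LocalModels q R N)

namespace LocalModels

theorem exists_eq (v : HeightOneSpectrum (𝓞 F)) {z : (LocalAlg F B v)ˣ}
    (hz : z ∈ localNormalizer (localOrder R v)) :
    ∃ t ∈ scalarLocalUnits (v.adicCompletion F) (localOrder R v),
      z = t ∨ z = t * (L.M v).u := by
  obtain ⟨c, r, hr, h⟩ := (L.M v).exists_of_mem_localNormalizer (integralOn_localOrder v q R)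
    (span_localOrder v R) hz
  exact ⟨_, ⟨c, r, hr, rfl⟩, h⟩

include L in
-- Both factors lie in the coset of `u`, and `u` normalizes the order and has scalar square.
theorem mul_mem_scalarLocalUnits (v : HeightOneSpectrum (𝓞 F)) {z w : (LocalAlg F B v)ˣ}
    (hz : z ∈ localNormalizer (localOrder R v)) (hw : w ∈ localNormalizer (localOrder R v))
    (hz' : z ∉ scalarLocalUnits (v.adicCompletion F) (localOrder R v))
    (hw' : w ∉ scalarLocalUnits (v.adicCompletion F) (localOrder R v)) :
    z * w ∈ scalarLocalUnits (v.adicCompletion F) (localOrder R v) := by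
  obtain ⟨t, ht, h⟩ := L.exists_eq v hz
  obtain ⟨s, hs, h'⟩ := L.exists_eq v hw
  rcases h with rfl | rfl
  · exact absurd ht hz'
  rcases h' with rfl | rfl
  · exact absurd hs hw'
  obtain ⟨c, hc⟩ := (L.M v).u_mul_u
  have : t * (L.M v).u * (s * (L.M v).u) = t * ((L.M v).u * s * (L.M v).u⁻¹) *
      ((L.M v).u * (L.M v).u) := by group
  rw [this, hc]
  exact mul_mem (mul_mem ht (conj_mem_scalarLocalUnits (L.M v).u_mem hs))
    ⟨c, 1, one_mem _, (mul_one _).symm⟩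

include L in
theorem mem_scalarLocalUnits_of_not_dvd {v : HeightOneSpectrum (𝓞 F)} (hv : ¬ v.asIdeal ∣ N)
    {z : (LocalAlg F B v)ˣ} (hz : z ∈ localNormalizer (localOrder R v)) :
    z ∈ scalarLocalUnits (v.adicCompletion F) (localOrder R v) := by
  obtain ⟨t, ht, rfl | rfl⟩ := L.exists_eq v hz
  · exact ht
  · exact mul_mem ht (localUnits_le_scalarLocalUnits _ _
      ((L.M v).u_mem_localUnits ((L.isUnit_iff v).2 hv)))

theorem u_notMem {v : HeightOneSpectrum (𝓞 F)} (hv : v.asIdeal ∣ N) :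
    (L.M v).u ∉ scalarLocalUnits (v.adicCompletion F) (localOrder R v) := by
  rintro ⟨c, r, hr, h⟩
  exact (L.M v).u_ne (fun h' => (L.isUnit_iff v).1 h' hv) c hr h

/-- The local characters on the normalizer. -/
def localChar (v : HeightOneSpectrum (𝓞 F)) :
    localNormalizer (localOrder R v) →* Multiplicative (ZMod 2) :=
  indexTwoHom ((scalarLocalUnits (v.adicCompletion F) (localOrder R v)).subgroupOf _)
    fun a b ha hb => L.mul_mem_scalarLocalUnits v a.2 b.2 ha hb

theorem localChar_eq_one_iff {v : HeightOneSpectrum (𝓞 F)}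
    {z : localNormalizer (localOrder R v)} : L.localChar v z = 1 ↔
      (z : (LocalAlg F B v)ˣ) ∈ scalarLocalUnits (v.adicCompletion F) (localOrder R v) :=
  indexTwoHom_eq_one_iff _

theorem localChar_of_notMem {v : HeightOneSpectrum (𝓞 F)}
    {z : localNormalizer (localOrder R v)}
    (h : (z : (LocalAlg F B v)ˣ) ∉ scalarLocalUnits (v.adicCompletion F) (localOrder R v)) :
    L.localChar v z = Multiplicative.ofAdd 1 :=
  indexTwoHom_of_notMem _ h

/-- The product of the local characters. -/
def char : hatNormalizer R →*
    Multiplicative ({v : HeightOneSpectrum (𝓞 F) // v.asIdeal ∣ N} → ZMod 2) where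
  toFun z := Multiplicative.ofAdd fun v => Multiplicative.toAdd
    (L.localChar v ⟨comp R v z, mem_hatNormalizer_iff.1 z.2 v⟩)
  map_one' := by
    refine congrArg Multiplicative.ofAdd (funext fun v => ?_)
    exact congrArg Multiplicative.toAdd (L.localChar v).map_one
  map_mul' a b := by
    refine congrArg Multiplicative.ofAdd (funext fun v => ?_)
    exact congrArg Multiplicative.toAdd ((L.localChar v).map_mul
      ⟨comp R v a, mem_hatNormalizer_iff.1 a.2 v⟩ ⟨comp R v b, mem_hatNormalizer_iff.1 b.2 v⟩)

theorem char_eq_one_iff (z : hatNormalizer R) : L.char z = 1 ↔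
    ∀ v, comp R v z ∈ scalarLocalUnits (v.adicCompletion F) (localOrder R v) := by
  constructor
  · intro h v
    by_cases hv : v.asIdeal ∣ N
    · have := congrFun (congrArg Multiplicative.toAdd h) ⟨v, hv⟩
      exact L.localChar_eq_one_iff.1 (congrArg Multiplicative.ofAdd this)
    · exact L.mem_scalarLocalUnits_of_not_dvd hv (mem_hatNormalizer_iff.1 z.2 v)
  · intro h
    refine congrArg Multiplicative.ofAdd (funext fun v => ?_)
    exact congrArg Multiplicative.toAdd (L.localChar_eq_one_iff.2 (h v))

/-- The kernel consists of the ideles that are everywhere locally a scalar times a unit, and the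
local scalars can be patched. -/
theorem ker_char : L.char.ker = (hatUnits R).subgroupOf (hatNormalizer R) ⊔
    (scalarUnits R).range.subgroupOf (hatNormalizer R) := by
  apply le_antisymm
  · intro z hz
    obtain ⟨d, u, hu, h⟩ := exists_scalar_mul_hatUnits ((L.char_eq_one_iff z).1 hz)
    have hd : scalarUnits R d ∈ hatNormalizer R := by
      have : scalarUnits R d = z * u⁻¹ := by rw [h, mul_inv_cancel_right]
      rw [this]
      exact mul_mem z.2 (inv_mem (hatUnits_le hu))
    have : z = ⟨scalarUnits R d, hd⟩ * ⟨u, hatUnits_le hu⟩ := Subtype.ext h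
    rw [this]
    exact mul_mem (Subgroup.mem_sup_right ⟨d, rfl⟩) (Subgroup.mem_sup_left hu)
  · rw [sup_le_iff]
    refine ⟨fun z hz => ?_, fun z hz => ?_⟩
    · rw [MonoidHom.mem_ker, char_eq_one_iff]
      exact fun v => localUnits_le_scalarLocalUnits _ _ (mem_hatUnits_iff.1 hz v)
    · obtain ⟨d, hd⟩ := hz
      rw [MonoidHom.mem_ker, char_eq_one_iff]
      intro v
      obtain ⟨c, hc⟩ := comp_scalarUnits (R := R) d v
      exact ⟨c, 1, one_mem _, by rw [mul_one, ← hc, hd]; rfl⟩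

/-- Prescribe the component `u` at the chosen primes dividing `N` and `1` elsewhere; finiteness of
the set of such primes makes this an idele. -/
theorem char_surjective : Function.Surjective L.char := by
  classical
  intro e
  obtain ⟨z, hz⟩ := exists_comp_eq (R := R) (fun v =>
    if h : v.asIdeal ∣ N then if Multiplicative.toAdd e ⟨v, h⟩ = 0 then 1 else (L.M v).u else 1) (by
    filter_upwards [L.finite.compl_mem_cofinite] with v hv
    rw [dif_neg (by simpa using hv)]
    exact one_mem _)
  have hzN : z ∈ hatNormalizer R := by
    rw [mem_hatNormalizer_iff]
    intro v
    rw [hz]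
    split_ifs
    · exact one_mem _
    · exact (L.M v).u_mem
    · exact one_mem _
  refine ⟨⟨z, hzN⟩, ?_⟩
  refine congrArg Multiplicative.ofAdd (funext fun v => ?_)
  by_cases h0 : Multiplicative.toAdd e v = 0
  · have h1 : comp R v z = 1 := by rw [hz, dif_pos v.2, if_pos h0]
    refine Eq.trans ?_ h0.symm
    refine congrArg Multiplicative.toAdd (L.localChar_eq_one_iff.2 ?_)
    change comp R v z ∈ scalarLocalUnits (HeightOneSpectrum.adicCompletion F v.1) _
    rw [h1]
    exact one_mem _
  · have h1 : comp R v z = (L.M v).u := by rw [hz, dif_pos v.2, if_neg h0]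
    have h2 : Multiplicative.toAdd e v = 1 := by
      have : ∀ a : ZMod 2, a ≠ 0 → a = 1 := by decide
      exact this _ h0
    refine Eq.trans ?_ h2.symm
    refine congrArg Multiplicative.toAdd (L.localChar_of_notMem ?_)
    change comp R v z ∉ scalarLocalUnits (HeightOneSpectrum.adicCompletion F v.1) _
    rw [h1]
    exact L.u_notMem v.2

/-- `Bil(R)` is an elementary abelian `2`-group. -/
def bilEquiv : Bil R ≃*
    Multiplicative ({v : HeightOneSpectrum (𝓞 F) // v.asIdeal ∣ N} → ZMod 2) :=
  (QuotientGroup.quotientMulEquivOfEq L.ker_char.symm).trans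
    (QuotientGroup.quotientKerEquivOfSurjective L.char L.char_surjective)

end LocalModels

end BilGroup

/-! ## Special points -/

section SpecialActions

open Filter

variable {F : Type*} [Field F] [NumberField F] {K : Type*} [Field K] [Algebra F K]
  {B : Type*} [Ring B] [Algebra F B] {R : Subalgebra (𝓞 F) B}
  [FiniteDimensional F K] [IsOrder R] (ι : IntegralEmbedding K R)

theorem comp_hatUnitsMap (a : (Hat (maxOrder F K))ˣ) (v : HeightOneSpectrum (𝓞 F)) :
    comp R v (ι.hatUnitsMap a) = ι.localUnitsMap v (comp (maxOrder F K) v a) := rfl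

theorem conj_localOrder_mem {x : (Hat R)ˣ} (hx : x ∈ specialSet ι) (v : HeightOneSpectrum (𝓞 F))
    {y : LocalAlg F K v} (hy : y ∈ localOrder (maxOrder F K) v) :
    (comp R v x : LocalAlg F B v) * ι.localMap v y * ((comp R v x)⁻¹ : (LocalAlg F B v)ˣ) ∈
      localOrder R v := by
  classical
  let Y : Hat (maxOrder F K) := ⟨fun w => if h : w = v then h ▸ y else 0, by
    filter_upwards [(Set.finite_singleton v).compl_mem_cofinite] with w hw
    rw [dif_neg (by simpa using hw)]
    exact zero_mem _⟩
  have hYv : Y v = y := by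
    change (if h : v = v then h ▸ y else 0) = y
    rw [dif_pos rfl]
  have hY : Y ∈ hatOrder (maxOrder F K) := by
    intro w
    by_cases hw : w = v
    · subst hw; rw [hYv]; exact hy
    · have : Y w = 0 := dif_neg hw
      rw [this]; exact zero_mem _
  have h := conj_hatOrder_mem ι hx hY v
  change (comp R v x : LocalAlg F B v) * ι.localMap v (Y v) *
    ((comp R v x)⁻¹ : (LocalAlg F B v)ˣ) ∈ localOrder R v at h
  rwa [hYv] at h

theorem mem_hatUnits_of_conj (q : QuatStr F B) {a : (Hat (maxOrder F K))ˣ} {x u : (Hat R)ˣ}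
    (hu : u ∈ hatUnits R) (h : x * ι.hatUnitsMap a = u * x) : a ∈ hatUnits (maxOrder F K) := by
  rw [mem_hatUnits_iff] at hu ⊢
  intro v
  refine mem_localUnits_of_conj ι q v (x := comp R v x) (hu v) ?_
  rw [← comp_hatUnitsMap, ← map_mul, h, map_mul]

theorem one_mem_specialSet : (1 : (Hat R)ˣ) ∈ specialSet ι := by
  intro a ha
  change ((1 : (Hat R)ˣ) : Hat R) * diag R (ι.toAlgHom a) * ((1⁻¹ : (Hat R)ˣ) : Hat R) ∈ hatOrder R
  rw [inv_one, Units.val_one, one_mul, mul_one]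
  exact fun v => one_tmul_mem_localOrder (ι.map_mem a ha) v

/-- The special point defined by an element of `X̃_D`. -/
def specialPoint (x : (Hat R)ˣ) (hx : x ∈ specialSet ι) : SpecialPoints ι :=
  Quotient.mk'' (s₁ := specialSetoid ι) ⟨x, hx⟩

theorem specialPoint_eq_iff {x y : (Hat R)ˣ} (hx : x ∈ specialSet ι) (hy : y ∈ specialSet ι) :
    specialPoint ι x hx = specialPoint ι y hy ↔ ∃ u ∈ hatUnits R, ∃ c : Kˣ,
      y = u * x * ι.hatUnitsMap (diagUnits (maxOrder F K) c) :=
  ⟨fun h => Quotient.exact (s := specialSetoid ι) h,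
    fun h => Quotient.sound (s := specialSetoid ι) h⟩

theorem exists_specialPoint_eq (p : SpecialPoints ι) : ∃ x hx, specialPoint ι x hx = p := by
  obtain ⟨x, rfl⟩ := Quotient.exists_rep (s := specialSetoid ι) p
  exact ⟨x, x.2, rfl⟩

theorem class_smul_specialPoint (a : (Hat (maxOrder F K))ˣ) {x : (Hat R)ˣ}
    (hx : x ∈ specialSet ι) : (QuotientGroup.mk a : ClassGp F K) • specialPoint ι x hx =
      specialPoint ι (x * ι.hatUnitsMap a) (mul_hatUnitsMap_mem ι hx a) := rfl

theorem normalizer_smul_specialPoint (z : hatNormalizer R) {x : (Hat R)ˣ}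
    (hx : x ∈ specialSet ι) : z • specialPoint ι x hx =
      specialPoint ι (z * x) (normalizer_mul_mem ι hx z) := rfl

/-- The class of a special point modulo `cl(K)`. -/
def specialClass (p : SpecialPoints ι) : SpecialClasses ι := Quotient.mk'' p

theorem specialClass_eq_iff {p p' : SpecialPoints ι} :
    specialClass ι p = specialClass ι p' ↔ ∃ a : ClassGp F K, a • p' = p :=
  ⟨fun h => Quotient.exact h, fun h => Quotient.sound h⟩

theorem bil_smul_specialClass (z : hatNormalizer R) (p : SpecialPoints ι) :
    (QuotientGroup.mk z : Bil R) • specialClass ι p = specialClass ι (z • p) := rfl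

/-- A fixed point gives `x (ac) x⁻¹` in `R̂ˣ` for some `c` in `Kˣ`. Then `ac` is locally integral
together with its inverse, so it is a unit of `𝓞̂_K` and the class of `a` is trivial. -/
theorem class_free (q : QuatStr F B) (c : ClassGp F K) (p : SpecialPoints ι) (h : c • p = p) :
    c = 1 := by
  obtain ⟨x, hx, rfl⟩ := exists_specialPoint_eq ι p
  induction c using QuotientGroup.induction_on with
  | H a =>
    rw [class_smul_specialPoint, specialPoint_eq_iff] at h
    obtain ⟨u, hu, c, h⟩ := h
    rw [QuotientGroup.eq_one_iff]
    have hmem : a * diagUnits (maxOrder F K) c ∈ hatUnits (maxOrder F K) := by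
      refine mem_hatUnits_of_conj ι q (x := x) (inv_mem hu) ?_
      rw [map_mul, eq_inv_mul_iff_mul_eq, ← mul_assoc, ← mul_assoc, mul_assoc u x]
      exact h.symm
    have : a = a * diagUnits (maxOrder F K) c * (diagUnits (maxOrder F K) c)⁻¹ := by
      rw [mul_inv_cancel_right]
    rw [this]
    exact mul_mem (Subgroup.mem_sup_left hmem) (Subgroup.mem_sup_right (inv_mem ⟨c, rfl⟩))

theorem basePoint_mem (n : hatNormalizer R) (a : (Hat (maxOrder F K))ˣ) :
    (n : (Hat R)ˣ) * ι.hatUnitsMap a ∈ specialSet ι := by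
  have := mul_hatUnitsMap_mem ι (one_mem_specialSet ι) a
  rw [one_mul] at this
  exact normalizer_mul_mem ι this n

/-- The special point defined by a pair of classes. -/
def basePoint (z : Bil R) (a : ClassGp F K) : SpecialPoints ι :=
  -- The inverse appears because translating `φ_x` by `z` gives `φ_{z⁻¹x}`; these are the points
  -- that occur in `ψ · z`.
  specialPoint ι (((z.out : hatNormalizer R)⁻¹ : hatNormalizer R) * ι.hatUnitsMap a.out)
    (basePoint_mem ι _ _)

theorem basePoint_eq (z : Bil R) (a : ClassGp F K) : basePoint ι z a =
    a • (z.out : hatNormalizer R)⁻¹ • specialPoint ι 1 (one_mem_specialSet ι) := by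
  conv_rhs => rw [← QuotientGroup.out_eq' a, normalizer_smul_specialPoint,
    class_smul_specialPoint]
  rw [basePoint]
  congr 1
  rw [mul_one]

theorem specialClass_basePoint (z : Bil R) (a : ClassGp F K) : specialClass ι (basePoint ι z a) =
    z⁻¹ • specialClass ι (specialPoint ι 1 (one_mem_specialSet ι)) := by
  conv_rhs => rw [← QuotientGroup.out_eq' z, ← QuotientGroup.mk_inv, bil_smul_specialClass]
  rw [basePoint_eq]
  exact (specialClass_eq_iff ι).2 ⟨a, rfl⟩

variable {ι}
variable {q : QuatStr F B} {N : Ideal (𝓞 F)} (L : LocalModels q R N)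
  {D : F} {δ : K} (hδ : δ ^ 2 = -algebraMap F K D) (hD : D ≠ 0)
  (hsc : ∀ c, algebraMap F K c ≠ δ)

include L hδ hD hsc

/-- `X̃_D = N(R̂) K̂ˣ`. -/
theorem exists_eq_mul_hatUnitsMap {x : (Hat R)ˣ} (hx : x ∈ specialSet ι) :
    ∃ n ∈ hatNormalizer R, ∃ κ : (Hat (maxOrder F K))ˣ, x = n * ι.hatUnitsMap κ := by
  have hloc : ∀ v, ∃ n ∈ localNormalizer (localOrder R v), ∃ κ : (LocalAlg F K v)ˣ,
      comp R v x = n * ι.localUnitsMap v κ ∧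
        (¬ v.asIdeal ∣ N → n ∈ localUnits (localOrder R v)) := by
    intro v
    obtain ⟨r, hr, κ, h | h⟩ := exists_local_decomp ι q v hδ hD hsc (L.M v)
      (fun y hy => conj_localOrder_mem ι hx v hy)
    · exact ⟨r, localUnits_le _ hr, κ, h, fun _ => hr⟩
    · exact ⟨r * (L.M v).u, mul_mem (localUnits_le _ hr) (L.M v).u_mem, κ, h, fun hv =>
        mul_mem hr ((L.M v).u_mem_localUnits ((L.isUnit_iff v).2 hv))⟩
  choose n hn κ hκ hnu using hloc
  -- Outside `N`, at almost all places, both `x` and the normalizing factor are local units, so the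
  -- component of `κ` is one too; the components therefore form an idele of `K`.
  obtain ⟨k, hk⟩ := exists_comp_eq (R := maxOrder F K) κ (by
    filter_upwards [L.finite.compl_mem_cofinite, eventually_comp_mem x] with v hv hxv
    refine mem_localUnits_of_conj ι q v (x := 1)
      (mul_mem (inv_mem (hnu v (by simpa using hv))) hxv) ?_
    rw [one_mul, mul_one, hκ, inv_mul_cancel_left])
  refine ⟨x * (ι.hatUnitsMap k)⁻¹, mem_hatNormalizer_iff.2 fun v => ?_, k,
    (inv_mul_cancel_right _ _).symm⟩
  rw [map_mul, map_inv, comp_hatUnitsMap, hk, hκ, mul_inv_cancel_right]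
  exact hn v

theorem exists_bil_smul_eq (p : SpecialClasses ι) :
    ∃ z : Bil R, z • specialClass ι (specialPoint ι 1 (one_mem_specialSet ι)) = p := by
  obtain ⟨p, rfl⟩ := Quotient.exists_rep p
  obtain ⟨x, hx, rfl⟩ := exists_specialPoint_eq ι p
  obtain ⟨n, hn, κ, rfl⟩ := exists_eq_mul_hatUnitsMap L hδ hD hsc hx
  refine ⟨QuotientGroup.mk ⟨n, hn⟩, ?_⟩
  rw [bil_smul_specialClass, normalizer_smul_specialPoint]
  refine Eq.symm ((specialClass_eq_iff ι).2 ⟨QuotientGroup.mk κ, ?_⟩)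
  rw [class_smul_specialPoint]
  congr 1
  rw [mul_one]

theorem bil_pretransitive : MulAction.IsPretransitive (Bil R) (SpecialClasses ι) where
  exists_smul_eq p p' := by
    obtain ⟨z, rfl⟩ := exists_bil_smul_eq L hδ hD hsc p
    obtain ⟨z', rfl⟩ := exists_bil_smul_eq L hδ hD hsc p'
    exact ⟨z' * z⁻¹, by rw [mul_smul, inv_smul_smul]⟩

/-- Writing `x = nκ`, a fixed class yields `zn = unb` with `u` in `R̂ˣ` and `b` in `K̂ˣ`, so `b`
normalizes `R̂`. At primes dividing `N` it centralizes an étale element of the order, elsewhere the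
normalizer is trivial modulo scalars and units. Hence `b` is everywhere a scalar times a unit, and
so is `z`. -/
theorem bil_free (hK : IntermediateField.adjoin F {δ} = ⊤)
    (hcop : IsCoprime (relDiscriminant F K) N) (z : Bil R) (p : SpecialClasses ι) (h : z • p = p) :
    z = 1 := by
  obtain ⟨p, rfl⟩ := Quotient.exists_rep p
  obtain ⟨x, hx, rfl⟩ := exists_specialPoint_eq ι p
  obtain ⟨n, hn, κ, rfl⟩ := exists_eq_mul_hatUnitsMap L hδ hD hsc hx
  obtain ⟨z, rfl⟩ := QuotientGroup.mk_surjective z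
  change (QuotientGroup.mk z : Bil R) • specialClass ι _ = specialClass ι _ at h
  rw [bil_smul_specialClass, normalizer_smul_specialPoint, specialClass_eq_iff] at h
  obtain ⟨a, h⟩ := h
  obtain ⟨a, rfl⟩ := QuotientGroup.mk_surjective a
  rw [class_smul_specialPoint, specialPoint_eq_iff] at h
  obtain ⟨u, hu, c, h⟩ := h
  set b := a * diagUnits (maxOrder F K) c
  have hb : (z : (Hat R)ˣ) * n = u * n * ι.hatUnitsMap b := by
    have e : ι.hatUnitsMap κ * ι.hatUnitsMap b = ι.hatUnitsMap b * ι.hatUnitsMap κ := by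
      rw [← map_mul, mul_comm, map_mul]
    have h2 : (z : (Hat R)ˣ) * n * ι.hatUnitsMap κ =
        u * n * ι.hatUnitsMap b * ι.hatUnitsMap κ := by
      rw [mul_assoc (u * n : (Hat R)ˣ), ← e, mul_assoc, h]
      simp only [b, map_mul, mul_assoc]
    exact mul_right_cancel h2
  have hbN : ι.hatUnitsMap b ∈ hatNormalizer R := by
    have : ι.hatUnitsMap b = n⁻¹ * u⁻¹ * (z * n) := by rw [hb]; group
    rw [this]
    exact mul_mem (mul_mem (inv_mem hn) (inv_mem (hatUnits_le hu))) (mul_mem z.2 hn)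
  have hbloc : ∀ v, comp R v (ι.hatUnitsMap b) ∈
      scalarLocalUnits (v.adicCompletion F) (localOrder R v) := by
    intro v
    have hbv := mem_hatNormalizer_iff.1 hbN v
    by_cases hv : v.asIdeal ∣ N
    · obtain ⟨g, hg, t, m, ht, hm, hu⟩ := exists_etale_of_isCoprime ι q v hδ hK hsc hcop hv
      refine exists_scalar_mul_unit (integralOn_localOrder v q R) (span_localOrder v R)
        (ι.localMap_mem v hg) ht hm hu hbv ?_
      change ι.localMap v _ * ι.localMap v g = ι.localMap v g * ι.localMap v _
      rw [← map_mul, mul_comm, map_mul]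
    · exact L.mem_scalarLocalUnits_of_not_dvd hv hbv
  rw [QuotientGroup.eq_one_iff, ← L.ker_char, MonoidHom.mem_ker, L.char_eq_one_iff]
  intro v
  have : (z : (Hat R)ˣ) = u * (n * ι.hatUnitsMap b * n⁻¹) := by
    rw [eq_comm, ← mul_assoc, ← mul_assoc, ← hb, mul_inv_cancel_right]
  rw [this, map_mul, map_mul, map_mul, map_inv]
  exact mul_mem (localUnits_le_scalarLocalUnits _ _ (mem_hatUnits_iff.1 hu v))
    (conj_mem_scalarLocalUnits (mem_hatNormalizer_iff.1 hn v) (hbloc v))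

/-- Freeness of `Bil(R)` on classes recovers `z`, freeness of `cl(K)` then recovers `a`, and
transitivity gives surjectivity. -/
theorem bijective_basePoint (hK : IntermediateField.adjoin F {δ} = ⊤)
    (hcop : IsCoprime (relDiscriminant F K) N) :
    Function.Bijective (fun p : Bil R × ClassGp F K => basePoint ι p.1 p.2) := by
  constructor
  · rintro ⟨z, a⟩ ⟨z', a'⟩ h
    change basePoint ι z a = basePoint ι z' a' at h
    have h1 := congrArg (specialClass ι) h
    rw [specialClass_basePoint, specialClass_basePoint] at h1
    have h2 : (z' * z⁻¹) • specialClass ι (specialPoint ι 1 (one_mem_specialSet ι)) =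
        specialClass ι (specialPoint ι 1 (one_mem_specialSet ι)) := by
      rw [mul_smul, h1, smul_inv_smul]
    have h3 := mul_inv_eq_one.1 (bil_free L hδ hD hsc hK hcop _ _ h2)
    subst h3
    rw [basePoint_eq, basePoint_eq] at h
    have h4 := inv_mul_eq_one.1 (class_free ι q (a'⁻¹ * a) _ (by
      rw [mul_smul, h, inv_smul_smul]))
    rw [h4]
  · intro p
    refine (exists_bil_smul_eq L hδ hD hsc (specialClass ι p)).elim fun z hz => ?_
    have h := specialClass_basePoint ι z⁻¹ 1
    rw [inv_inv, hz, basePoint_eq, one_smul] at h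
    refine ((specialClass_eq_iff ι).1 h.symm).elim fun a ha => ⟨(z⁻¹, a), ?_⟩
    rw [← ha]
    exact basePoint_eq ι z⁻¹ a

end SpecialActions

/-! ## The Fischer product -/

section Fischer

open MvPolynomial

variable {σ : Type*} [Fintype σ]

/-- The bilinear version of the Fischer product. -/
def fischerBil (P Q : MvPolynomial σ ℂ) : ℂ :=
  ∑ m ∈ P.support, P.coeff m * Q.coeff m * ∏ p, ((m p).factorial : ℂ)

theorem fischerBil_eq_sum {P : MvPolynomial σ ℂ} (Q : MvPolynomial σ ℂ) {s : Finset (σ →₀ ℕ)}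
    (h : P.support ⊆ s) :
    fischerBil P Q = ∑ m ∈ s, P.coeff m * Q.coeff m * ∏ p, ((m p).factorial : ℂ) :=
  Finset.sum_subset h fun m _ hm => by
    rw [notMem_support_iff.1 hm, zero_mul, zero_mul]

theorem fischerBil_comm (P Q : MvPolynomial σ ℂ) : fischerBil P Q = fischerBil Q P := by
  classical
  rw [fischerBil_eq_sum Q (Finset.subset_union_left (s₂ := Q.support)),
    fischerBil_eq_sum P (Finset.subset_union_right (s₁ := P.support))]
  exact Finset.sum_congr rfl fun m _ => by ring

theorem fischerBil_add_left (P P' Q : MvPolynomial σ ℂ) :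
    fischerBil (P + P') Q = fischerBil P Q + fischerBil P' Q := by
  classical
  rw [fischerBil_eq_sum Q (support_add (p := P) (q := P')),
    fischerBil_eq_sum Q (Finset.subset_union_left (s₂ := P'.support)),
    fischerBil_eq_sum Q (Finset.subset_union_right (s₁ := P.support)), ← Finset.sum_add_distrib]
  exact Finset.sum_congr rfl fun m _ => by rw [coeff_add]; ring

theorem fischerBil_smul_left (c : ℂ) (P Q : MvPolynomial σ ℂ) :
    fischerBil (c • P) Q = c * fischerBil P Q := by
  rw [fischerBil_eq_sum Q (support_smul (a := c) (f := P)), fischerBil, Finset.mul_sum]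
  exact Finset.sum_congr rfl fun m _ => by rw [coeff_smul, smul_eq_mul]; ring

theorem fischerBil_add_right (P Q Q' : MvPolynomial σ ℂ) :
    fischerBil P (Q + Q') = fischerBil P Q + fischerBil P Q' := by
  rw [fischerBil_comm, fischerBil_add_left, fischerBil_comm Q, fischerBil_comm Q']

theorem fischerBil_smul_right (c : ℂ) (P Q : MvPolynomial σ ℂ) :
    fischerBil P (c • Q) = c * fischerBil P Q := by
  rw [fischerBil_comm, fischerBil_smul_left, fischerBil_comm Q]

/-- The Fischer product as a bilinear form. -/
def fischerForm : MvPolynomial σ ℂ →ₗ[ℂ] MvPolynomial σ ℂ →ₗ[ℂ] ℂ :=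
  LinearMap.mk₂ ℂ fischerBil fischerBil_add_left fischerBil_smul_left fischerBil_add_right
    fischerBil_smul_right

theorem fischerForm_apply (P Q : MvPolynomial σ ℂ) : fischerForm P Q = fischerBil P Q := rfl

theorem fischerBil_monomial (m : σ →₀ ℕ) (c : ℂ) (Q : MvPolynomial σ ℂ) :
    fischerBil (monomial m c) Q = c * Q.coeff m * ∏ p, ((m p).factorial : ℂ) := by
  classical
  rw [fischerBil_eq_sum Q (support_monomial_subset (s := m) (a := c)), Finset.sum_singleton,
    coeff_monomial, if_pos rfl]

/-- Multiplication by a variable is adjoint to the derivative. -/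
theorem fischerBil_mul_X (P Q : MvPolynomial σ ℂ) (p : σ) :
    fischerBil (P * X p) Q = fischerBil P (pderiv p Q) := by
  classical
  induction P using MvPolynomial.induction_on' with
  | monomial m c =>
    have h : monomial m c * X p = monomial (m + Finsupp.single p 1) c := by
      rw [X, monomial_mul, mul_one]
    have hf : ∏ r, (((m + Finsupp.single p 1 : σ →₀ ℕ) r).factorial : ℂ) =
        (m p + 1) * ∏ r, ((m r).factorial : ℂ) := by
      rw [← Finset.mul_prod_erase _ _ (Finset.mem_univ p),
        ← Finset.mul_prod_erase (a := p) _ (fun r => ((m r).factorial : ℂ)) (Finset.mem_univ p),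
        ← mul_assoc]
      congr 1
      · rw [Finsupp.add_apply, Finsupp.single_eq_same, Nat.factorial_succ]; push_cast; ring
      · refine Finset.prod_congr rfl fun r hr => ?_
        rw [Finsupp.add_apply, Finsupp.single_eq_of_ne (Finset.ne_of_mem_erase hr), add_zero]
    rw [h, fischerBil_monomial, fischerBil_monomial, coeff_pderiv, hf]
    ring
  | add P P' hP hP' => rw [add_mul, fischerBil_add_left, hP, hP', fischerBil_add_left]

/-- Complex conjugation of the coefficients. -/
abbrev conjPoly (P : MvPolynomial σ ℂ) : MvPolynomial σ ℂ := map (starRingEnd ℂ) P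

theorem conjPoly_conjPoly (P : MvPolynomial σ ℂ) : conjPoly (conjPoly P) = P := by
  ext m; simp [conjPoly, coeff_map]

/-- The value is a sum of squared absolute values of coefficients with positive weights. -/
theorem eq_zero_of_fischerBil {P : MvPolynomial σ ℂ} (h : fischerBil P (conjPoly P) = 0) :
    P = 0 := by
  have h1 : fischerBil P (conjPoly P) =
      ((∑ m ∈ P.support, Complex.normSq (P.coeff m) * ∏ p, ((m p).factorial : ℝ) : ℝ) : ℂ) := by
    rw [fischerBil]
    push_cast
    exact Finset.sum_congr rfl fun m _ => by rw [coeff_map, Complex.mul_conj]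
  rw [h1, Complex.ofReal_eq_zero, Finset.sum_eq_zero_iff_of_nonneg
    (fun m _ => mul_nonneg (Complex.normSq_nonneg _) (Finset.prod_nonneg fun _ _ => by positivity))]
    at h
  ext m
  rw [coeff_zero]
  by_contra hm
  have h2 := h m (mem_support_iff.2 hm)
  refine mul_ne_zero (Complex.normSq_eq_zero.not.2 hm) ?_ h2
  exact Finset.prod_ne_zero_iff.2 fun p _ => by exact_mod_cast Nat.factorial_ne_zero _

end Fischer

/-! ### Linear substitutions -/

section Subst

open MvPolynomial

variable {T : Type*} [Fintype T] {n : Type*} [Fintype n]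

/-- The block-diagonal linear substitution defined by a family of matrices. -/
def linSubst (M : T → Matrix n n ℝ) : MvPolynomial (T × n) ℂ →ₐ[ℂ] MvPolynomial (T × n) ℂ :=
  aeval fun p => ∑ j, C ((M p.1 p.2 j : ℝ) : ℂ) * X (p.1, j)

theorem linSubst_X (M : T → Matrix n n ℝ) (p : T × n) :
    linSubst M (X p) = ∑ j, C ((M p.1 p.2 j : ℝ) : ℂ) * X (p.1, j) := aeval_X _ _

/-- Substitution reverses products of matrices, which is why `Bˣ` acts on the right. -/
theorem linSubst_linSubst (M M' : T → Matrix n n ℝ) (P : MvPolynomial (T × n) ℂ) :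
    linSubst M (linSubst M' P) = linSubst (M' * M) P := by
  have : (linSubst M).comp (linSubst M') = linSubst (M' * M) := by
    refine algHom_ext fun p => ?_
    rw [AlgHom.comp_apply, linSubst_X, linSubst_X, map_sum]
    simp only [map_mul, algHom_C, linSubst_X, Finset.mul_sum, Pi.mul_apply, Matrix.mul_apply]
    rw [Finset.sum_comm]
    refine Finset.sum_congr rfl fun j _ => ?_
    push_cast
    rw [map_sum, Finset.sum_mul]
    exact Finset.sum_congr rfl fun i _ => by rw [map_mul, mul_assoc]; rfl
  rw [← this]; rfl

theorem linSubst_one [DecidableEq n] (P : MvPolynomial (T × n) ℂ) :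
    linSubst (1 : T → Matrix n n ℝ) P = P := by
  have : linSubst (1 : T → Matrix n n ℝ) = AlgHom.id ℂ _ := by
    refine algHom_ext fun p => ?_
    rw [linSubst_X, Finset.sum_eq_single p.2]
    · simp
    · intro j _ hj; simp [Matrix.one_apply_ne hj.symm]
    · simp
  rw [this]; rfl

theorem conjPoly_linSubst (M : T → Matrix n n ℝ) (P : MvPolynomial (T × n) ℂ) :
    conjPoly (linSubst M P) = linSubst M (conjPoly P) := by
  induction P using MvPolynomial.induction_on with
  | C a => simp [conjPoly, algHom_C, algebraMap_eq]
  | add P Q hP hQ => simp only [conjPoly, map_add] at *; rw [hP, hQ]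
  | mul_X P p hP =>
    simp only [conjPoly, map_mul] at *
    rw [hP]
    congr 1
    simp only [linSubst_X, map_sum, map_mul, map_X, map_C, Complex.conj_ofReal]

/-- The chain rule. -/
theorem pderiv_linSubst (M : T → Matrix n n ℝ) (P : MvPolynomial (T × n) ℂ) (τ : T) (i : n) :
    pderiv (τ, i) (linSubst M P) =
      ∑ j, C ((M τ j i : ℝ) : ℂ) * linSubst M (pderiv (τ, j) P) := by
  classical
  induction P using MvPolynomial.induction_on with
  | C a => simp [algHom_C, algebraMap_eq]
  | add P Q hP hQ => simp only [map_add, hP, hQ, mul_add, Finset.sum_add_distrib]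
  | mul_X P p hP =>
    have hX : pderiv (τ, i) (linSubst M (X p)) =
        ∑ j, C ((M τ j i : ℝ) : ℂ) * linSubst M (pderiv (τ, j) (X p)) := by
      obtain ⟨τ', l⟩ := p
      simp only [linSubst_X, map_sum, Derivation.leibniz, pderiv_C, pderiv_X, smul_zero, add_zero,
        smul_eq_mul]
      by_cases hτ : τ' = τ
      · subst hτ
        rw [Finset.sum_eq_single i, Finset.sum_eq_single l]
        · simp
        · intro j _ hj
          rw [Pi.single_eq_of_ne (by simp [hj.symm]), map_zero, mul_zero]
        · simp
        · intro j _ hj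
          rw [Pi.single_eq_of_ne (by simp [hj]), mul_zero, mul_zero, add_zero]
        · simp
      · rw [Finset.sum_eq_zero, Finset.sum_eq_zero]
        · intro j _
          rw [Pi.single_eq_of_ne (by simp [hτ]), map_zero, mul_zero]
        · intro j _
          rw [Pi.single_eq_of_ne (by simp [hτ]), mul_zero, mul_zero, add_zero]
    have hj : ∀ j, C ((M τ j i : ℝ) : ℂ) * linSubst M (pderiv (τ, j) (P * X p)) =
        C ((M τ j i : ℝ) : ℂ) * linSubst M (pderiv (τ, j) P) * linSubst M (X p) +
          linSubst M P * (C ((M τ j i : ℝ) : ℂ) * linSubst M (pderiv (τ, j) (X p))) := fun j => by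
      rw [pderiv_mul, map_add, map_mul, map_mul]
      ring
    rw [map_mul, pderiv_mul, hP, hX, Finset.sum_congr rfl fun j _ => hj j, Finset.sum_add_distrib,
      Finset.sum_mul, Finset.mul_sum]

/-- The adjoint of a substitution is the transposed substitution. -/
theorem fischerBil_linSubst (M : T → Matrix n n ℝ) (P Q : MvPolynomial (T × n) ℂ) :
    fischerBil (linSubst M P) Q = fischerBil P (linSubst (fun τ => (M τ).transpose) Q) := by
  induction P using MvPolynomial.induction_on generalizing Q with
  | C a =>
    have hc : coeff 0 (linSubst (fun τ => (M τ).transpose) Q) = coeff 0 Q := by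
      induction Q using MvPolynomial.induction_on with
      | C a => simp [algHom_C, algebraMap_eq]
      | add P Q hP hQ => rw [map_add, coeff_add, hP, hQ, coeff_add]
      | mul_X P p hP =>
        change constantCoeff _ = constantCoeff _
        rw [map_mul, map_mul, map_mul, linSubst_X]
        simp
    rw [algHom_C, algebraMap_eq, C_apply, fischerBil_monomial, fischerBil_monomial, hc]
  | add P P' hP hP' => rw [map_add, fischerBil_add_left, hP, hP', fischerBil_add_left]
  | mul_X P p hP =>
    obtain ⟨τ, i⟩ := p
    -- Induction on `P`: multiplication by a variable is adjoint to the derivative, and the chain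
    -- rule on one side produces the transposed coefficients on the other.
    rw [fischerBil_mul_X, pderiv_linSubst, map_mul, linSubst_X, Finset.mul_sum]
    have h1 : ∀ s : Finset n, ∀ f : n → MvPolynomial (T × n) ℂ,
        fischerBil (∑ j ∈ s, f j) Q = ∑ j ∈ s, fischerBil (f j) Q := fun s f => by
      rw [← fischerForm_apply, map_sum, LinearMap.sum_apply]; rfl
    have h2 : ∀ s : Finset n, ∀ f : n → MvPolynomial (T × n) ℂ,
        fischerBil P (∑ j ∈ s, f j) = ∑ j ∈ s, fischerBil P (f j) := fun s f => by
      rw [← fischerForm_apply, map_sum]; rfl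
    rw [h1, h2]
    refine Finset.sum_congr rfl fun j _ => ?_
    rw [mul_left_comm, ← smul_eq_C_mul, fischerBil_smul_left, fischerBil_mul_X, hP,
      ← smul_eq_C_mul, fischerBil_smul_right]
    rfl

theorem euler_linSubst (M : T → Matrix n n ℝ) (P : MvPolynomial (T × n) ℂ) (τ : T) :
    ∑ i, X (τ, i) * pderiv (τ, i) (linSubst M P) =
      linSubst M (∑ i, X (τ, i) * pderiv (τ, i) P) := by
  simp only [pderiv_linSubst, Finset.mul_sum, map_sum, map_mul, linSubst_X, Finset.sum_mul]
  rw [Finset.sum_comm]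
  exact Finset.sum_congr rfl fun j _ => Finset.sum_congr rfl fun i _ => by ring

/-- Two applications of the chain rule leave the entries of `M Mᵀ` as coefficients, so orthogonality
is exactly what is required. -/
theorem laplace_linSubst [DecidableEq n] {M : T → Matrix n n ℝ} {τ : T}
    (hM : M τ * (M τ).transpose = 1) (P : MvPolynomial (T × n) ℂ) :
    ∑ i, pderiv (τ, i) (pderiv (τ, i) (linSubst M P)) =
      linSubst M (∑ i, pderiv (τ, i) (pderiv (τ, i) P)) := by
  have h1 : ∀ i, pderiv (τ, i) (pderiv (τ, i) (linSubst M P)) =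
      ∑ j, ∑ l, C ((M τ j i * M τ l i : ℝ) : ℂ) *
        linSubst M (pderiv (τ, l) (pderiv (τ, j) P)) := by
    intro i
    rw [pderiv_linSubst, map_sum]
    refine Finset.sum_congr rfl fun j _ => ?_
    rw [Derivation.leibniz, pderiv_C, smul_zero, add_zero, smul_eq_mul, pderiv_linSubst,
      Finset.mul_sum]
    refine Finset.sum_congr rfl fun l _ => ?_
    rw [Complex.ofReal_mul, map_mul, mul_assoc]
  simp only [h1]
  rw [Finset.sum_comm, map_sum]
  refine Finset.sum_congr rfl fun j _ => ?_
  rw [Finset.sum_comm]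
  have h2 : ∀ l, ∑ i, M τ j i * M τ l i = if j = l then 1 else 0 := fun l => by
    have := congrFun (congrFun hM j) l
    rw [Matrix.mul_apply, Matrix.one_apply] at this
    simpa using this
  have h3 : ∀ l, ∑ i, C ((M τ j i * M τ l i : ℝ) : ℂ) *
      linSubst M (pderiv (τ, l) (pderiv (τ, j) P)) =
      if j = l then linSubst M (pderiv (τ, l) (pderiv (τ, j) P)) else 0 := by
    intro l
    rw [← Finset.sum_mul, ← map_sum, ← Complex.ofReal_sum, h2]
    split_ifs <;> simp
  simp only [h3]
  rw [Finset.sum_ite_eq]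
  simp

theorem eval_linSubst (M : T → Matrix n n ℝ) (P : MvPolynomial (T × n) ℂ) (x : T × n → ℂ) :
    eval x (linSubst M P) = eval (fun p => ∑ j, ((M p.1 p.2 j : ℝ) : ℂ) * x (p.1, j)) P := by
  induction P using MvPolynomial.induction_on with
  | C a => simp [algHom_C, algebraMap_eq]
  | add P Q hP hQ => simp only [map_add, hP, hQ]
  | mul_X P p hP => simp only [map_mul, hP, linSubst_X, map_sum, eval_C, eval_X]

/-- Homogeneity in a group of variables is Euler's identity. -/
theorem forall_mem_support_iff_euler (P : MvPolynomial (T × n) ℂ) (τ : T) (d : ℕ) :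
    (∀ m ∈ P.support, ∑ i, m (τ, i) = d) ↔
      ∑ i, X (τ, i) * pderiv (τ, i) P = (d : ℂ) • P := by
  have hcoeff : ∀ (p : T × n) (m), coeff m (X p * pderiv p P) = (m p : ℂ) * coeff m P := by
    intro p m
    induction P using MvPolynomial.induction_on' with
    | monomial u a =>
      classical
      rw [X_mul_pderiv_monomial, coeff_smul, coeff_monomial, nsmul_eq_mul]
      split_ifs with h
      · rw [h]
      · simp
    | add P Q hP hQ => rw [map_add, mul_add, coeff_add, hP, hQ, coeff_add, mul_add]
  constructor
  · intro h
    ext m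
    rw [coeff_sum, coeff_smul, smul_eq_mul]
    simp only [hcoeff]
    rw [← Finset.sum_mul]
    by_cases hm : m ∈ P.support
    · rw [← h m hm]; push_cast; rfl
    · rw [notMem_support_iff.1 hm, mul_zero, mul_zero]
  · intro h m hm
    have := congrArg (coeff m) h
    rw [coeff_sum, coeff_smul, smul_eq_mul] at this
    simp only [hcoeff] at this
    rw [← Finset.sum_mul] at this
    exact_mod_cast mul_right_cancel₀ (mem_support_iff.1 hm) this

end Subst

/-! ## The representation on harmonic polynomials -/

section Rotation

theorem coord_add (p q : ℍ[ℝ]) (i : Fin 3) : coord (p + q) i = coord p i + coord q i := by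
  fin_cases i <;> simp [coord, mul_add]

theorem coord_smul (c : ℝ) (q : ℍ[ℝ]) (i : Fin 3) : coord (c • q) i = c * coord q i := by
  fin_cases i <;> simp [coord, mul_left_comm]

@[simp] theorem halfBasis_re (l : Fin 3) : (halfBasis l).re = 0 := by fin_cases l <;> rfl

@[simp] theorem halfBasis_imI (l : Fin 3) : (halfBasis l).imI = if l = 0 then 1 / 2 else 0 := by
  fin_cases l <;> rfl

@[simp] theorem halfBasis_imJ (l : Fin 3) : (halfBasis l).imJ = if l = 1 then 1 / 2 else 0 := by
  fin_cases l <;> rfl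

@[simp] theorem halfBasis_imK (l : Fin 3) : (halfBasis l).imK = if l = 2 then 1 / 2 else 0 := by
  fin_cases l <;> rfl

theorem eq_re_add_sum_coord (q : ℍ[ℝ]) :
    q = q.re • (1 : ℍ[ℝ]) + ((coord q 0) • halfBasis 0 + (coord q 1) • halfBasis 1 +
      (coord q 2) • halfBasis 2) := by
  ext <;> simp [coord] <;> ring

/-- The matrix of a conjugation acts on coordinates as the conjugation itself. -/
theorem sum_coord_conj {p r : ℍ[ℝ]} (h : p * r = 1) (q : ℍ[ℝ]) (i : Fin 3) :
    ∑ l, coord (p * halfBasis l * r) i * coord q l = coord (p * q * r) i := by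
  have h1 : coord (1 : ℍ[ℝ]) i = 0 := by fin_cases i <;> simp [coord]
  conv_rhs => rw [eq_re_add_sum_coord q]
  simp only [mul_add, add_mul, mul_smul_comm, smul_mul_assoc, coord_add, coord_smul, mul_one, h, h1,
    Fin.sum_univ_three]
  ring

theorem coord_conj_star (p : ℍ[ℝ]) (i j : Fin 3) :
    coord (p * halfBasis j * star p) i = coord (star p * halfBasis i * p) j := by
  fin_cases i <;> fin_cases j <;> simp [coord] <;> ring

/-- The inverse of `p` is its conjugate divided by a real number, which factors out of both sides.
-/
theorem coord_conj_inv {p r : ℍ[ℝ]} (h : p * r = 1) (i j : Fin 3) :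
    coord (p * halfBasis j * r) i = coord (r * halfBasis i * p) j := by
  obtain rfl : r = p⁻¹ := eq_inv_of_mul_eq_one_right h
  rw [Quaternion.inv_def, mul_smul_comm, smul_mul_assoc, smul_mul_assoc, coord_smul, coord_smul,
    coord_conj_star]

theorem coord_halfBasis (i j : Fin 3) : coord (halfBasis j) i = if i = j then 1 else 0 := by
  fin_cases i <;> fin_cases j <;> simp [coord]

end Rotation

/-! ### Invariance of the inner product, stability of `V_𝐤`, and the polynomial representing
evaluation. -/

section Harmonic

open MvPolynomial

variable {F : Type*} [Field F] [NumberField F] {B : Type*} [Ring B] [Algebra F B]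
  (θ : HamiltonIdent F B)

theorem emb_mul_emb_inv (γ : Bˣ) (τ : F →+* ℝ) :
    θ.emb τ γ * θ.emb τ ((γ⁻¹ : Bˣ) : B) = 1 := by
  rw [← map_mul, Units.mul_inv, map_one]

theorem emb_inv_mul_emb (γ : Bˣ) (τ : F →+* ℝ) :
    θ.emb τ ((γ⁻¹ : Bˣ) : B) * θ.emb τ γ = 1 := by
  rw [← map_mul, Units.inv_mul, map_one]

theorem conjMatrix_mul (γ γ' : Bˣ) : conjMatrix θ (γ * γ') = conjMatrix θ γ * conjMatrix θ γ' := by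
  funext τ
  ext i j
  rw [Pi.mul_apply, Matrix.mul_apply]
  simp only [conjMatrix, Matrix.of_apply]
  rw [sum_coord_conj (emb_mul_emb_inv θ γ τ), mul_inv_rev, Units.val_mul, Units.val_mul, map_mul,
    map_mul]
  simp only [mul_assoc]

theorem conjMatrix_one : conjMatrix θ (1 : Bˣ) = 1 := by
  funext τ
  ext i j
  rw [Pi.one_apply, Matrix.one_apply]
  simp [conjMatrix, coord_halfBasis]

theorem conjMatrix_inv (γ : Bˣ) (τ : F →+* ℝ) :
    conjMatrix θ γ⁻¹ τ = (conjMatrix θ γ τ).transpose := by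
  ext i j
  rw [Matrix.transpose_apply]
  simp only [conjMatrix, Matrix.of_apply, inv_inv]
  exact coord_conj_inv (emb_inv_mul_emb θ γ τ) i j

theorem conjMatrix_mul_transpose (γ : Bˣ) (τ : F →+* ℝ) :
    conjMatrix θ γ τ * (conjMatrix θ γ τ).transpose = 1 := by
  rw [← conjMatrix_inv, ← Pi.mul_apply, ← conjMatrix_mul, mul_inv_cancel, conjMatrix_one,
    Pi.one_apply]

theorem act_eq_linSubst (γ : Bˣ) : act θ γ = linSubst (conjMatrix θ γ) := rfl

theorem act_mul (γ γ' : Bˣ) (P : WPoly F) : act θ (γ * γ') P = act θ γ' (act θ γ P) := by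
  rw [act_eq_linSubst, act_eq_linSubst, act_eq_linSubst, linSubst_linSubst, conjMatrix_mul]

theorem act_one (P : WPoly F) : act θ (1 : Bˣ) P = P := by
  rw [act_eq_linSubst, conjMatrix_one, linSubst_one]

theorem fischer_eq_fischerBil (P Q : WPoly F) : fischer P Q = fischerBil P (conjPoly Q) :=
  Finset.sum_congr rfl fun m _ => by rw [coeff_map]

/-- The inner product is invariant under `Bˣ`. -/
theorem fischer_act (γ : Bˣ) (P Q : WPoly F) : fischer (act θ γ P) (act θ γ Q) = fischer P Q := by
  have h : (fun τ => (conjMatrix θ γ τ).transpose) = conjMatrix θ γ⁻¹ :=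
    funext fun τ => (conjMatrix_inv θ γ τ).symm
  rw [fischer_eq_fischerBil, fischer_eq_fischerBil, act_eq_linSubst, conjPoly_linSubst,
    fischerBil_linSubst, h, linSubst_linSubst, ← conjMatrix_mul, mul_inv_cancel, conjMatrix_one,
    linSubst_one]

theorem fischer_act_left (γ : Bˣ) (P Q : WPoly F) :
    fischer P (act θ γ Q) = fischer (act θ γ⁻¹ P) Q := by
  conv_rhs => rw [← fischer_act θ γ, ← act_mul, inv_mul_cancel, act_one]

theorem fischer_sum_right {ι : Type*} (s : Finset ι) (P : WPoly F) (f : ι → WPoly F) :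
    fischer P (∑ i ∈ s, f i) = ∑ i ∈ s, fischer P (f i) := by
  simp only [fischer_eq_fischerBil, ← fischerForm_apply, conjPoly, map_sum]

theorem fischer_zero_right (P : WPoly F) : fischer P 0 = 0 := by
  rw [fischer_eq_fischerBil, conjPoly, map_zero, ← fischerForm_apply, map_zero]

/-- Homogeneity is rewritten with the Euler operator, so that `V_𝐤` is cut out by operators
commuting with orthogonal substitutions. -/
theorem mem_V_iff (k : (F →+* ℝ) → ℕ) (P : WPoly F) :
    P ∈ V k ↔ ∀ τ, ∑ i, X (τ, i) * pderiv (τ, i) P = (k τ : ℂ) • P ∧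
      ∑ i, pderiv (τ, i) (pderiv (τ, i) P) = 0 :=
  forall_congr' fun τ => and_congr_left' (forall_mem_support_iff_euler P τ (k τ))

/-- `V_𝐤` is stable under `Bˣ`. -/
theorem act_mem_V {k : (F →+* ℝ) → ℕ} {P : WPoly F} (hP : P ∈ V k) (γ : Bˣ) : act θ γ P ∈ V k := by
  rw [mem_V_iff] at hP ⊢
  intro τ
  rw [act_eq_linSubst, euler_linSubst, laplace_linSubst (conjMatrix_mul_transpose θ γ τ),
    (hP τ).1, (hP τ).2, map_smul, map_zero]
  exact ⟨rfl, rfl⟩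

/-- `V_𝐤` is stable under complex conjugation. -/
theorem conjPoly_mem_V {k : (F →+* ℝ) → ℕ} {P : WPoly F} (hP : P ∈ V k) : conjPoly P ∈ V k := by
  intro τ
  refine ⟨fun m hm => (hP τ).1 m (support_map_subset _ _ hm), ?_⟩
  simp only [conjPoly, pderiv_map]
  rw [← map_sum, (hP τ).2, map_zero]

instance finiteDimensional_V (k : (F →+* ℝ) → ℕ) : FiniteDimensional ℂ (V k) := by
  have hle : V k ≤ restrictTotalDegree ((F →+* ℝ) × Fin 3) ℂ (∑ τ, k τ) := by
    intro P hP
    rw [mem_restrictTotalDegree, totalDegree]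
    refine Finset.sup_le fun m hm => ?_
    rw [Finsupp.sum_fintype _ _ (fun _ => rfl), Fintype.sum_prod_type]
    exact (Finset.sum_le_sum fun τ _ => ((hP τ).1 m hm).le)
  exact Submodule.finiteDimensional_of_le hle

theorem evalAt_act (γ : Bˣ) (b : B) (P : WPoly F) :
    evalAt θ b (act θ γ P) = evalAt θ (γ * b * ((γ⁻¹ : Bˣ) : B)) P := by
  rw [evalAt, evalAt, act_eq_linSubst, eval_linSubst]
  congr 2
  funext p
  rw [map_mul, map_mul, ← sum_coord_conj (emb_mul_emb_inv θ γ p.1)]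
  push_cast
  rfl

theorem eq_of_fischer_eq {k : (F →+* ℝ) → ℕ} {Q Q' : WPoly F} (hQ : Q ∈ V k) (hQ' : Q' ∈ V k)
    (h : ∀ P ∈ V k, fischer P Q = fischer P Q') : Q = Q' := by
  rw [← sub_eq_zero]
  apply eq_zero_of_fischerBil
  have := h _ (sub_mem hQ hQ')
  rw [fischer_eq_fischerBil, fischer_eq_fischerBil, ← fischerForm_apply, ← fischerForm_apply,
    ← sub_eq_zero, ← map_sub] at this
  rwa [conjPoly, map_sub]

/-- Existence and uniqueness of the Gegenbauer polynomial at a point. -/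
theorem existsUnique_isGegenbauer (k : (F →+* ℝ) → ℕ) (b : B) :
    ∃! PD : WPoly F, IsGegenbauer θ k b PD := by
  -- The restricted bilinear form is nondegenerate because `V_𝐤` contains the conjugate of each of
  -- its elements. In finite dimension it represents every functional, and conjugating the
  -- representative passes to the Hermitian product.
  let Ψ : V k →ₗ[ℂ] Module.Dual ℂ (V k) := fischerForm.domRestrict₁₂ (V k) (V k)
  have hinj : Function.Injective Ψ := by
    rw [injective_iff_map_eq_zero]
    intro P hP
    refine Subtype.ext (eq_zero_of_fischerBil ?_)
    exact LinearMap.congr_fun hP ⟨_, conjPoly_mem_V P.2⟩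
  have hsurj : Function.Surjective Ψ :=
    (LinearMap.injective_iff_surjective_of_finrank_eq_finrank
      (Subspace.dual_finrank_eq (K := ℂ) (V := V k)).symm).1 hinj
  let ev : Module.Dual ℂ (V k) :=
    (aeval (R := ℂ) (fun p : (F →+* ℝ) × Fin 3 =>
      ((coord (θ.emb p.1 b) p.2 : ℝ) : ℂ))).toLinearMap.comp (V k).subtype
  obtain ⟨Q, hQ⟩ := hsurj ev
  refine ⟨conjPoly (Q : WPoly F), ⟨conjPoly_mem_V Q.2, fun P hP => ?_⟩, fun Q' hQ' => ?_⟩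
  · rw [fischer_eq_fischerBil, conjPoly_conjPoly, fischerBil_comm]
    exact (LinearMap.congr_fun hQ ⟨P, hP⟩).symm
  · refine eq_of_fischer_eq hQ'.1 (conjPoly_mem_V Q.2) fun P hP => ?_
    rw [← hQ'.2 P hP, fischer_eq_fischerBil, conjPoly_conjPoly, fischerBil_comm]
    exact (LinearMap.congr_fun hQ ⟨P, hP⟩).symm

/-- The Gegenbauer polynomial at a point is fixed by the stabiliser of the point. -/
theorem IsGegenbauer.act_eq {θ : HamiltonIdent F B} {k : (F →+* ℝ) → ℕ} {b : B} {PD : WPoly F}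
    (h : IsGegenbauer θ k b PD) {γ : Bˣ} (hγ : γ * b = b * γ) : act θ γ PD = PD := by
  refine eq_of_fischer_eq (act_mem_V θ h.1 γ) h.1 fun P hP => ?_
  rw [fischer_act_left, ← h.2 _ (act_mem_V θ hP _), ← h.2 P hP, evalAt_act, inv_inv, mul_assoc,
    ← hγ, Units.inv_mul_cancel_left]

end Harmonic

/-! ## Forms with minimal support -/

section MinimalSupport

variable {F : Type*} [Field F] [NumberField F] {B : Type*} [Ring B] [Algebra F B]
  {R : Subalgebra (𝓞 F) B} [IsOrder R] (θ : HamiltonIdent F B) (k : (F →+* ℝ) → ℕ)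

theorem conj_mem_hatUnits_iff {w : (Hat R)ˣ} (hw : w ∈ hatNormalizer R) (u : (Hat R)ˣ) :
    w * u * w⁻¹ ∈ hatUnits R ↔ u ∈ hatUnits R := by
  have h : ∀ {w : (Hat R)ˣ}, w ∈ hatNormalizer R → ∀ {u}, u ∈ hatUnits R →
      w * u * w⁻¹ ∈ hatUnits R := fun {w} hw {u} hu =>
    (hatUnits_normal R).conj_mem ⟨u, hatUnits_le hu⟩ hu ⟨w, hw⟩
  refine ⟨fun hu => ?_, h hw⟩
  have := h (inv_mem hw) hu
  simpa [mul_assoc] using this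

theorem Gam_mul_right {w : (Hat R)ˣ} (hw : w ∈ hatNormalizer R) (x y : (Hat R)ˣ) :
    Gam R x (w * y) = Gam R (w⁻¹ * x) y := by
  ext g
  refine exists_congr fun γ => and_congr_right fun _ => ?_
  rw [← conj_mem_hatUnits_iff (inv_mem hw)]
  simp only [mul_inv_rev, inv_inv, mul_assoc, inv_mul_cancel, mul_one]

theorem Gam_mul_left {u : (Hat R)ˣ} (hu : u ∈ hatUnits R) (x y : (Hat R)ˣ) :
    Gam R (u * x) y = Gam R x y := by
  ext g
  refine exists_congr fun γ => and_congr_right fun _ => ?_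
  rw [mul_assoc u, mul_assoc u, Subgroup.mul_mem_cancel_left _ hu]

instance scalarRange_normal :
    (Units.map (algebraMap (𝓞 F) B : 𝓞 F →* B)).range.Normal where
  conj_mem := by
    rintro _ ⟨u, rfl⟩ γ
    have : γ * Units.map (algebraMap (𝓞 F) B : 𝓞 F →* B) u * γ⁻¹ =
        Units.map (algebraMap (𝓞 F) B : 𝓞 F →* B) u :=
      mul_inv_eq_iff_eq_mul.2 (Units.ext (Algebra.commutes (u : 𝓞 F) (γ : B)).symm)
    rw [this]
    exact ⟨u, rfl⟩

theorem mem_Gam_mul_diag_iff (γ : Bˣ) (x y : (Hat R)ˣ) (g : UnitsModScalars F B) :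
    g ∈ Gam R (x * diagUnits R γ) y ↔ (γ : UnitsModScalars F B) * g ∈ Gam R x y := by
  constructor
  · rintro ⟨β, rfl, h⟩
    refine ⟨γ * β, rfl, ?_⟩
    rwa [map_mul, ← mul_assoc x]
  · rintro ⟨β, hβ, h⟩
    refine ⟨γ⁻¹ * β, by rw [QuotientGroup.mk_mul, hβ, QuotientGroup.mk_inv, inv_mul_cancel_left], ?_⟩
    rwa [map_mul, map_inv, mul_assoc x, mul_inv_cancel_left]

theorem mem_Gam_diag_iff (γ : Bˣ) (x y : (Hat R)ˣ) (g : UnitsModScalars F B) :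
    g * (γ : UnitsModScalars F B) ∈ Gam R x (y * diagUnits R γ) ↔ g ∈ Gam R x y := by
  constructor
  · rintro ⟨β, hβ, h⟩
    refine ⟨β * γ⁻¹, by rw [QuotientGroup.mk_mul, hβ, QuotientGroup.mk_inv,
      mul_inv_cancel_right], ?_⟩
    rw [mul_inv_rev] at h
    rwa [map_mul, map_inv, ← mul_assoc x, mul_assoc _ _ y⁻¹]
  · rintro ⟨β, rfl, h⟩
    refine ⟨β * γ, rfl, ?_⟩
    rwa [map_mul, mul_inv_rev, mul_assoc, mul_assoc, mul_inv_cancel_left, ← mul_assoc]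

theorem wt_normalizer_mul {w : (Hat R)ˣ} (hw : w ∈ hatNormalizer R) (x : (Hat R)ˣ) :
    wt R (w * x) = wt R x := by
  rw [wt, wt, Gam_mul_right hw, inv_mul_cancel_left]

theorem wt_mul_diag (x : (Hat R)ˣ) (γ : Bˣ) : wt R (x * diagUnits R γ) = wt R x := by
  refine Nat.card_congr (Equiv.subtypeEquiv
    (MulAut.conj (γ : UnitsModScalars F B)).toEquiv fun g => ?_)
  have h := mem_Gam_diag_iff γ x x
    ((γ : UnitsModScalars F B) * g * (γ : UnitsModScalars F B)⁻¹)
  rw [inv_mul_cancel_right] at h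
  exact (mem_Gam_mul_diag_iff γ x (x * diagUnits R γ) g).trans h

theorem actMod_mul_left (v : WPoly F) (γ : Bˣ) (g : UnitsModScalars F B) :
    actMod θ v ((γ : UnitsModScalars F B) * g) = actMod θ (act θ γ v) g := by
  induction g using QuotientGroup.induction_on with
  | H β => exact act_mul θ γ β v

theorem actMod_mul_right (v : WPoly F) (γ : Bˣ) (g : UnitsModScalars F B) :
    actMod θ v (g * (γ : UnitsModScalars F B)) = act θ γ (actMod θ v g) := by
  induction g using QuotientGroup.induction_on with
  | H β => exact act_mul θ β γ v

theorem act_injective (γ : Bˣ) : Function.Injective (act θ γ) := fun P Q h => by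
  have := congrArg (act θ γ⁻¹) h
  rwa [← act_mul, ← act_mul, mul_inv_cancel, act_one, act_one] at this

theorem phi_normalizer_mul {w : (Hat R)ˣ} (hw : w ∈ hatNormalizer R) (x y : (Hat R)ˣ)
    (v : WPoly F) : phi R θ x v (w * y) = phi R θ (w⁻¹ * x) v y := by
  rw [phi, phi, Gam_mul_right hw]

theorem phi_unit_mul {u : (Hat R)ˣ} (hu : u ∈ hatUnits R) (x : (Hat R)ˣ) (v : WPoly F) :
    phi R θ (u * x) v = phi R θ x v := by
  funext y
  rw [phi, phi, Gam_mul_left hu]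

theorem phi_mul_diag (x : (Hat R)ˣ) (γ : Bˣ) (v : WPoly F) :
    phi R θ (x * diagUnits R γ) (act θ γ v) = phi R θ x v := by
  funext y
  refine finsum_eq_of_bijective (Equiv.subtypeEquiv (Equiv.mulLeft (γ : UnitsModScalars F B))
    (mem_Gam_mul_diag_iff γ x y)) (Equiv.bijective _) fun g => ?_
  exact (actMod_mul_left θ v γ g).symm

theorem phi_apply_mul_diag (x y : (Hat R)ˣ) (γ : Bˣ) (v : WPoly F) :
    phi R θ x v (y * diagUnits R γ) = act θ γ (phi R θ x v y) := by
  -- Injectivity of the action lets it pass through the sum without knowing that `Γ_{x,y}` is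
  -- finite.
  refine ((AddMonoidHom.map_finsum_of_injective (act θ γ : WPoly F →+ WPoly F)
    (act_injective θ γ) fun g : Gam R x y => actMod θ v (g : UnitsModScalars F B)).trans ?_).symm
  refine finsum_eq_of_bijective (Equiv.subtypeEquiv (Equiv.mulRight (γ : UnitsModScalars F B))
    fun g => (mem_Gam_diag_iff γ x y g).symm) (Equiv.bijective _) fun g => ?_
  exact (actMod_mul_right θ v γ g).symm

theorem phi_mem_forms (x : (Hat R)ˣ) {v : WPoly F} (hv : v ∈ V k) :
    phi R θ x v ∈ forms R θ k := by
  refine ⟨fun y => ?_, fun u hu y γ => ?_⟩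
  · refine finsum_induction (· ∈ V k) (zero_mem _) (fun _ _ => add_mem) ?_
    rintro ⟨g, hg⟩
    induction g using QuotientGroup.induction_on with
    | H β => exact act_mem_V θ hv β
  · rw [phi_apply_mul_diag, phi_normalizer_mul θ (hatUnits_le hu), phi_unit_mul θ (inv_mem hu)]

theorem exists_eq_of_phi_ne_zero {x y : (Hat R)ˣ} {v : WPoly F} (h : phi R θ x v y ≠ 0) :
    ∃ u ∈ hatUnits R, ∃ γ : Bˣ, y = u * x * diagUnits R γ := by
  obtain ⟨g, -⟩ : ∃ g : Gam R x y, actMod θ v (g : UnitsModScalars F B) ≠ 0 := by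
    by_contra! h0
    exact h (finsum_eq_zero_of_forall_eq_zero h0)
  obtain ⟨-, γ, -, hγ⟩ := g
  refine ⟨_, inv_mem hγ, γ, ?_⟩
  group

theorem scalarUnits_mem_hatNormalizer (c : (FiniteAdeleRing (𝓞 F) F)ˣ) :
    scalarUnits R c ∈ hatNormalizer R := by
  intro y
  have h : (scalarUnits R c : Hat R) * y * (((scalarUnits R c)⁻¹ : (Hat R)ˣ) : Hat R) = y := by
    change scalar R c * y * _ = y
    rw [scalar_comm, mul_assoc]
    change y * ((scalarUnits R c : Hat R) * (((scalarUnits R c)⁻¹ : (Hat R)ˣ) : Hat R)) = y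
    rw [Units.mul_inv, mul_one]
  rw [h]

/-! ### Translations and the height pairing -/

variable (F R) in
/-- The translation `(T_w φ)(x) = φ(w x)`. -/
def translate (w : (Hat R)ˣ) : ((Hat R)ˣ → WPoly F) ≃ₗ[ℂ] ((Hat R)ˣ → WPoly F) :=
  LinearEquiv.funCongrLeft ℂ (WPoly F) (Equiv.mulLeft w)

theorem translate_apply (w : (Hat R)ˣ) (φ : (Hat R)ˣ → WPoly F) (x : (Hat R)ˣ) :
    translate F R w φ x = φ (w * x) := rfl

/-- Translation is an equivalence, so it commutes with `finsum` even when the support is infinite.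
-/
theorem translate_finsum {α : Type*} (w : (Hat R)ˣ) (f : α → (Hat R)ˣ → WPoly F) :
    translate F R w (∑ᶠ i, f i) = ∑ᶠ i, translate F R w (f i) :=
  (translate F R w).toAddEquiv.map_finsum f

theorem translate_phi {w : (Hat R)ˣ} (hw : w ∈ hatNormalizer R) (x : (Hat R)ˣ) (v : WPoly F) :
    translate F R w (phi R θ x v) = phi R θ (w⁻¹ * x) v :=
  funext fun y => phi_normalizer_mul θ hw x y v

theorem slash_eq_translate (φ : (Hat R)ˣ → WPoly F) (z : Bil R) :
    slash φ z = translate F R (z.out : hatNormalizer R) φ := rfl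

theorem mk_out_eq (x : (Hat R)ˣ) : ∃ u ∈ hatUnits R, ∃ γ : Bˣ,
    (DoubleCoset.mk (hatUnits R) (diagUnits R).range x).out = u * x * diagUnits R γ := by
  obtain ⟨u, _, hu, ⟨γ, rfl⟩, h⟩ := DoubleCoset.mk_out_eq_mul (hatUnits R) (diagUnits R).range x
  exact ⟨u, hu, γ, h⟩

variable (R) in
/-- The permutation of `cl(R)` induced by left multiplication by an element of `N(R̂)`. -/
def classShift (w : hatNormalizer R) (c : OrderClasses R) : OrderClasses R :=
  DoubleCoset.mk (hatUnits R) (diagUnits R).range (w * c.out)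

theorem classShift_inv_classShift (w : hatNormalizer R) (c : OrderClasses R) :
    classShift R w⁻¹ (classShift R w c) = c := by
  obtain ⟨u, hu, γ, h⟩ := mk_out_eq ((w : (Hat R)ˣ) * c.out)
  rw [classShift, classShift, h]
  conv_rhs => rw [← DoubleCoset.out_eq' _ _ c]
  rw [DoubleCoset.eq]
  refine ⟨_, inv_mem ((conj_mem_hatUnits_iff (inv_mem w.2) u).2 hu), _,
    ⟨γ⁻¹, rfl⟩, ?_⟩
  rw [Subgroup.coe_inv, map_inv]
  group

theorem classShift_bijective (w : hatNormalizer R) : Function.Bijective (classShift R w) :=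
  Function.bijective_iff_has_inverse.2 ⟨classShift R w⁻¹, classShift_inv_classShift w, fun c => by
    simpa using classShift_inv_classShift w⁻¹ c⟩

/-- A sum over `cl(R)` is invariant under translation by `N(R̂)`. -/
theorem finsum_classes_translate {M : Type*} [AddCommMonoid M] {f : (Hat R)ˣ → M}
    (hf : ∀ u ∈ hatUnits R, ∀ x, ∀ γ : Bˣ, f (u * x * diagUnits R γ) = f x) (w : hatNormalizer R) :
    ∑ᶠ c : OrderClasses R, f (w * c.out) = ∑ᶠ c : OrderClasses R, f c.out := by
  refine finsum_eq_of_bijective (classShift R w) (classShift_bijective w) fun c => ?_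
  obtain ⟨u, hu, γ, h⟩ := mk_out_eq ((w : (Hat R)ˣ) * c.out)
  rw [classShift, h, hf u hu]

variable {θ k}

theorem height_summand_invariant {φ ψ : (Hat R)ˣ → WPoly F} (hφ : φ ∈ forms R θ k)
    (hψ : ψ ∈ forms R θ k) {u : (Hat R)ˣ} (hu : u ∈ hatUnits R) (x : (Hat R)ˣ) (γ : Bˣ) :
    ((wt R (u * x * diagUnits R γ) : ℂ))⁻¹ *
      fischer (φ (u * x * diagUnits R γ)) (ψ (u * x * diagUnits R γ)) =
    ((wt R x : ℂ))⁻¹ * fischer (φ x) (ψ x) := by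
  rw [hφ.2 u hu, hψ.2 u hu, fischer_act, wt_mul_diag, wt_normalizer_mul (hatUnits_le hu)]

/-- The pairing with a `Bil(R)`-invariant form is invariant under translation. -/
theorem height_translate {φ ψ : (Hat R)ˣ → WPoly F} (hφ : φ ∈ formsBil R θ k)
    (hψ : ψ ∈ forms R θ k) (w : hatNormalizer R) :
    height φ (translate F R w ψ) = height φ ψ := by
  refine Eq.trans (finsum_congr fun c => ?_) (finsum_classes_translate
    (f := fun x => ((wt R x : ℂ))⁻¹ * fischer (φ x) (ψ x))
    (fun u hu x γ => height_summand_invariant hφ.1.1 hψ hu x γ) w)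
  rw [translate_apply, hφ.2 w w.2, wt_normalizer_mul w.2]

/-- The set of classes that meet the support of a function. -/
def classSupport (ψ : (Hat R)ˣ → WPoly F) : Set (OrderClasses R) :=
  DoubleCoset.mk (hatUnits R) (diagUnits R).range '' Function.support ψ

/-- The form `φ_{x,v}` is supported on the double coset of `x`. Finiteness of class supports is what
makes the height pairing additive in its second variable. -/
theorem classSupport_phi_finite (x : (Hat R)ˣ) (v : WPoly F) :
    (classSupport (phi R θ x v)).Finite := by
  refine (Set.finite_singleton (DoubleCoset.mk (hatUnits R) (diagUnits R).range x)).subset ?_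
  rintro _ ⟨y, hy, rfl⟩
  obtain ⟨u, hu, γ, h⟩ := exists_eq_of_phi_ne_zero θ hy
  exact ((DoubleCoset.eq (hatUnits R) (diagUnits R).range x y).2 ⟨u, hu, _, ⟨γ, rfl⟩, h⟩).symm

/-- A `finsum` is either a finite sum or zero, so the index set need not be finite. -/
theorem classSupport_finsum_finite {α : Type*} {f : α → (Hat R)ˣ → WPoly F}
    (hf : ∀ i, (classSupport (f i)).Finite) : (classSupport (∑ᶠ i, f i)).Finite := by
  refine finsum_induction (fun ψ => (classSupport ψ).Finite) ?_ (fun φ ψ hφ hψ => ?_) hf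
  · simp [classSupport]
  · refine (hφ.union hψ).subset ?_
    rw [classSupport, classSupport, classSupport, ← Set.image_union]
    exact Set.image_mono (Function.support_add φ ψ)

theorem classSupport_smul_finite {ψ : (Hat R)ˣ → WPoly F} (hψ : (classSupport ψ).Finite) (a : ℂ) :
    (classSupport (a • ψ)).Finite :=
  hψ.subset (Set.image_mono (Function.support_const_smul_subset a ψ))

theorem height_sum {α : Type*} (s : Finset α) (φ : (Hat R)ˣ → WPoly F)
    (f : α → (Hat R)ˣ → WPoly F) (hf : ∀ i, (classSupport (f i)).Finite) :
    height φ (∑ i ∈ s, f i) = ∑ i ∈ s, height φ (f i) := by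
  simp only [height]
  rw [← finsum_sum_comm]
  · refine finsum_congr fun c => ?_
    rw [Finset.sum_apply, fischer_sum_right, Finset.mul_sum]
  · intro i _
    refine (hf i).subset fun c hc => ?_
    refine ⟨c.out, fun h => hc ?_, DoubleCoset.out_eq' _ _ c⟩
    change _ * fischer _ (f i c.out) = 0
    rw [h, fischer_zero_right, mul_zero]

end MinimalSupport

/-! ## The forms `η_D` and `ψ_{P_D}` -/

section Heegner

variable {F : Type*} [Field F] [NumberField F] {K : Type*} [Field K] [Algebra F K]
  {B : Type*} [Ring B] [Algebra F B] {R : Subalgebra (𝓞 F) B}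
  [FiniteDimensional F K] [IsOrder R] (θ : HamiltonIdent F B) (ι : IntegralEmbedding K R)
  {k : (F →+* ℝ) → ℕ} {v : WPoly F}

theorem act_gegenbauer {ω : K} (h : IsGegenbauer θ k (ι.toAlgHom ω) v) (c : Kˣ) :
    act θ (Units.map (ι.toAlgHom : K →* B) c) v = v :=
  h.act_eq (by
    change ι.toAlgHom c * ι.toAlgHom ω = ι.toAlgHom ω * ι.toAlgHom c
    rw [← map_mul, mul_comm, map_mul])

theorem hatUnitsMap_diagUnits (c : Kˣ) : ι.hatUnitsMap (diagUnits (maxOrder F K) c) =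
    diagUnits R (Units.map (ι.toAlgHom : K →* B) c) :=
  Units.ext (ι.hatMap_diag (c : K))

variable (hv : ∀ c : Kˣ, act θ (Units.map (ι.toAlgHom : K →* B) c) v = v)

include hv in
-- Representatives differ by a unit on the left, which does not matter, and by an element of `Kˣ` on
-- the right, which is absorbed because it fixes `v`.
theorem phi_eq_of_specialPoint_eq {x y : (Hat R)ˣ} (hx : x ∈ specialSet ι) (hy : y ∈ specialSet ι)
    (h : specialPoint ι x hx = specialPoint ι y hy) : phi R θ x v = phi R θ y v := by
  obtain ⟨u, hu, c, rfl⟩ := (specialPoint_eq_iff ι hx hy).1 h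
  conv_rhs => rw [hatUnitsMap_diagUnits, ← hv c, phi_mul_diag, phi_unit_mul θ hu]

/-- The form with minimal support attached to a special point. -/
def pointForm (v : WPoly F) (p : SpecialPoints ι) : (Hat R)ˣ → WPoly F :=
  phi R θ ((Quotient.out (s := specialSetoid ι) p : specialSet ι) : (Hat R)ˣ) v

include hv in
theorem pointForm_specialPoint {x : (Hat R)ˣ} (hx : x ∈ specialSet ι) :
    pointForm θ ι v (specialPoint ι x hx) = phi R θ x v :=
  phi_eq_of_specialPoint_eq θ ι hv _ hx (Quotient.out_eq (s := specialSetoid ι) _)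

include hv in
theorem translate_pointForm (w : hatNormalizer R) (p : SpecialPoints ι) :
    translate F R w (pointForm θ ι v p) = pointForm θ ι v (w⁻¹ • p) := by
  obtain ⟨x, hx, rfl⟩ := exists_specialPoint_eq ι p
  rw [normalizer_smul_specialPoint, pointForm_specialPoint θ ι hv, pointForm_specialPoint θ ι hv,
    translate_phi θ w.2]
  rfl

theorem eta_eq : eta θ ι v = ((unitIndex F K : ℂ))⁻¹ • ∑ᶠ p, pointForm θ ι v p := rfl

include hv in
/-- `η_D` is a `Bil(R)`-invariant form. -/
theorem eta_mem_formsBil (hV : v ∈ V k) : eta θ ι v ∈ formsBil R θ k := by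
  have hinv : ∀ w : hatNormalizer R, translate F R w (eta θ ι v) = eta θ ι v := fun w => by
    rw [eta_eq, map_smul, translate_finsum]
    congr 1
    exact finsum_eq_of_bijective (w⁻¹ • ·) (MulAction.bijective w⁻¹)
      fun p => translate_pointForm θ ι hv w p
  have hform : eta θ ι v ∈ forms R θ k :=
    Submodule.smul_mem _ _ (finsum_induction (· ∈ forms R θ k) (zero_mem _) (fun _ _ => add_mem)
      fun p => phi_mem_forms θ k _ hV)
  exact ⟨⟨hform, fun c x => congrFun (hinv ⟨_, scalarUnits_mem_hatNormalizer c⟩) x⟩,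
    fun z hz x => congrFun (hinv ⟨z, hz⟩) x⟩

theorem hatUnitsMap_mem_specialSet (a : (Hat (maxOrder F K))ˣ) :
    ι.hatUnitsMap a ∈ specialSet ι := by
  simpa using mul_hatUnitsMap_mem ι (one_mem_specialSet ι) a

theorem class_smul_one (a : (Hat (maxOrder F K))ˣ) :
    (QuotientGroup.mk a : ClassGp F K) • specialPoint ι 1 (one_mem_specialSet ι) =
      specialPoint ι (ι.hatUnitsMap a) (hatUnitsMap_mem_specialSet ι a) := by
  rw [class_smul_specialPoint]
  congr 1
  rw [one_mul]

include hv in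
theorem phi_hatUnitsMap (a : (Hat (maxOrder F K))ˣ) : phi R θ (ι.hatUnitsMap a) v =
    pointForm θ ι v
      ((QuotientGroup.mk a : ClassGp F K) • specialPoint ι 1 (one_mem_specialSet ι)) := by
  rw [class_smul_one, pointForm_specialPoint θ ι hv]

theorem psi_mem_forms (hV : v ∈ V k) : psi θ ι v ∈ forms R θ k :=
  Submodule.smul_mem _ _ (finsum_induction (· ∈ forms R θ k) (zero_mem _) (fun _ _ => add_mem)
    fun a => phi_mem_forms θ k _ hV)

include hv in
/-- `ψ_{P_D}` has trivial central character. -/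
theorem psi_mem_formsTrivial (hV : v ∈ V k) : psi θ ι v ∈ formsTrivial R θ k := by
  refine ⟨psi_mem_forms θ ι hV, fun c x => ?_⟩
  have h : translate F R (scalarUnits R c) (psi θ ι v) = psi θ ι v := by
    rw [psi, map_smul, translate_finsum]
    congr 1
    -- A central idele commutes past everything, so the translation becomes multiplication by its
    -- class in `cl(K)`, a permutation of the summands.
    refine finsum_eq_of_bijective
      ((QuotientGroup.mk (scalarUnits (maxOrder F K) c)⁻¹ : ClassGp F K) * ·)
      (Group.mulLeft_bijective _) fun a => ?_
    have hs : (scalarUnits R c)⁻¹ * ι.hatUnitsMap a.out =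
        ι.hatUnitsMap ((scalarUnits (maxOrder F K) c)⁻¹ * a.out) := by
      rw [map_mul, map_inv]
      congr 2
      exact Units.ext (ι.hatMap_scalar c).symm
    rw [translate_phi θ (scalarUnits_mem_hatNormalizer c), hs, phi_hatUnitsMap θ ι hv,
      phi_hatUnitsMap θ ι hv, QuotientGroup.out_eq', QuotientGroup.mk_mul, QuotientGroup.out_eq']
  exact congrFun h x

theorem slash_psi (z : Bil R) : slash (psi θ ι v) z = ((unitIndex F K : ℂ))⁻¹ •
    ∑ᶠ a : ClassGp F K,
      phi R θ (((z.out : hatNormalizer R) : (Hat R)ˣ)⁻¹ * ι.hatUnitsMap a.out) v := by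
  rw [slash_eq_translate, psi, map_smul, translate_finsum]
  congr 1
  exact finsum_congr fun a => translate_phi θ (z.out : hatNormalizer R).2 _ v

/-- A finite sum over a product, whose summands vanish uniformly in the first variable. -/
theorem finsum_prod_of_uniform {α β M : Type*} [Finite α] [Nonempty α] [AddCommMonoid M]
    {f : α → β → M} (S : Set β) (hf : ∀ a b, f a b ≠ 0 ↔ b ∈ S) :
    ∑ᶠ p : α × β, f p.1 p.2 = ∑ᶠ a, ∑ᶠ b, f a b := by
  by_cases hS : S.Finite
  · refine finsum_curry (fun p : α × β => f p.1 p.2) ?_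
    refine (Set.finite_univ.prod hS).subset fun p hp => ⟨trivial, (hf _ _).1 hp⟩
  -- If the common support is infinite, all inner sums and the double sum take the default value
  -- zero.
  · have h1 : ∀ a, ∑ᶠ b, f a b = 0 := fun a =>
      finsum_of_infinite_support fun h => hS (h.subset fun b hb => (hf a b).2 hb)
    obtain ⟨a₀⟩ := ‹Nonempty α›
    rw [finsum_eq_zero_of_forall_eq_zero h1]
    refine finsum_of_infinite_support fun h => hS ?_
    exact (h.image Prod.snd).subset fun b hb => ⟨(a₀, b), (hf a₀ b).2 hb, rfl⟩

include hv in
/-- If the special points are parametrised by `Bil(R) × cl(K)`, then `η_D` is the sum of the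
translates of `ψ_{P_D}`. -/
theorem eta_eq_finsum_slash [Finite (Bil R)]
    (hb : Function.Bijective fun p : Bil R × ClassGp F K => basePoint ι p.1 p.2) :
    eta θ ι v = ∑ᶠ z : Bil R, slash (psi θ ι v) z := by
  rw [finsum_congr (slash_psi θ ι), ← smul_finsum, eta_eq, ← finsum_comp _ hb]
  congr 1
  refine (finsum_congr fun p => ?_).trans (finsum_prod_of_uniform
    {a | phi R θ (ι.hatUnitsMap a.out) v ≠ 0} fun z a => ?_)
  · exact pointForm_specialPoint θ ι hv (basePoint_mem ι _ _)
  -- Translations are injective, so whether a summand vanishes does not depend on `z`.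
  · rw [← translate_phi θ (z.out : hatNormalizer R).2, Set.mem_ofPred_eq,
      (translate F R _).map_ne_zero_iff]

include hv in
/-- The height pairing of `η_D` with an invariant form. -/
theorem height_eta [Finite (Bil R)]
    (hb : Function.Bijective fun p : Bil R × ClassGp F K => basePoint ι p.1 p.2) (hV : v ∈ V k)
    {φ : (Hat R)ˣ → WPoly F} (hφ : φ ∈ formsBil R θ k) :
    height φ (eta θ ι v) = Nat.card (Bil R) * height φ (psi θ ι v) := by
  have := Fintype.ofFinite (Bil R)
  have hfin : ∀ z : Bil R, (classSupport (slash (psi θ ι v) z)).Finite := fun z => by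
    rw [slash_psi]
    exact classSupport_smul_finite (classSupport_finsum_finite fun a =>
      classSupport_phi_finite _ v) _
  rw [eta_eq_finsum_slash θ ι hv hb, finsum_eq_sum_of_fintype, height_sum _ _ _ hfin,
    Finset.sum_congr rfl fun z _ => height_translate hφ (psi_mem_forms θ ι hV) z.out,
    Finset.sum_const, Finset.card_univ, Nat.card_eq_fintype_card, nsmul_eq_mul]

end Heegner

/-! ### The order of `Bil(R)`. -/

section Card

variable {F : Type*} [Field F] [NumberField F] {B : Type*} [Ring B] [Algebra F B]
  {q : QuatStr F B} {R : Subalgebra (𝓞 F) B} [IsOrder R] {N : Ideal (𝓞 F)}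

theorem LocalModels.finite_bil (L : LocalModels q R N) : Finite (Bil R) := by
  have : Finite {v : HeightOneSpectrum (𝓞 F) // v.asIdeal ∣ N} := L.finite.to_subtype
  have : Finite ({v : HeightOneSpectrum (𝓞 F) // v.asIdeal ∣ N} → ZMod 2) := Pi.finite
  exact Finite.of_equiv _ (L.bilEquiv.toEquiv.trans Multiplicative.toAdd).symm

theorem LocalModels.card_bil (L : LocalModels q R N) :
    Nat.card (Bil R) = 2 ^ {v : HeightOneSpectrum (𝓞 F) | v.asIdeal ∣ N}.ncard := by
  have : Finite {v : HeightOneSpectrum (𝓞 F) // v.asIdeal ∣ N} := L.finite.to_subtype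
  rw [Nat.card_congr (L.bilEquiv.toEquiv.trans Multiplicative.toAdd), Nat.card_fun, Nat.card_zmod]
  rfl

end Card

end QuatForms

end

theorem mainTheorem8
    {F : Type*} [Field F] [NumberField F] [IsTotallyReal F]
    {B : Type*} [Ring B] [Algebra F B] [IsSimpleRing B] [Algebra.IsCentral F B]
    (hB : Module.finrank F B = 4) (θ : HamiltonIdent F B)
    (R : Subalgebra (𝓞 F) B) [IsOrder R]
    (N : Ideal (𝓞 F)) (hN : IsReducedDiscriminant R N)
    (hR : ∀ v : HeightOneSpectrum (𝓞 F), v.asIdeal ∣ N → eichlerInvariant R v ≠ 0)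
    (D : F) (hD : ∀ τ : F →+* ℝ, 0 < τ D)
    {K : Type*} [Field K] [Algebra F K] [FiniteDimensional F K]
    (δ : K) (hδ : δ ^ 2 = -algebraMap F K D) (hK : IntermediateField.adjoin F {δ} = ⊤)
    (ι : IntegralEmbedding K R)
    (k : (F →+* ℝ) → ℕ)
    (ω : K) (hω : Algebra.trace F K ω ^ 2 - 4 * Algebra.norm F ω = -D) :
    -- `Bil(R)` is elementary abelian of rank `ω(N)`
    Nonempty (Bil R ≃*
      Multiplicative ({v : HeightOneSpectrum (𝓞 F) // v.asIdeal ∣ N} → ZMod 2)) ∧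
    -- `cl(K)` acts freely on `X_D`
    (∀ (c : ClassGp F K) (x : SpecialPoints ι), c • x = x → c = 1) ∧
    -- `Bil(R)` acts transitively on `X_D / cl(K)`
    (Nonempty (SpecialClasses ι) ∧ MulAction.IsPretransitive (Bil R) (SpecialClasses ι)) ∧
    -- the polynomial `P_D` exists and is unique
    (∃! PD : WPoly F, IsGegenbauer θ k (ι.toAlgHom ω) PD) ∧
    (IsCoprime (relDiscriminant F K) N →
      -- `Bil(R)` acts freely on `X_D / cl(K)`
      (∀ (z : Bil R) (p : SpecialClasses ι), z • p = p → z = 1) ∧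
      ∀ PD : WPoly F, IsGegenbauer θ k (ι.toAlgHom ω) PD →
        psi θ ι PD ∈ formsTrivial R θ k ∧
        eta θ ι PD ∈ formsBil R θ k ∧
        eta θ ι PD = ∑ᶠ z : Bil R, slash (psi θ ι PD) z ∧
        ∀ φ ∈ formsBil R θ k,
          height φ (eta θ ι PD) =
            2 ^ {v : HeightOneSpectrum (𝓞 F) | v.asIdeal ∣ N}.ncard *
              height φ (psi θ ι PD)) := by
  obtain ⟨q, hq, -⟩ := exists_quatStr hB θ
  obtain ⟨L⟩ := exists_localModels q hq R hN hR
  have hsc := algebraMap_ne_of_sq hD hδ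
  have hD0 : D ≠ 0 := by
    rintro rfl
    refine hsc 0 ?_
    rw [map_zero, neg_zero] at hδ
    rw [map_zero, eq_comm]
    exact pow_eq_zero_iff two_ne_zero |>.1 hδ
  refine ⟨⟨L.bilEquiv⟩, class_free ι q,
    ⟨⟨specialClass ι (specialPoint ι 1 (one_mem_specialSet ι))⟩, bil_pretransitive L hδ hD0 hsc⟩,
    existsUnique_isGegenbauer θ k _, fun hcop => ⟨bil_free L hδ hD0 hsc hK hcop,
      fun PD hPD => ?_⟩⟩
  have := L.finite_bil
  have hv := act_gegenbauer θ ι hPD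
  have hb := bijective_basePoint (ι := ι) L hδ hD0 hsc hK hcop
  refine ⟨psi_mem_formsTrivial θ ι hv hPD.1, eta_mem_formsBil θ ι hv hPD.1,
    eta_eq_finsum_slash θ ι hv hb, fun φ hφ => ?_⟩
  rw [height_eta θ ι hv hb hPD.1 hφ, L.card_bil, Nat.cast_pow, Nat.cast_ofNat]
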